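/- Let $n,k>0$ be integers and $A_n=\{1<2<\dots<n\}$. A \emph{Young tableau} on $A_n$ is a finite sequence (from top to bottom) of non-empty non-decreasing words ("rows"), decreasing for the order $x_1\ldots x_s\succ y_1\ldots y_t \iff s\le t$ and $x_i>y_i$ for all $i\le s$; $\mathbf{YT}_{A_n}$ is the set of these, $\mathcal R(T)$ is the word obtained by reading the rows of $T$ from left to right, from top to bottom, $\operatorname{rows}(T)$ and $\operatorname{cols}(T)$ are the numbers of rows and columns, $\mathcal T(w)$ is the tableau obtained from $\emptyset$ by successive Schensted (right) insertion of the letters of the word $w$, and $T*T'$ is obtained by successive Schensted insertion of the letters of $\mathcal R(T')$ into $T$. Put $X=\mathbf{YT}_{A_n}\times\mathbb N_0$. \textbf{Braidings.} There are unique maps $\boldsymbol\sigma_R,\boldsymbol\sigma_C:X^2\to X^2$, written $((T_1,\alpha_1),(T_2,\alpha_2))\mapsto((T_2',\alpha_2'),(T_1',\alpha_1'))$, such that, respectively: for $\boldsymbol\sigma_R$, the rows of $T_2'$ followed by those of $T_1'$ form $T_1*T_2$; $\alpha_j'+\operatorname{rows}(T_j')=\alpha_j+\operatorname{rows}(T_j)$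 for $j=1,2$; and $\alpha_1'>0$ if and only if $\operatorname{rows}(T_1*T_2)<\alpha_1+\operatorname{rows}(T_1)$, in which case $T_2'=\emptyset$; for $\boldsymbol\sigma_C$, the columns of $T_2'$ followed by those of $T_1'$ form $T_1*T_2$; $\alpha_j'+\operatorname{cols}(T_j')=\alpha_j+\operatorname{cols}(T_j)$ for $j=1,2$; and $\alpha_2'>0$ if and only if $\operatorname{cols}(T_1*T_2)<\alpha_2+\operatorname{cols}(T_2)$, in which case $T_1'=\emptyset$. \textbf{Letter permuting operators.} For $1\le i<n$ and a word $w$ on $A_n$, consider the letters $i$ and $i+1$ of $w$ in their order, and repeatedly match and forget two consecutive letters $(i+1,i)$, in this order, where (last letter, first letter) counts as consecutive, until only $i$s or only $i+1$s are left; $s_i(w)$ is obtained from $w$ by changing the unmatched letters $i$ to $i+1$, or $i+1$ to $i$. On $X^k$ put $s_i((T_1,\alpha_1),\ldots,(T_k,\alpha_k))=((\widetilde T_1,\alpha_1),\ldots,(\widetilde T_k,\alpha_k))$, where $s_i(\mathcal R(T_1)\cdots\mathcal R(T_k))=\widetilde w_1\cdots\widetilde w_k$ with $\widetilde w_j$ of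 the same length as $\mathcal R(T_j)$, and $\widetilde T_j=\mathcal T(\widetilde w_j)$. \textbf{Theorem.} The set $X^k$ carries an action of the symmetric group $S_n$ in which the transposition $(i\ i{+}1)$ acts by $s_i$ for $1\le i<n$, and an action of the positive braid monoid $$B_k^+=\langle b_1,\ldots,b_{k-1}\mid b_ib_j=b_jb_i\ (|i-j|>1),\ b_ib_{i+1}b_i=b_{i+1}b_ib_{i+1}\rangle^+$$ in which $b_l$ acts by $\boldsymbol\sigma_R$ on the components $l,l+1$ and by the identity on the others. These two actions commute. Likewise $B_k^+$ acts on $X^k$ via $\boldsymbol\sigma_C$, and this action commutes with the $S_n$-action. -/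

import Mathlib

namespace Plactic

section Tableaux

variable {A : Type*} [LinearOrder A]

/-- The (strict) partial order on rows: `x₁ … x_s ≻ y₁ … y_t` iff `s ≤ t` and `x_i > y_i` for all
`i ≤ s`. -/
def RowGt (x y : List A) : Prop :=
  x.length ≤ y.length ∧ ∀ (i : ℕ) (hx : i < x.length) (hy : i < y.length), y[i] < x[i]

/-- A Young tableau on `A`: a finite decreasing sequence of non-empty non-decreasing words.
The rows are listed from top to bottom, in French notation (smaller rows at the bottom have larger
indices, i.e. the sequence is decreasing for `RowGt`). -/
@[ext]
structure YT (A : Type*) [LinearOrder A] where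
  /-- the rows, from top to bottom -/
  rows : List (List A)
  ne_nil : ∀ r ∈ rows, r ≠ []
  nondecreasing : ∀ r ∈ rows, r.Pairwise (· ≤ ·)
  decreasing : rows.Pairwise RowGt

theorem RowGt.trans {x y z : List A} (h : RowGt x y) (h' : RowGt y z) : RowGt x z :=
  ⟨h.1.trans h'.1, fun i hx hz =>
    (h'.2 i (lt_of_lt_of_le hx h.1) hz).trans (h.2 i hx (lt_of_lt_of_le hx h.1))⟩

/-- Schensted insertion of a letter `x` into a row `r`: if no letter of `r` exceeds `x`, attach `x`
at the end; otherwise replace by `x` the leftmost letter exceeding `x`, and return the replaced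
letter as second component. -/
def insertRow (x : A) (r : List A) : List A × Option A :=
  if h : r.findIdx (fun y => decide (x < y)) < r.length then
    (r.set (r.findIdx (fun y => decide (x < y))) x, some r[r.findIdx (fun y => decide (x < y))])
  else (r ++ [x], none)

/-- Schensted insertion into a list of rows, here listed from bottom to top: insert into the bottom
row, then insert the replaced letter (if any) into what remains above. -/
def insertRows (x : A) : List (List A) → List (List A)
  | [] => [[x]]
  | r :: up =>
    match insertRow x r with
    | (r', none) => r' :: up
    | (r', some y) => r' :: insertRows y up

theorem insertRow_cases (x : A) (r : List A) :
    (insertRow x r = (r ++ [x], none) ∧ ∀ y ∈ r, y ≤ x) ∨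
    (∃ (p : ℕ) (hp : p < r.length), insertRow x r = (r.set p x, some r[p]) ∧ x < r[p] ∧
      ∀ (j : ℕ) (hj : j < p), r[j] ≤ x) := by
  unfold insertRow
  split_ifs with h
  · right
    refine ⟨_, h, rfl, ?_, ?_⟩
    · simpa using List.findIdx_getElem (w := h)
    · intro j hj
      simpa using List.not_of_lt_findIdx hj
  · left
    refine ⟨rfl, fun y hy => ?_⟩
    by_contra hxy
    exact h (List.findIdx_lt_length_of_exists ⟨y, hy, by simpa using hxy⟩)

theorem set_nondecreasing {x : A} {r : List A} (hr : r.Pairwise (· ≤ ·)) (p : ℕ)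
    (hp : p < r.length) (h1 : x < r[p]) (h2 : ∀ (j : ℕ) (_ : j < p), r[j] ≤ x) :
    (r.set p x).Pairwise (· ≤ ·) := by
  rw [List.pairwise_iff_getElem] at hr ⊢
  intro i j hi hj hij
  simp only [List.length_set] at hi hj
  simp only [List.getElem_set]
  split_ifs with ha hb hb
  · exact le_rfl
  · subst ha
    exact h1.le.trans (hr _ _ hi hj hij)
  · subst hb
    exact h2 i hij
  · exact hr _ _ hi hj hij

theorem rowGt_bump {x : A} {r h : List A} {p : ℕ} (hp : p < r.length)
    (h1 : x < r[p]) (h2 : ∀ (j : ℕ) (_ : j < p), r[j] ≤ x)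
    (q : ℕ) (hq : q < h.length) (hqp : q ≤ p) (hlen : h.length ≤ r.length) (hy : h[q] = r[p])
    (hother : ∀ (j : ℕ) (hj : j < h.length), j ≠ q → r[j] < h[j]) :
    RowGt h (r.set p x) := by
  refine ⟨by simpa using hlen, fun i hi hi' => ?_⟩
  rw [List.getElem_set]
  by_cases hiq : i = q
  · subst hiq
    split_ifs with hpi
    · rw [hy]; exact h1
    · rw [hy]; exact (h2 i (by omega)).trans_lt h1
  · split_ifs with hpi
    · subst hpi; exact h1.trans (hother _ hi hiq)
    · exact hother i hi hiq

/-- Replacing a letter of the lower row by a smaller one preserves the relation. -/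
theorem rowGt_set_self {x : A} {r u : List A} (hur : RowGt u r) (p : ℕ) (hp : p < r.length)
    (h1 : x < r[p]) : RowGt u (r.set p x) := by
  refine ⟨by simpa using hur.1, fun i hi hi' => ?_⟩
  have hir : i < r.length := by simpa using hi'
  rw [List.getElem_set]
  split_ifs with hpi
  · subst hpi; exact h1.trans (hur.2 _ hi hir)
  · exact hur.2 i hi hir

theorem rowGt_append {x : A} {r u : List A} (hur : RowGt u r) : RowGt u (r ++ [x]) := by
  refine ⟨by have := hur.1; simp; omega, fun i hi hi' => ?_⟩
  have hir : i < r.length := lt_of_lt_of_le hi hur.1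
  rw [List.getElem_append_left hir]
  exact hur.2 i hi hir

theorem insertRows_ne_nil (x : A) (L : List (List A)) (hL : ∀ r ∈ L, r ≠ []) :
    ∀ r ∈ insertRows x L, r ≠ [] := by
  induction L generalizing x with
  | nil => simp [insertRows]
  | cons r up ih =>
    have hup : ∀ r ∈ up, r ≠ [] := fun s hs => hL s (List.mem_cons_of_mem _ hs)
    have hr : r ≠ [] := hL r List.mem_cons_self
    have h' : (insertRow x r).1 ≠ [] := by
      unfold insertRow
      split_ifs <;> simp [hr]
    intro s hs
    rcases hins : insertRow x r with ⟨r', _ | y⟩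
    all_goals
      rw [hins] at h'
      simp only [insertRows, hins, List.mem_cons] at hs
      rcases hs with rfl | hs
      · exact h'
    · exact hup s hs
    · exact ih y hup s hs

theorem insertRows_nondecreasing (x : A) (L : List (List A))
    (hL : ∀ r ∈ L, r.Pairwise (· ≤ ·)) :
    ∀ r ∈ insertRows x L, r.Pairwise (· ≤ ·) := by
  induction L generalizing x with
  | nil => simp [insertRows]
  | cons r up ih =>
    have hup : ∀ r ∈ up, r.Pairwise (· ≤ ·) := fun s hs => hL s (List.mem_cons_of_mem _ hs)
    have hr : r.Pairwise (· ≤ ·) := hL r List.mem_cons_self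
    intro s hs
    rcases insertRow_cases x r with ⟨hins, hle⟩ | ⟨p, hp, hins, h1, h2⟩
    · simp only [insertRows, hins, List.mem_cons] at hs
      rcases hs with rfl | hs
      · rw [List.pairwise_append]
        exact ⟨hr, by simp, fun a ha b hb => by simp at hb; subst hb; exact hle a ha⟩
      · exact hup s hs
    · simp only [insertRows, hins, List.mem_cons] at hs
      rcases hs with rfl | hs
      · exact set_nondecreasing hr p hp h1 h2
      · exact ih _ hup s hs

theorem insertRows_decreasing (x : A) (L : List (List A))
    (hL : ∀ r ∈ L, r.Pairwise (· ≤ ·)) (hd : L.Pairwise (fun r u => RowGt u r)) :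
    (insertRows x L).Pairwise (fun r u => RowGt u r) := by
  induction L generalizing x with
  | nil => simp [insertRows]
  | cons r up ih =>
    have hup : ∀ r ∈ up, r.Pairwise (· ≤ ·) := fun s hs => hL s (List.mem_cons_of_mem _ hs)
    have hr : r.Pairwise (· ≤ ·) := hL r List.mem_cons_self
    rw [List.pairwise_cons] at hd
    rcases insertRow_cases x r with ⟨hins, hle⟩ | ⟨p, hp, hins, h1, h2⟩
    · simp only [insertRows, hins]
      exact List.pairwise_cons.2 ⟨fun u hu => rowGt_append (hd.1 u hu), hd.2⟩
    · simp only [insertRows, hins]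
      have hrec := ih r[p] hup hd.2
      refine List.pairwise_cons.2 ⟨?_, hrec⟩
      -- it suffices to compare with the lowest row above
      suffices H : ∀ h tl, insertRows r[p] up = h :: tl → RowGt h (r.set p x) by
        intro u hu
        rcases heq : insertRows r[p] up with _ | ⟨h, tl⟩
        · simp [heq] at hu
        · rw [heq] at hu hrec
          rcases List.mem_cons.1 hu with rfl | hu
          · exact H _ _ heq
          · exact ((List.pairwise_cons.1 hrec).1 u hu).trans (H _ _ heq)
      intro h tl heq
      cases up with
      | nil =>
        simp only [insertRows, List.cons.injEq] at heq
        obtain ⟨rfl, -⟩ := heq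
        refine rowGt_bump hp h1 h2 0 (by simp) (Nat.zero_le _) (by simp; omega) rfl ?_
        intro j hj hj0
        simp at hj
        omega
      | cons u up' =>
        have hu : u.Pairwise (· ≤ ·) := hup u List.mem_cons_self
        have hur : RowGt u r := hd.1 u List.mem_cons_self
        rcases insertRow_cases r[p] u with ⟨hins', hle'⟩ | ⟨q, hq, hins', h1', h2'⟩
        · simp only [insertRows, hins', List.cons.injEq] at heq
          obtain ⟨rfl, -⟩ := heq
          have hlen : u.length ≤ p := by
            by_contra hlt
            have hlt' : p < u.length := not_le.1 hlt
            exact absurd (hle' _ (List.getElem_mem hlt')) (not_le.2 (hur.2 p hlt' hp))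
          refine rowGt_bump hp h1 h2 u.length (by simp) hlen (by simp; omega) (by simp) ?_
          intro j hj hjne
          have hj' : j < u.length := by simp at hj; omega
          rw [List.getElem_append_left hj']
          exact hur.2 j hj' _
        · simp only [insertRows, hins', List.cons.injEq] at heq
          obtain ⟨rfl, -⟩ := heq
          have hqp : q ≤ p := by
            by_contra hlt
            have hlt' : p < q := not_le.1 hlt
            exact absurd (h2' p hlt') (not_le.2 (hur.2 p (by omega) hp))
          refine rowGt_bump hp h1 h2 q (by simpa using hq) hqp (by simpa using hur.1) (by simp) ?_
          intro j hj hjne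
          rw [List.getElem_set_ne (Ne.symm hjne)]
          exact hur.2 j (by simpa using hj) _

namespace YT

/-- The empty tableau. -/
def empty : YT A := ⟨[], by simp, by simp, List.Pairwise.nil⟩

/-- Right Schensted insertion of a letter into a Young tableau. -/
def insert (T : YT A) (x : A) : YT A where
  rows := (insertRows x T.rows.reverse).reverse
  ne_nil r hr := insertRows_ne_nil x T.rows.reverse (fun s hs => T.ne_nil s (by simpa using hs))
    r (by simpa using hr)
  nondecreasing r hr := insertRows_nondecreasing x T.rows.reverse
    (fun s hs => T.nondecreasing s (by simpa using hs)) r (by simpa using hr)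
  decreasing := List.pairwise_reverse.2 <| insertRows_decreasing x T.rows.reverse
    (fun s hs => T.nondecreasing s (by simpa using hs)) (List.pairwise_reverse.2 T.decreasing)

/-- The insertion map `𝓘 : YT × A* → YT`. -/
def insertWord (T : YT A) (w : List A) : YT A := w.foldl insert T

/-- The tableau map `𝓣 : A* → YT`. -/
def ofWord (w : List A) : YT A := insertWord empty w

/-- The row map `𝓡 : YT → A*`: the rows are read from left to right, from top to bottom. -/
def rowReading (T : YT A) : List A := T.rows.flatten

/-- The product `T ∗ T' = 𝓘(T, 𝓡(T'))` of tableaux. -/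
def prod (T T' : YT A) : YT A := insertWord T T'.rowReading

/-- The number of rows. -/
def numRows (T : YT A) : ℕ := T.rows.length

/-- The number of columns, i.e. the length of the last (bottom, longest) row. -/
def numCols (T : YT A) : ℕ := (T.rows.getLast?.getD []).length

/-- The `j`-th column (counting from `0`), read from top to bottom. -/
def col (T : YT A) (j : ℕ) : List A := T.rows.filterMap (fun r => r[j]?)

/-- The list of columns, from left to right. -/
def cols (T : YT A) : List (List A) := (List.range T.numCols).map T.col

/-- The tableau formed by the top `m` rows. -/
def takeRows (m : ℕ) (T : YT A) : YT A where
  rows := T.rows.take m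
  ne_nil r hr := T.ne_nil r (List.mem_of_mem_take hr)
  nondecreasing r hr := T.nondecreasing r (List.mem_of_mem_take hr)
  decreasing := T.decreasing.sublist (List.take_sublist _ _)

/-- The tableau formed by all rows but the top `m` ones. -/
def dropRows (m : ℕ) (T : YT A) : YT A where
  rows := T.rows.drop m
  ne_nil r hr := T.ne_nil r (List.mem_of_mem_drop hr)
  nondecreasing r hr := T.nondecreasing r (List.mem_of_mem_drop hr)
  decreasing := T.decreasing.sublist (List.drop_sublist _ _)

/-- The tableau formed by the leftmost `m` columns. -/
def takeCols (m : ℕ) (T : YT A) : YT A where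
  rows := (T.rows.map (List.take m)).filter (fun r => decide (r ≠ []))
  ne_nil r hr := by simpa using (List.mem_filter.1 hr).2
  nondecreasing r hr := by
    obtain ⟨s, hs, rfl⟩ := List.mem_map.1 (List.mem_filter.1 hr).1
    exact (T.nondecreasing s hs).sublist (List.take_sublist _ _)
  decreasing := by
    refine List.Pairwise.filter _ (List.Pairwise.map _ ?_ T.decreasing)
    intro x y h
    refine ⟨by have := h.1; simp; omega, fun i hx hy => ?_⟩
    simp only [List.getElem_take]
    simp only [List.length_take] at hx hy
    exact h.2 i (by omega) (by omega)

/-- The tableau formed by all columns but the leftmost `m` ones. -/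
def dropCols (m : ℕ) (T : YT A) : YT A where
  rows := (T.rows.map (List.drop m)).filter (fun r => decide (r ≠ []))
  ne_nil r hr := by simpa using (List.mem_filter.1 hr).2
  nondecreasing r hr := by
    obtain ⟨s, hs, rfl⟩ := List.mem_map.1 (List.mem_filter.1 hr).1
    exact (T.nondecreasing s hs).sublist (List.drop_sublist _ _)
  decreasing := by
    refine List.Pairwise.filter _ (List.Pairwise.map _ ?_ T.decreasing)
    intro x y h
    refine ⟨by have := h.1; simp; omega, fun i hx hy => ?_⟩
    simp only [List.getElem_drop]
    simp only [List.length_drop] at hx hy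
    exact h.2 _ (by omega) (by omega)

end YT

end Tableaux

section Braidings

/-- `ℕ₀`-decorated Young tableaux on `A`. -/
abbrev DecYT (A : Type*) [LinearOrder A] : Type _ := YT A × ℕ

variable {A : Type*} [LinearOrder A]

/-- The conditions characterizing `((T₂', α₂'), (T₁', α₁')) = σ_R ((T₁, α₁), (T₂, α₂))`. -/
structure IsSigmaR (T₁ : YT A) (α₁ : ℕ) (T₂ : YT A) (α₂ : ℕ)
    (T₂' : YT A) (α₂' : ℕ) (T₁' : YT A) (α₁' : ℕ) : Prop where
  rows_append : T₂'.rows ++ T₁'.rows = (T₁.prod T₂).rows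
  size_one : α₁' + T₁'.numRows = α₁ + T₁.numRows
  size_two : α₂' + T₂'.numRows = α₂ + T₂.numRows
  pos_iff : 0 < α₁' ↔ (T₁.prod T₂).numRows < α₁ + T₁.numRows
  eq_empty : 0 < α₁' → T₂' = YT.empty

/-- The conditions characterizing `((T₂', α₂'), (T₁', α₁')) = σ_C ((T₁, α₁), (T₂, α₂))`. -/
structure IsSigmaC (T₁ : YT A) (α₁ : ℕ) (T₂ : YT A) (α₂ : ℕ)
    (T₂' : YT A) (α₂' : ℕ) (T₁' : YT A) (α₁' : ℕ) : Prop where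
  cols_append : T₂'.cols ++ T₁'.cols = (T₁.prod T₂).cols
  size_one : α₁' + T₁'.numCols = α₁ + T₁.numCols
  size_two : α₂' + T₂'.numCols = α₂ + T₂.numCols
  pos_iff : 0 < α₂' ↔ (T₁.prod T₂).numCols < α₂ + T₂.numCols
  eq_empty : 0 < α₂' → T₁' = YT.empty

/-- The row insertion braiding: `T₁'` consists of the last `α₁ + rows T₁` rows of `T₁ ∗ T₂`
(of all of them if there are fewer), and `T₂'` of the rows above. -/
def sigmaR (p : DecYT A × DecYT A) : DecYT A × DecYT A :=
  let P := p.1.1.prod p.2.1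
  let m₁ := p.1.2 + p.1.1.numRows
  let m₂ := p.2.2 + p.2.1.numRows
  let T₂' := P.takeRows (P.numRows - m₁)
  let T₁' := P.dropRows (P.numRows - m₁)
  ((T₂', m₂ - T₂'.numRows), (T₁', m₁ - T₁'.numRows))

/-- The column insertion braiding: `T₂'` consists of the first `α₂ + cols T₂` columns of `T₁ ∗ T₂`
(of all of them if there are fewer), and `T₁'` of the columns to the right. -/
def sigmaC (p : DecYT A × DecYT A) : DecYT A × DecYT A :=
  let P := p.1.1.prod p.2.1
  let m₁ := p.1.2 + p.1.1.numCols
  let m₂ := p.2.2 + p.2.1.numCols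
  let T₂' := P.takeCols m₂
  let T₁' := P.dropCols m₂
  ((T₂', m₂ - T₂'.numCols), (T₁', m₁ - T₁'.numCols))

/-- The relations of the positive braid monoid on generators `b₀, …, b_{k-2}`. -/
inductive BraidRel (k : ℕ) : FreeMonoid (Fin (k - 1)) → FreeMonoid (Fin (k - 1)) → Prop
  | far (i j : Fin (k - 1)) (h : i.val + 1 < j.val) :
      BraidRel k (FreeMonoid.of i * FreeMonoid.of j) (FreeMonoid.of j * FreeMonoid.of i)
  | near (i j : Fin (k - 1)) (h : i.val + 1 = j.val) :
      BraidRel k (FreeMonoid.of i * FreeMonoid.of j * FreeMonoid.of i)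
        (FreeMonoid.of j * FreeMonoid.of i * FreeMonoid.of j)

/-- The positive braid monoid `B_k^+` on `k` strands (for `k ≥ 1`). -/
abbrev PosBraidMonoid (k : ℕ) : Type := PresentedMonoid (BraidRel k)

/-- The `l`-th generator of `B_k^+` (counting from `0`). -/
def braidGen (k : ℕ) (l : Fin (k - 1)) : PosBraidMonoid k := PresentedMonoid.of (BraidRel k) l

/-- `Id × … × σ × … × Id` on `X^k`, where `σ` is applied to the components `l` and `l + 1`
(counting from `0`). -/
def applyAt {X : Type*} {k : ℕ} (σ : X × X → X × X) (l : Fin (k - 1)) (x : Fin k → X) :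
    Fin k → X := fun j =>
  if j.val = l.val then
    (σ (x ⟨l.val, by have := l.isLt; omega⟩, x ⟨l.val + 1, by have := l.isLt; omega⟩)).1
  else if j.val = l.val + 1 then
    (σ (x ⟨l.val, by have := l.isLt; omega⟩, x ⟨l.val + 1, by have := l.isLt; omega⟩)).2
  else x j

end Braidings

section LetterPermuting

variable {A : Type*} [DecidableEq A]

/-- Given the letters `a` and `b` occurring in a word, together with their positions, match
repeatedly consecutive letters `b a` (in this order), and forget them, as long as possible.
The list of remaining letters is returned. -/
def matchInner (a b : A) : List (A × ℕ) → List (A × ℕ)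
  | [] => []
  | p :: t =>
    match matchInner a b t with
    | [] => [p]
    | q :: t' => if p.1 = b ∧ q.1 = a then t' else p :: q :: t'

/-- Match repeatedly the last and the first letter, if these are `b` and `a` respectively,
and forget them, as long as possible. The list of remaining letters is returned. -/
def matchOuter (a b : A) : List (A × ℕ) → List (A × ℕ)
  | [] => []
  | p :: t =>
    if p.1 = a ∧ t.getLast?.map Prod.fst = some b then matchOuter a b t.dropLast else p :: t
termination_by u => u.length
decreasing_by simp

/-- The positions of the unmatched letters `a`, `b` in a word `w`, after matching consecutive
letters `b a`, where the couple (last letter, first letter) is considered consecutive. The final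
matching does not depend on the order in which pairs are matched; the pairs consecutive in the
usual sense are treated first, which leaves a word `a … a b … b`. -/
def unmatched (a b : A) (w : List A) : List ℕ :=
  (matchOuter a b (matchInner a b
    (w.zipIdx.filter (fun p => decide (p.1 = a ∨ p.1 = b))))).map Prod.snd

/-- The operator on words which changes all the unmatched letters `a` to `b`, and all the unmatched
letters `b` to `a` (only one of the two cases occurs). -/
def permuteWord (a b : A) (w : List A) : List A :=
  w.mapIdx fun j x => if j ∈ unmatched a b w then (if x = a then b else a) else x

/-- The letter permuting operator `s_i` on words in the alphabet `Fin n`. Letters are counted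
from `0`, so that it concerns the letters `i` and `i + 1` for `0 ≤ i < n - 1`. -/
def sWord {n : ℕ} (i : ℕ) (hi : i + 1 < n) (w : List (Fin n)) : List (Fin n) :=
  permuteWord (⟨i, by omega⟩ : Fin n) ⟨i + 1, hi⟩ w

/-- The letter permuting operator `s_i` on `k`-tuples of decorated tableaux: apply `s_i` to the
concatenation of the words `𝓡(T_1), …, 𝓡(T_k)`, cut the result into words of the same lengths,
and turn these into tableaux; decorations are kept. -/
def sTuple {n k : ℕ} (i : ℕ) (hi : i + 1 < n) (x : Fin k → DecYT (Fin n)) :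
    Fin k → DecYT (Fin n) := fun j =>
  (YT.ofWord
    (((sWord i hi (List.ofFn fun m => (x m).1.rowReading).flatten).drop
      (∑ m ∈ Finset.Iio j, (x m).1.rowReading.length)).take (x j).1.rowReading.length),
    (x j).2)

end LetterPermuting

end Plactic

/-! The decoration of a tableau counts empty rows: `(T, α)` is encoded as the rows of `T` with `α`
empty rows on top, that is, as a tableau with a fixed number of possibly empty rows. In this
encoding `sigmaR` becomes `sig`: form the product tableau with all available rows and cut off as
many top rows as the second factor has. A plactic class contains only one tableau with a given
number of rows (`Tab.eq_of_ke`). Right multiplication works upwards from the bottom rows, left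
multiplication downwards from the top rows (`norm_append_right`, `norm_append_left`). Hence both
sides of the Yang–Baxter equation cut the tableau of a triple product into the same blocks
(`sig_braid`).

Commutation rests on dual equivalence. Insertion is a sequence of elementary Knuth swaps, and both
the positions of these swaps and the resulting shapes depend only on the descents of the words met
on the way (`SameQ.ins`, `SameQ.norm`). A letter permuting operator preserves descents and commutes
with Knuth swaps at every position (`natOp_flip`). It therefore commutes with the normalisation of
two adjacent factors and preserves all row lengths. Since a tuple is determined by its word and its
row lengths, the operator commutes with the braiding (`Realizes.applyAt`).

The Coxeter relations are verified on words. For the braid relation, two natural operators agree on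
a word as soon as they agree on its tableau (`NatOp.eq_of_norm`), so tableaux in three letters
suffice, where the relation is an identity between piecewise linear formulas (`threeRows_braid`).
The Coxeter presentation of the symmetric group then yields the action (`exists_hom_of_coxeterRel`).

For columns, the theory of insertion is developed for a comparison `r` that may be `<` or `≤`.
Reversing words turns columns into rows for `≤` and exchanges the factors of a product, so `sigmaC`
is, up to a mirror symmetry, again an instance of `sig`. -/

namespace Plactic

/-! ### Row insertion for a strict or a weak comparison -/

section Generic

variable {A : Type*}

/-- The properties shared by a strict and a non-strict linear order which the theory of row
insertion needs. -/
structure Bumping (r : A → A → Prop) : Prop where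
  trans : ∀ {x y z}, r x y → r y z → r x z
  neg_trans : ∀ {x y z}, ¬ r x y → ¬ r y z → ¬ r x z

theorem Bumping.lt [LinearOrder A] : Bumping (fun x y : A => x < y) :=
  ⟨fun h h' => lt_trans h h', fun h h' => by rw [not_lt] at *; exact h'.trans h⟩

theorem Bumping.le [LinearOrder A] : Bumping (fun x y : A => x ≤ y) :=
  ⟨fun h h' => le_trans h h', fun h h' => by rw [not_le] at *; exact h'.trans h⟩

variable {r : A → A → Prop}

theorem Bumping.left (h : Bumping r) {x y z : A} (h1 : r x y) (h2 : ¬ r z y) : r x z := by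
  by_contra h3
  exact h.neg_trans h3 h2 h1

theorem Bumping.right (h : Bumping r) {x y z : A} (h1 : ¬ r y x) (h2 : r y z) : r x z := by
  by_contra h3
  exact h.neg_trans h1 h3 h2

/-- Rows for the comparison `r`: no letter bumps a preceding one. -/
abbrev Sorted (r : A → A → Prop) (l : List A) : Prop := l.Pairwise fun x y => ¬ r y x

/-- The row `x` can be stacked on top of the row `y`. -/
def Above (r : A → A → Prop) : List A → List A → Prop
  | [], _ => True
  | _ :: _, [] => False
  | a :: x, b :: y => r b a ∧ Above r x y

@[simp] theorem above_nil (y : List A) : Above r [] y := by cases y <;> trivial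
@[simp] theorem not_above_nil (a : A) (x : List A) : ¬ Above r (a :: x) [] := id
@[simp] theorem above_cons (a b : A) (x y : List A) :
    Above r (a :: x) (b :: y) ↔ r b a ∧ Above r x y := Iff.rfl

theorem Above.length_le {x y : List A} (h : Above r x y) : x.length ≤ y.length := by
  induction x generalizing y with
  | nil => simp
  | cons a x ih =>
    cases y with
    | nil => simp at h
    | cons b y => simpa using ih h.2

theorem Above.cons_of_sorted (h : Bumping r) {x y : List A} (hxy : Above r x y) {a : A}
    (ha : Sorted r (a :: y)) : Above r x (a :: y) := by
  induction x generalizing y a with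
  | nil => simp
  | cons b x ih =>
    cases y with
    | nil => simp at hxy
    | cons c y =>
      rw [Sorted, List.pairwise_cons] at ha
      exact ⟨h.right (ha.1 c (by simp)) hxy.1, ih hxy.2 ha.2⟩

variable [DecidableRel r]

/-- Insertion of a letter into a row. The list of bumped letters (at most one) and the new row are
returned. -/
def ins (r : A → A → Prop) [DecidableRel r] (x : A) : List A → List A × List A
  | [] => ([], [x])
  | a :: u => if r x a then ([a], x :: u) else ((ins r x u).1, a :: (ins r x u).2)

/-- Insertion of a word into a row. The word of bumped letters and the new row are returned. -/
def insW (r : A → A → Prop) [DecidableRel r] : List A → List A → List A × List A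
  | [], u => ([], u)
  | x :: w, u => ((ins r x u).1 ++ (insW r w (ins r x u).2).1, (insW r w (ins r x u).2).2)

/-- Insertion of a word into a list of rows, given from top to bottom, starting with the bottom
row. The word bumped out of the top row and the new rows are returned. -/
def insRows (r : A → A → Prop) [DecidableRel r] :
    List A → List (List A) → List A × List (List A)
  | w, [] => (w, [])
  | w, l :: L => ((insW r (insRows r w L).1 l).1,
      (insW r (insRows r w L).1 l).2 :: (insRows r w L).2)

/-- Left multiplication of a list of rows (from top to bottom) by a row. The new rows but the
bottom one, and the new bottom row, are returned. -/
def pass (r : A → A → Prop) [DecidableRel r] :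
    List A → List (List A) → List (List A) × List A
  | u, [] => ([], u)
  | u, l :: L => ((insW r l u).1 :: (pass r (insW r l u).2 L).1, (pass r (insW r l u).2 L).2)

/-- The tableau with as many (possibly empty) rows as `L` obtained from the product of the
elements of `L`. -/
def norm (r : A → A → Prop) [DecidableRel r] : List (List A) → List (List A)
  | [] => []
  | l :: L => (pass r l (norm r L)).1 ++ [(pass r l (norm r L)).2]

@[simp] theorem insW_nil (u : List A) : insW r [] u = ([], u) := rfl

theorem insW_append (w w' u : List A) : insW r (w ++ w') u =
    ((insW r w u).1 ++ (insW r w' (insW r w u).2).1, (insW r w' (insW r w u).2).2) := by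
  induction w generalizing u with
  | nil => simp
  | cons x w ih => simp [insW, ih]

theorem insW_cons_of_not {w : List A} {a : A} (hw : ∀ x ∈ w, ¬ r x a) (u : List A) :
    insW r w (a :: u) = ((insW r w u).1, a :: (insW r w u).2) := by
  induction w generalizing u with
  | nil => rfl
  | cons x w ih =>
    simp only [List.mem_cons, forall_eq_or_imp] at hw
    simp [insW, ins, hw.1, ih hw.2]

/-- Once `x` has displaced `a`, no later letter of a sorted word can displace `x`, so the rest acts
on `u` alone. Together with `insW_cons_skip` this lets inductions run along the row rather than
along the inserted word. -/
theorem insW_cons_cons {x : A} {w : List A} (hw : Sorted r (x :: w)) {a : A} (hxa : r x a)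
    (u : List A) :
    insW r (x :: w) (a :: u) = (a :: (insW r w u).1, x :: (insW r w u).2) := by
  have := insW_cons_of_not (List.pairwise_cons.1 hw).1 u
  simp [insW, ins, hxa, this]

theorem insW_cons_skip (h : Bumping r) {x : A} {w : List A} (hw : Sorted r (x :: w)) {a : A}
    (hxa : ¬ r x a) (u : List A) :
    insW r (x :: w) (a :: u) = ((insW r (x :: w) u).1, a :: (insW r (x :: w) u).2) := by
  refine insW_cons_of_not ?_ u
  intro y hy
  rcases List.mem_cons.1 hy with rfl | hy
  · exact hxa
  · exact h.neg_trans ((List.pairwise_cons.1 hw).1 y hy) hxa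

theorem mem_ins {x a : A} {u : List A} (h : a ∈ (ins r x u).2) : a = x ∨ a ∈ u := by
  induction u with
  | nil => simpa [ins] using h
  | cons b u ih =>
    unfold ins at h
    split_ifs at h <;> simp at h ⊢ <;> tauto

theorem mem_ins_fst {x a : A} {u : List A} (h : a ∈ (ins r x u).1) : r x a ∧ a ∈ u := by
  induction u with
  | nil => simp [ins] at h
  | cons b u ih =>
    unfold ins at h
    split_ifs at h <;> simp at h ⊢
    · subst h; exact ⟨by assumption, by simp⟩
    · have := ih h; tauto

theorem ins_fst_cases (c : A) (y : List A) :
    (ins r c y).1 = [] ∨ ∃ d, (ins r c y).1 = [d] := by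
  induction y with
  | nil => simp [ins]
  | cons b y ih => unfold ins; split_ifs <;> simp [ih]

theorem sorted_ins (h : Bumping r) (x : A) {u : List A} (hu : Sorted r u) :
    Sorted r (ins r x u).2 := by
  induction u with
  | nil => simp [ins]
  | cons a u ih =>
    rw [Sorted, List.pairwise_cons] at hu
    unfold ins
    split_ifs with hxa
    · refine List.pairwise_cons.2 ⟨fun b hb hbx => hu.1 b hb (h.trans hbx hxa), hu.2⟩
    · refine List.pairwise_cons.2 ⟨fun b hb => ?_, ih hu.2⟩
      rcases mem_ins hb with rfl | hb
      · exact hxa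
      · exact hu.1 b hb

theorem sorted_insW (h : Bumping r) (w : List A) {u : List A} (hu : Sorted r u) :
    Sorted r (insW r w u).2 := by
  induction w generalizing u with
  | nil => exact hu
  | cons x w ih => exact ih (sorted_ins h x hu)

theorem insW_empty {w : List A} (hw : Sorted r w) : insW r w [] = ([], w) := by
  induction w with
  | nil => rfl
  | cons x w ih =>
    have hw' := List.pairwise_cons.1 hw
    simp [insW, ins, insW_cons_of_not hw'.1, ih hw'.2]

theorem mem_of_mem_insW_fst (h : Bumping r) {b : A} {w u : List A} (hw : Sorted r w)
    (hb : b ∈ (insW r w u).1) : b ∈ u := by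
  induction u generalizing w with
  | nil => simp [insW_empty hw] at hb
  | cons a u ih =>
    cases w with
    | nil => simp at hb
    | cons x w =>
      by_cases hxa : r x a
      · rw [insW_cons_cons hw hxa] at hb
        rcases List.mem_cons.1 hb with rfl | hb
        · simp
        · exact List.mem_cons_of_mem _ (ih (List.pairwise_cons.1 hw).2 hb)
      · rw [insW_cons_skip h hw hxa] at hb
        exact List.mem_cons_of_mem _ (ih hw hb)

theorem sorted_insW_fst (h : Bumping r) {w u : List A} (hw : Sorted r w) (hu : Sorted r u) :
    Sorted r (insW r w u).1 := by
  induction u generalizing w with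
  | nil => simp [insW_empty hw]
  | cons a u ih =>
    cases w with
    | nil => simp
    | cons x w =>
      have hu' := List.pairwise_cons.1 hu
      have hw' := List.pairwise_cons.1 hw
      by_cases hxa : r x a
      · rw [insW_cons_cons hw hxa]
        exact List.pairwise_cons.2
          ⟨fun b hb => hu'.1 b (mem_of_mem_insW_fst h hw'.2 hb), ih hw'.2 hu'.2⟩
      · rw [insW_cons_skip h hw hxa]
        exact ih hw hu'.2

theorem insW_length (w u : List A) :
    (insW r w u).1.length + (insW r w u).2.length = w.length + u.length := by
  induction w generalizing u with
  | nil => simp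
  | cons x w ih =>
    have h1 := ih (ins r x u).2
    have h2 : (ins r x u).1.length + (ins r x u).2.length = u.length + 1 := by
      clear h1
      induction u with
      | nil => simp [ins]
      | cons a u ih => unfold ins; split_ifs <;> simp <;> omega
    simp [insW]
    omega

/-- The row bumped out by inserting a row can be stacked on the new row. -/
theorem above_insW (h : Bumping r) {w u : List A} (hw : Sorted r w) (hu : Sorted r u) :
    Above r (insW r w u).1 (insW r w u).2 := by
  induction u generalizing w with
  | nil => simp [insW_empty hw]
  | cons a u ih =>
    cases w with
    | nil => simp
    | cons x w =>
      have hu' := List.pairwise_cons.1 hu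
      have hw' := List.pairwise_cons.1 hw
      by_cases hxa : r x a
      · rw [insW_cons_cons hw hxa]
        exact ⟨hxa, ih hw'.2 hu'.2⟩
      · have hs := sorted_insW h (x :: w) hu
        rw [insW_cons_skip h hw hxa] at hs ⊢
        exact (ih hw hu'.2).cons_of_sorted h hs

/-- Dropping the first inserted letter and putting `b` in front makes the bumped word entrywise no
larger, because `b` precedes `u` in a sorted row. This is the case of `above_insW_insW` in which
only the lower row displaces the head. -/
theorem above_cons_insW (h : Bumping r) {y b : A} {w u Z : List A} (hw : Sorted r (y :: w))
    (hu : Sorted r (b :: u)) (hZ : Above r Z (insW r (y :: w) u).1) :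
    Above r Z (b :: (insW r w u).1) := by
  induction u generalizing w b y Z with
  | nil =>
    rw [insW_empty hw] at hZ
    cases Z with
    | nil => simp
    | cons z Z => simp at hZ
  | cons c u ih =>
    have hu' := List.pairwise_cons.1 hu
    have hw' := List.pairwise_cons.1 hw
    by_cases hyc : r y c
    · rw [insW_cons_cons hw hyc] at hZ
      cases Z with
      | nil => simp
      | cons z Z =>
        refine ⟨h.right (hu'.1 c (by simp)) hZ.1, ?_⟩
        cases w with
        | nil => simpa using hZ.2
        | cons y2 w =>
          by_cases hy2 : r y2 c
          · rw [insW_cons_cons hw'.2 hy2]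
            exact ih hw'.2 hu'.2 hZ.2
          · rw [insW_cons_skip h hw'.2 hy2]
            exact hZ.2
    · rw [insW_cons_skip h hw hyc] at hZ
      rw [insW_cons_of_not fun x hx => h.neg_trans (hw'.1 x hx) hyc]
      exact ih hw (hu.sublist (by simp)) hZ

/-- Inserting two stacked rows, starting with the top one, bumps out two stacked rows. -/
theorem above_insW_insW (h : Bumping r) {w v u : List A} (hw : Sorted r w) (hv : Sorted r v)
    (hu : Sorted r u) (hwv : Above r w v) :
    Above r (insW r w u).1 (insW r v (insW r w u).2).1 := by
  induction u generalizing w v with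
  | nil => simp [insW_empty hw]
  | cons a u ih =>
    have hu' := List.pairwise_cons.1 hu
    rcases w with _ | ⟨x, w⟩
    · simp
    rcases v with _ | ⟨y, v⟩
    · simp at hwv
    have hw' := List.pairwise_cons.1 hw
    have hv' := List.pairwise_cons.1 hv
    by_cases hxa : r x a
    · rw [insW_cons_cons hw hxa, insW_cons_cons hv hwv.1]
      exact ⟨hxa, ih hw'.2 hv'.2 hu'.2 hwv.2⟩
    · have hs := sorted_insW h (x :: w) hu
      rw [insW_cons_skip h hw hxa] at hs ⊢
      have := ih hw hv hu'.2 hwv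
      by_cases hya : r y a
      · rw [insW_cons_cons hv hya]
        exact above_cons_insW h hv hs this
      · rw [insW_cons_skip h hv hya]
        exact this

theorem insW_of_above {x y : List A} (hy : Sorted r y) (hxy : Above r x y) :
    insW r y x = (x, y) := by
  induction x generalizing y with
  | nil => exact insW_empty hy
  | cons a x ih =>
    rcases y with _ | ⟨b, y⟩
    · simp at hxy
    rw [insW_cons_cons hy hxy.1, ih (List.pairwise_cons.1 hy).2 hxy.2]

theorem length_insW_fst_le (h : Bumping r) {y : List A} (hy : Sorted r y) (x : List A) :
    (insW r y x).1.length ≤ x.length := by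
  induction x generalizing y with
  | nil => simp [insW_empty hy]
  | cons a x ih =>
    rcases y with _ | ⟨b, y⟩
    · simp
    by_cases hb : r b a
    · simpa [insW_cons_cons hy hb] using ih (List.pairwise_cons.1 hy).2
    · rw [insW_cons_skip h hy hb]
      exact (ih hy).trans (by simp)

/-- If as many letters are bumped as `x` has, the insertion never skips a letter of `x`. With
`insW_of_above` this turns stacking into an equality of lengths, the form in which it is transferred
to other words in `SameQ.tab`. -/
theorem above_of_length_eq (h : Bumping r) {x y : List A} (hy : Sorted r y)
    (hl : (insW r y x).1.length = x.length) : Above r x y := by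
  induction x generalizing y with
  | nil => simp
  | cons a x ih =>
    rcases y with _ | ⟨b, y⟩
    · simp at hl
    by_cases hb : r b a
    · rw [insW_cons_cons hy hb] at hl
      exact ⟨hb, ih (List.pairwise_cons.1 hy).2 (by simpa using hl)⟩
    · rw [insW_cons_skip h hy hb] at hl
      have := length_insW_fst_le h hy x
      simp at hl
      omega

end Generic

end Plactic

namespace Plactic

/-! ### Knuth equivalence and its compatibility with insertion -/

section Knuth

variable {A : Type*}

/-- The elementary Knuth relations for the comparison `r`. -/
inductive KnuthMove (r : A → A → Prop) : List A → List A → Prop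
  | one {x y z : A} (hxy : r x y) (hyz : ¬ r z y) : KnuthMove r [y, z, x] [y, x, z]
  | two {x y z : A} (hxy : ¬ r y x) (hyz : r y z) : KnuthMove r [x, z, y] [z, x, y]

/-- Knuth (or plactic) equivalence of words for the comparison `r`. -/
inductive KE (r : A → A → Prop) : List A → List A → Prop
  | move (u v : List A) {s t : List A} (hst : KnuthMove r s t) : KE r (u ++ s ++ v) (u ++ t ++ v)
  | refl (u : List A) : KE r u u
  | symm {u v : List A} : KE r u v → KE r v u
  | trans {u v w : List A} : KE r u v → KE r v w → KE r u w

variable {r : A → A → Prop}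

theorem KE.of_move {s t : List A} (hst : KnuthMove r s t) : KE r s t := by
  simpa using KE.move [] [] hst

theorem KE.context {s t : List A} (h : KE r s t) (u v : List A) :
    KE r (u ++ s ++ v) (u ++ t ++ v) := by
  induction h with
  | move u' v' hst => simpa using KE.move (u ++ u') (v' ++ v) hst
  | refl => exact KE.refl _
  | symm _ ih => exact ih.symm
  | trans _ _ ih ih' => exact ih.trans ih'

theorem KE.append_left {s t : List A} (h : KE r s t) (u : List A) : KE r (u ++ s) (u ++ t) := by
  simpa using h.context u []

theorem KE.append_right {s t : List A} (h : KE r s t) (u : List A) : KE r (s ++ u) (t ++ u) := by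
  simpa using h.context [] u

theorem KE.append {s t s' t' : List A} (h : KE r s t) (h' : KE r s' t') :
    KE r (s ++ s') (t ++ t') :=
  (h.append_right s').trans (h'.append_left t)

theorem KE.length_eq {s t : List A} (h : KE r s t) : s.length = t.length := by
  induction h with
  | move u v hst => cases hst <;> simp
  | refl => rfl
  | symm _ ih => exact ih.symm
  | trans _ _ ih ih' => exact ih.trans ih'

theorem KE.perm {s t : List A} (h : KE r s t) : s.Perm t := by
  induction h with
  | move u v hst =>
    refine List.Perm.append_right _ (List.Perm.append_left _ ?_)
    cases hst
    · exact List.Perm.cons _ (List.Perm.swap _ _ _)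
    · exact List.Perm.swap _ _ _
  | refl => rfl
  | symm _ ih => exact ih.symm
  | trans _ _ ih ih' => exact ih.trans ih'

variable [DecidableRel r]

theorem ins_fst_eq_nil_of (h : Bumping r) {y z : A} (hyz : ¬ r z y) {u : List A}
    (h0 : (ins r y u).1 = []) : (ins r z (ins r y u).2).1 = [] := by
  induction u with
  | nil => simp [ins, hyz]
  | cons a u ih =>
    by_cases hy : r y a
    · simp [ins, hy] at h0
    · have : ¬ r z a := h.neg_trans hyz hy
      simp only [ins, hy, this, if_false] at h0 ⊢
      exact ih h0

/-- Letters bumped out by weakly increasing letters are weakly increasing. -/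
theorem not_r_of_bumped (h : Bumping r) {y z c d : A} (hyz : ¬ r z y) {u : List A}
    (hu : Sorted r u) (hc : (ins r y u).1 = [c]) (hd : (ins r z (ins r y u).2).1 = [d]) :
    ¬ r d c := by
  induction u with
  | nil => simp [ins] at hc
  | cons a u ih =>
    rw [Sorted, List.pairwise_cons] at hu
    by_cases hy : r y a
    · simp only [ins, hy, hyz, if_true, if_false, List.cons.injEq, and_true] at hc hd
      subst hc
      exact hu.1 d (mem_ins_fst (r := r) (x := z) (by rw [hd]; simp)).2
    · have : ¬ r z a := h.neg_trans hyz hy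
      simp only [ins, hy, this, if_false] at hc hd
      exact ih hu.2 hc hd

/-- Inserting `z` and then a smaller letter `y`, the second letter bumps out a letter which is at
most `z`. -/
theorem exists_bumped (h : Bumping r) {y z : A} (hyz : r y z) (u : List A) :
    ∃ d, (ins r y (ins r z u).2).1 = [d] ∧ ∀ c, r z c → r d c := by
  induction u with
  | nil => exact ⟨z, by simp [ins, hyz], fun c hc => hc⟩
  | cons a u ih =>
    by_cases hz : r z a
    · exact ⟨z, by simp [ins, hz, hyz], fun c hc => hc⟩
    · by_cases hy : r y a
      · exact ⟨a, by simp [ins, hz, hy], fun c hc => h.right hz hc⟩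
      · obtain ⟨d, hd, hd'⟩ := ih
        exact ⟨d, by simp [ins, hz, hy, hd], hd'⟩

/-- Inserting Knuth equivalent words into a row. -/
theorem KnuthMove.insW (h : Bumping r) {s t : List A} (hst : KnuthMove r s t) {u : List A}
    (hu : Sorted r u) :
    (insW r s u).2 = (insW r t u).2 ∧ KE r (insW r s u).1 (insW r t u).1 := by
  induction u with
  | nil =>
    cases hst with
    | @one x y z hxy hyz =>
      have hzx : ¬ r z x := fun h' => hyz (h.trans h' hxy)
      simp [Plactic.insW, ins, hxy, hyz, hzx, KE.refl]
    | @two x y z hxy hyz =>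
      have hzx : ¬ r z x := fun h' => hxy (h.trans hyz h')
      simp [Plactic.insW, ins, hxy, hyz, hzx, h.right hxy hyz, KE.refl]
  | cons a u ih =>
    have ih := ih (List.pairwise_cons.1 hu).2
    have hu' := List.pairwise_cons.1 hu
    cases hst with
    | @one x y z hxy hyz =>
      have hzx : ¬ r z x := fun h' => hyz (h.trans h' hxy)
      simp only [Plactic.insW, List.append_nil] at ih ⊢
      -- The cases record which of the three letters displace the head `a`. If none does, both words
      -- act on the tail and the induction hypothesis applies; otherwise the bumped words are equal
      -- or differ by one explicit Knuth move.
      by_cases hya : r y a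
      · have hxa := h.trans hxy hya
        simp only [ins, hya, hxa, hxy, hyz, hzx, if_true, if_false, true_and]
        rcases ins_fst_cases (r := r) z u with h0 | ⟨c, h0⟩
        · simp [h0, KE.refl]
        · rw [h0]
          refine KE.of_move (KnuthMove.one (x := y) (y := a) (z := c) hya ?_)
          exact hu'.1 c (mem_ins_fst (r := r) (x := z) (by rw [h0]; simp)).2
      · have hza : ¬ r z a := h.neg_trans hyz hya
        by_cases hxa : r x a
        · simp only [ins, hya, hza, hxa, hxy, hyz, hzx, if_true, if_false, true_and]
          rcases ins_fst_cases (r := r) y u with h0 | ⟨c, h0⟩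
          · simp [h0, ins_fst_eq_nil_of h hyz h0, KE.refl]
          · rcases ins_fst_cases (r := r) z (ins r y u).2 with h1 | ⟨d, h1⟩
            · simp [h0, h1, KE.refl]
            · rw [h0, h1]
              refine KE.of_move (KnuthMove.one (x := a) (y := c) (z := d) ?_ ?_)
              · exact h.right hya (mem_ins_fst (r := r) (x := y) (by rw [h0]; simp)).1
              · exact not_r_of_bumped h hyz hu'.2 h0 h1
        · simp only [ins, hya, hza, hxa, if_false]
          exact ⟨by rw [ih.1], ih.2⟩
    | @two x y z hxy hyz =>
      have hxz := h.right hxy hyz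
      have hzx : ¬ r z x := fun h' => hxy (h.trans hyz h')
      simp only [Plactic.insW, List.append_nil] at ih ⊢
      by_cases hza : r z a
      · have hxa := h.trans hxz hza
        simp only [ins, hza, hxa, hxy, hxy, hxz, hzx, if_true, if_false]
        cases u with
        | nil => simp [ins, hyz, hxy, hzx, KE.refl]
        | cons c u =>
          have hac := hu'.1 c (by simp)
          have hzc : r z c := h.left hza hac
          have hyc : r y c := h.trans hyz hzc
          simp only [ins, hzc, hyc, hyz, hxy, hzx, if_true, if_false]
          -- The kind of the move changes here: a move of the second kind bumps out `a c z` and `a z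
          -- c`, which differ by one of the first kind.
          exact ⟨trivial, KE.of_move (KnuthMove.one (x := z) (y := a) (z := c) hza hac)⟩
      · by_cases hxa : r x a
        · simp only [ins, hza, hxa, hxy, hxy, hxz, hzx, if_true, if_false, true_and]
          rcases ins_fst_cases (r := r) z u with h0 | ⟨c, h0⟩
          · simp [h0, ins, hxy, hzx, KE.refl]
          · obtain ⟨d, h1, h2⟩ := exists_bumped h hyz u
            simp only [h0, h1, ins, hxy, if_false]
            have hzc := mem_ins_fst (r := r) (x := z) (u := u) (a := c) (by rw [h0]; simp)
            refine KE.of_move (KnuthMove.two (x := a) (y := d) (z := c) ?_ (h2 c hzc.1))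
            have hd := mem_ins_fst (r := r) (x := y) (u := (ins r z u).2) (a := d)
              (by rw [h1]; simp)
            rcases mem_ins hd.2 with rfl | hd
            · exact hza
            · exact hu'.1 d hd
        · have hya : ¬ r y a := h.neg_trans hxy hxa
          simp only [ins, hya, hza, hxa, if_false]
          exact ⟨by rw [ih.1], ih.2⟩

theorem KE.insW (h : Bumping r) {s t : List A} (hst : KE r s t) {u : List A}
    (hu : Sorted r u) :
    (insW r s u).2 = (insW r t u).2 ∧ KE r (insW r s u).1 (insW r t u).1 := by
  induction hst generalizing u with
  | @move w v s t hst =>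
    obtain ⟨h1, h2⟩ := hst.insW h (sorted_insW h w hu)
    simp only [insW_append, h1, true_and]
    exact h2.context _ _
  | refl => exact ⟨rfl, KE.refl _⟩
  | symm _ ih => exact ⟨(ih hu).1.symm, (ih hu).2.symm⟩
  | trans _ _ ih ih' => exact ⟨(ih hu).1.trans (ih' hu).1, (ih hu).2.trans (ih' hu).2⟩

/-- The words bumped out of a row stay Knuth equivalent, so the argument climbs from each row to the
next. Insertion into a list of rows thus depends only on the plactic class of the inserted word. -/
theorem KE.insRows (h : Bumping r) {s t : List A} (hst : KE r s t) {L : List (List A)}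
    (hL : ∀ l ∈ L, Sorted r l) :
    (insRows r s L).2 = (insRows r t L).2 ∧ KE r (insRows r s L).1 (insRows r t L).1 := by
  induction L with
  | nil => exact ⟨rfl, hst⟩
  | cons l L ih =>
    simp only [List.mem_cons, forall_eq_or_imp] at hL
    obtain ⟨h1, h2⟩ := ih hL.2
    obtain ⟨h3, h4⟩ := h2.insW h hL.1
    exact ⟨by simp [Plactic.insRows, h1, h3], h4⟩

theorem ins_cons_ne_nil (h : Bumping r) {x a d : A} {u : List A} (hu : Sorted r (a :: u))
    (hd : (ins r x u).1 = [d]) (hxa : ¬ r x a) :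
    ∃ e v, (ins r x u).2 = e :: v ∧ r e d ∧ ¬ r e a := by
  cases u with
  | nil => simp [ins] at hd
  | cons b u =>
    rw [Sorted, List.pairwise_cons] at hu
    by_cases hxb : r x b
    · simp only [ins, hxb, if_true, List.cons.injEq, and_true] at hd ⊢
      subst hd
      exact ⟨x, u, ⟨rfl, rfl⟩, hxb, hxa⟩
    · simp only [ins, hxb, if_false, List.cons.injEq] at hd ⊢
      have := mem_ins_fst (r := r) (x := x) (u := u) (a := d) (by rw [hd]; simp)
      exact ⟨b, _, ⟨rfl, rfl⟩, h.right hxb this.1, hu.1 b (by simp)⟩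

/-- The tail is treated first. If it bumps out a letter, the head is taken into account by a single
Knuth move on the first three letters. -/
theorem ke_ins (h : Bumping r) (x : A) {u : List A} (hu : Sorted r u) :
    KE r (u ++ [x]) ((ins r x u).1 ++ (ins r x u).2) := by
  induction u with
  | nil => exact KE.refl _
  | cons a u ih =>
    have hu' := List.pairwise_cons.1 hu
    have ih := (ih hu'.2).append_left [a]
    by_cases hxa : r x a
    · simp only [ins, hxa, if_true]
      cases u with
      | nil => exact KE.refl _
      | cons b u =>
        have hab := hu'.1 b (by simp)
        simp only [ins, h.left hxa hab, if_true] at ih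
        refine ih.trans (KE.symm ?_)
        exact (KE.of_move (KnuthMove.one hxa hab)).symm.append_right u
    · simp only [ins, hxa, if_false]
      refine ih.trans ?_
      rcases ins_fst_cases (r := r) x u with h0 | ⟨d, h0⟩
      · simp [h0, KE.refl]
      · obtain ⟨e, v, h1, h2, h3⟩ := ins_cons_ne_nil h hu h0 hxa
        rw [h0, h1]
        exact (KE.of_move (KnuthMove.two h3 h2)).append_right v

theorem ke_insW (h : Bumping r) (w : List A) {u : List A} (hu : Sorted r u) :
    KE r (u ++ w) ((insW r w u).1 ++ (insW r w u).2) := by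
  induction w generalizing u with
  | nil => simp [KE.refl]
  | cons x w ih =>
    have h1 := (ke_ins h x hu).append_right w
    have h2 := (ih (sorted_ins h x hu)).append_left (ins r x u).1
    simp only [List.append_assoc, List.cons_append, List.nil_append] at h1 h2
    simpa [Plactic.insW] using h1.trans h2

theorem ke_insRows (h : Bumping r) (w : List A) {L : List (List A)} (hL : ∀ l ∈ L, Sorted r l) :
    KE r (L.flatten ++ w) ((insRows r w L).1 ++ (insRows r w L).2.flatten) := by
  induction L with
  | nil => simp [Plactic.insRows, KE.refl]
  | cons l L ih =>
    simp only [List.mem_cons, forall_eq_or_imp] at hL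
    have h1 := (ih hL.2).append_left l
    have h2 := (ke_insW h (insRows r w L).1 hL.1).append_right (insRows r w L).2.flatten
    simp only [List.append_assoc] at h1 h2
    simpa [Plactic.insRows] using h1.trans h2

end Knuth

end Plactic

namespace Plactic

/-! ### Tableaux with a fixed number of rows, their product and the Yang–Baxter equation -/

section Norm

variable {A : Type*} {r : A → A → Prop}

/-- Tableaux for the comparison `r`, as lists of possibly empty rows from top to bottom. -/
structure Tab (r : A → A → Prop) (L : List (List A)) : Prop where
  sorted : ∀ l ∈ L, Sorted r l
  chain : L.IsChain (Above r)

theorem Tab.nil : Tab r [] := ⟨by simp, by simp⟩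

theorem Tab.left {L M : List (List A)} (h : Tab r (L ++ M)) : Tab r L :=
  ⟨fun l hl => h.sorted l (List.mem_append_left _ hl), h.chain.left_of_append⟩

theorem Tab.right {L M : List (List A)} (h : Tab r (L ++ M)) : Tab r M :=
  ⟨fun l hl => h.sorted l (List.mem_append_right _ hl), h.chain.right_of_append⟩

theorem tab_cons {l : List A} {L : List (List A)} :
    Tab r (l :: L) ↔ Sorted r l ∧ (∀ m ∈ L.head?, Above r l m) ∧ Tab r L := by
  constructor
  · rintro ⟨h1, h2⟩
    rw [List.isChain_cons] at h2
    exact ⟨h1 l (by simp), h2.1, fun m hm => h1 m (by simp [hm]), h2.2⟩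
  · rintro ⟨h1, h2, h3⟩
    refine ⟨?_, List.isChain_cons.2 ⟨h2, h3.chain⟩⟩
    simp only [List.mem_cons, forall_eq_or_imp]
    exact ⟨h1, h3.sorted⟩

theorem Tab.pad {L : List (List A)} (h : Tab r L) (m : ℕ) : Tab r (List.replicate m [] ++ L) := by
  induction m with
  | zero => simpa using h
  | succ m ih =>
    rw [List.replicate_succ, List.cons_append, tab_cons]
    exact ⟨List.Pairwise.nil, fun _ _ => above_nil _, ih⟩

@[simp] theorem flatten_pad (m : ℕ) (L : List (List A)) :
    (List.replicate m [] ++ L).flatten = L.flatten := by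
  induction m with
  | zero => simp
  | succ m ih => simp [List.replicate_succ]

variable [DecidableRel r]

theorem pass_append (u : List A) (L M : List (List A)) : pass r u (L ++ M) =
    ((pass r u L).1 ++ (pass r (pass r u L).2 M).1, (pass r (pass r u L).2 M).2) := by
  induction L generalizing u with
  | nil => rfl
  | cons l L ih => simp [pass, ih]

theorem length_pass (u : List A) (L : List (List A)) : (pass r u L).1.length = L.length := by
  induction L generalizing u with
  | nil => rfl
  | cons l L ih => simp [pass, ih]

theorem tab_pass (h : Bumping r) {u : List A} (hu : Sorted r u) {L : List (List A)}
    (hL : Tab r L) : Tab r ((pass r u L).1 ++ [(pass r u L).2]) := by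
  induction L generalizing u with
  | nil => exact ⟨by simpa [pass] using hu, by simp [pass]⟩
  | cons l L ih =>
    rw [tab_cons] at hL
    simp only [pass, List.cons_append]
    refine tab_cons.2 ⟨sorted_insW_fst h hL.1 hu, ?_, ih (sorted_insW h l hu) hL.2.2⟩
    cases L with
    | nil => simpa [pass] using above_insW h hL.1 hu
    | cons l' L =>
      simp only [pass, List.cons_append, List.head?_cons, Option.mem_def, Option.some.injEq,
        forall_eq']
      exact above_insW_insW h hL.1 (hL.2.2.sorted _ (by simp)) hu (hL.2.1 l' (by simp))

theorem ke_pass (h : Bumping r) {u : List A} (hu : Sorted r u) (L : List (List A)) :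
    KE r (u ++ L.flatten) ((pass r u L).1.flatten ++ (pass r u L).2) := by
  induction L generalizing u with
  | nil => simp [pass, KE.refl]
  | cons l L ih =>
    have h1 := (ke_insW h l hu).append_right L.flatten
    have h2 := (ih (sorted_insW h l hu)).append_left (insW r l u).1
    simp only [List.append_assoc] at h1 h2
    simpa [pass] using h1.trans h2

theorem length_norm (L : List (List A)) : (norm r L).length = L.length := by
  induction L with
  | nil => rfl
  | cons l L ih => simp [norm, length_pass, ih]

theorem tab_norm (h : Bumping r) {L : List (List A)} (hL : ∀ l ∈ L, Sorted r l) :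
    Tab r (norm r L) := by
  induction L with
  | nil => exact Tab.nil
  | cons l L ih =>
    simp only [List.mem_cons, forall_eq_or_imp] at hL
    exact tab_pass h hL.1 (ih hL.2)

theorem ke_norm (h : Bumping r) {L : List (List A)} (hL : ∀ l ∈ L, Sorted r l) :
    KE r L.flatten (norm r L).flatten := by
  induction L with
  | nil => exact KE.refl _
  | cons l L ih =>
    simp only [List.mem_cons, forall_eq_or_imp] at hL
    simpa [norm] using ((ih hL.2).append_left l).trans (ke_pass h hL.1 _)

theorem insRows_append_word (w w' : List A) (L : List (List A)) : insRows r (w ++ w') L =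
    ((insRows r w L).1 ++ (insRows r w' (insRows r w L).2).1,
      (insRows r w' (insRows r w L).2).2) := by
  induction L with
  | nil => rfl
  | cons l L ih => simp [insRows, ih, insW_append]

theorem insRows_append (w : List A) (L M : List (List A)) : insRows r w (L ++ M) =
    ((insRows r (insRows r w M).1 L).1,
      (insRows r (insRows r w M).1 L).2 ++ (insRows r w M).2) := by
  induction L with
  | nil => rfl
  | cons l L ih => simp [insRows, ih]

theorem length_insRows (w : List A) (L : List (List A)) :
    (insRows r w L).2.length = L.length := by
  induction L with
  | nil => rfl
  | cons l L ih => simp [insRows, ih]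

/-- The row `l` can be stacked under the lowest row of `L`, so it displaces that row entirely; this
row displaces the next one in the same way, and every row moves up by one place. -/
theorem insRows_row {l : List A} {L : List (List A)} (hL : Tab r (L ++ [l])) :
    (insRows r l L).1 :: (insRows r l L).2 = L ++ [l] := by
  induction L with
  | nil => rfl
  | cons x L ih =>
    rw [List.cons_append, tab_cons] at hL
    have ih := ih hL.2.2
    have h1 : Above r x (insRows r l L).1 := hL.2.1 _ (by rw [← ih]; simp)
    have h2 : Sorted r (insRows r l L).1 := hL.2.2.sorted _ (by rw [← ih]; simp)
    simp only [insRows, insW_of_above h2 h1, List.cons_append, ← ih]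

/-- The rows of `N` are inserted one at a time, from top to bottom. Each one pushes the rows already
present up by one, into the empty rows reserved for that purpose. -/
theorem insRows_flatten_pad {M N : List (List A)} (h : Tab r (M ++ N)) :
    insRows r N.flatten (List.replicate N.length [] ++ M) = ([], M ++ N) := by
  induction N generalizing M with
  | nil => induction M with
    | nil => rfl
    | cons x M ih =>
      simp only [List.append_nil, tab_cons] at h
      simp only [List.append_nil, List.flatten_nil, List.length_nil, List.replicate_zero,
        List.nil_append] at ih ⊢
      simp [insRows, ih h.2.2]
  | cons n N ih =>
    have h' : Tab r ((M ++ [n]) ++ N) := by simpa using h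
    have h1 := insRows_row (r := r) (l := n) (L := List.replicate (N.length + 1) [] ++ M)
      (by simpa using h'.left.pad (N.length + 1))
    rw [List.replicate_succ, List.cons_append, List.cons_append, List.cons.injEq] at h1
    simp only [List.flatten_cons, List.length_cons, insRows_append_word, List.replicate_succ,
      List.cons_append, h1.1, h1.2, List.append_assoc]
    have := ih h'
    simp only [List.append_assoc] at this
    simp [this]

theorem insRows_flatten {L : List (List A)} (h : Tab r L) :
    insRows r L.flatten (List.replicate L.length []) = ([], L) := by
  simpa using insRows_flatten_pad (M := []) (N := L) h

theorem sorted_pad {L : List (List A)} (hL : ∀ l ∈ L, Sorted r l) (m : ℕ) :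
    ∀ l ∈ List.replicate m [] ++ L, Sorted r l := by
  intro l hl
  rcases List.mem_append.1 hl with hl | hl
  · rw [List.eq_of_mem_replicate hl]; exact List.Pairwise.nil
  · exact hL l hl

/-- There is only one tableau with a given number of (possibly empty) rows in a plactic class. -/
theorem Tab.eq_of_ke (h : Bumping r) {L M : List (List A)} (hL : Tab r L) (hM : Tab r M)
    (hlen : L.length = M.length) (hke : KE r L.flatten M.flatten) : L = M := by
  have h1 := hke.insRows h (L := List.replicate L.length [])
    (by simp)
  have h2 := insRows_flatten hL
  have h3 := insRows_flatten hM
  rw [← hlen] at h3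
  rw [h2, h3] at h1
  exact h1.1

theorem norm_eq (h : Bumping r) {L M : List (List A)} (hL : ∀ l ∈ L, Sorted r l) (hM : Tab r M)
    (hlen : M.length = L.length) (hke : KE r M.flatten L.flatten) : norm r L = M :=
  (tab_norm h hL).eq_of_ke h hM (by rw [length_norm, hlen]) ((ke_norm h hL).symm.trans hke.symm)

theorem norm_congr (h : Bumping r) {L M : List (List A)} (hL : ∀ l ∈ L, Sorted r l)
    (hM : ∀ l ∈ M, Sorted r l) (hlen : L.length = M.length) (hke : KE r L.flatten M.flatten) :
    norm r L = norm r M :=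
  norm_eq h hL (tab_norm h hM) (by rw [length_norm, hlen])
    ((ke_norm h hM).symm.trans hke.symm)

theorem Tab.norm_eq (h : Bumping r) {L : List (List A)} (hL : Tab r L) : norm r L = L :=
  Plactic.norm_eq h hL.sorted hL rfl (KE.refl _)

theorem KE.eq_nil {w : List A} (h : KE r [] w) : w = [] := by
  simpa [eq_comm] using h.length_eq

/-- This links Schensted insertion, which multiplies on the right, with `norm`, which is built from
left multiplications. Both amount to inserting Knuth equivalent words into the same number of empty
rows, and these rows are numerous enough for nothing to be bumped out at the top. -/
theorem insRows_flatten_eq_norm (h : Bumping r) {M N : List (List A)} (hM : Tab r M)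
    (hN : ∀ l ∈ N, Sorted r l) :
    insRows r N.flatten (List.replicate N.length [] ++ M) = ([], norm r (M ++ N)) := by
  have hMN : ∀ l ∈ M ++ N, Sorted r l := by
    intro l hl
    rcases List.mem_append.1 hl with hl | hl
    exacts [hM.sorted l hl, hN l hl]
  have h1 := (ke_norm h hMN).insRows h (L := List.replicate (N.length + M.length) [])
    (by simp)
  have h2 := insRows_flatten (tab_norm h hMN)
  rw [length_norm, List.length_append, Nat.add_comm] at h2
  have h3 := insRows_flatten (hM.pad N.length)
  simp only [flatten_pad, List.length_append, List.length_replicate] at h3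
  rw [h2, List.flatten_append, insRows_append_word, h3] at h1
  simp only [List.nil_append] at h1
  exact Prod.ext h1.2.symm.eq_nil h1.1

/-- The braiding on tableaux with fixed numbers of (possibly empty) rows. -/
def sig (r : A → A → Prop) [DecidableRel r] (L M : List (List A)) :
    List (List A) × List (List A) :=
  ((norm r (L ++ M)).take M.length, (norm r (L ++ M)).drop M.length)

theorem sig_append (L M : List (List A)) : (sig r L M).1 ++ (sig r L M).2 = norm r (L ++ M) :=
  List.take_append_drop _ _

theorem length_sig_fst (L M : List (List A)) : (sig r L M).1.length = M.length := by
  simp [sig, length_norm]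

theorem length_sig_snd (L M : List (List A)) : (sig r L M).2.length = L.length := by
  simp [sig, length_norm]

theorem sig_eq {L M P Q : List (List A)} (h : norm r (L ++ M) = P ++ Q)
    (hP : P.length = M.length) : sig r L M = (P, Q) := by
  simp [sig, h, ← hP]

theorem Tab.sig (h : Bumping r) {L M : List (List A)} (hL : Tab r L) (hM : Tab r M) :
    Tab r ((sig r L M).1 ++ (sig r L M).2) := by
  rw [sig_append]
  refine tab_norm h fun l hl => ?_
  rcases List.mem_append.1 hl with hl | hl
  exacts [hL.sorted l hl, hM.sorted l hl]

/-- Right multiplication of a tableau, starting with the bottom rows. -/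
theorem norm_append_right (h : Bumping r) {L M N : List (List A)} (hLM : Tab r (L ++ M))
    (hN : ∀ l ∈ N, Sorted r l) :
    norm r (L ++ M ++ N) = norm r (L ++ (sig r M N).1) ++ (sig r M N).2 := by
  have h1 := insRows_flatten_eq_norm h hLM.right hN
  have h2 := insRows_flatten_eq_norm h hLM hN
  -- Insertion starts at the bottom: the rows of `M` are final before `L` is reached, and `L` only
  -- sees the word bumped out of `M`.
  rw [← List.append_assoc, insRows_append] at h2
  rw [insRows_append, Prod.mk.injEq] at h1
  rw [sig_eq h1.2.symm (by simp [length_insRows])]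
  have h0 : ∀ l ∈ List.replicate N.length ([] : List A), Sorted r l := by
    simp
  -- The word bumped out of `M` is Knuth equivalent to the reading of the upper component of `sig r
  -- M N`, so either may be inserted into the rows above.
  have h3 := ke_insRows h (insRows r N.flatten M).1 h0
  rw [h1.1] at h3
  have hP : ∀ l ∈ (insRows r (insRows r N.flatten M).1 (List.replicate N.length [])).2,
      Sorted r l := by
    intro l hl
    refine (tab_norm h (L := M ++ N) ?_).sorted l ?_
    · intro l hl
      rcases List.mem_append.1 hl with hl | hl
      exacts [hLM.right.sorted l hl, hN l hl]
    · rw [← h1.2]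
      exact List.mem_append_left _ hl
  have h4 := insRows_flatten_eq_norm h hLM.left hP
  have h5 := h3.insRows h (sorted_pad hLM.left.sorted N.length)
  simp only [length_insRows, List.length_replicate] at h4
  have h6 : (List.replicate N.length ([] : List A)).flatten = [] := by simp
  rw [h6] at h5
  simp only [List.nil_append] at h5
  rw [h4] at h5
  have h7 := (Prod.mk.injEq _ _ _ _).mp h2
  rw [← h7.2, h5.1]

/-- Left multiplication of a tableau, starting with the top rows. -/
theorem norm_append_left (h : Bumping r) {L M N : List (List A)} (hL : ∀ l ∈ L, Sorted r l)
    (hMN : Tab r (M ++ N)) :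
    norm r (L ++ M ++ N) = (sig r L M).1 ++ norm r ((sig r L M).2 ++ N) := by
  induction L with
  | nil =>
    have h0 : sig r [] M = (M, []) := sig_eq (by simp [hMN.left.norm_eq h]) rfl
    simp [h0, hMN.norm_eq h, hMN.right.norm_eq h]
  | cons x L ih =>
    simp only [List.mem_cons, forall_eq_or_imp] at hL
    have hLM : ∀ l ∈ L ++ M, Sorted r l := by
      intro l hl
      rcases List.mem_append.1 hl with hl | hl
      exacts [hL.2 l hl, hMN.left.sorted l hl]
    have hT := tab_norm h hLM
    rw [← sig_append] at hT
    have h1 : norm r (x :: L ++ M) = (pass r x (sig r L M).1).1 ++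
        ((pass r (pass r x (sig r L M).1).2 (sig r L M).2).1 ++
          [(pass r (pass r x (sig r L M).1).2 (sig r L M).2).2]) := by
      rw [List.cons_append, norm, ← sig_append, pass_append]
      simp
    rw [sig_eq h1 (by rw [length_pass, length_sig_fst])]
    -- The row `x` traverses the top rows first, and what it leaves behind there is already final;
    -- only the row that comes out below interacts with the remaining rows.
    have h2 : norm r (x :: L ++ M ++ N) = (pass r x (sig r L M).1).1 ++
        norm r ((pass r x (sig r L M).1).2 :: (sig r L M).2 ++ N) := by
      rw [List.cons_append, List.cons_append, norm, ih hL.2, pass_append]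
      simp [norm]
    rw [h2]
    congr 1
    have hs : Sorted r (pass r x (sig r L M).1).2 :=
      (tab_pass h hL.1 hT.left).sorted _ (by simp)
    have ht := tab_pass h hs hT.right
    -- On one side the outgoing row has not yet been multiplied with the rows above `N`, on the
    -- other side it has. The number of rows and the plactic class are the same.
    refine norm_congr h ?_ ?_ ?_ ?_
    · intro l hl
      simp only [List.cons_append, List.mem_cons, List.mem_append] at hl
      rcases hl with rfl | hl | hl
      exacts [hs, hT.right.sorted l hl, hMN.right.sorted l hl]
    · intro l hl
      rcases List.mem_append.1 hl with hl | hl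
      exacts [ht.sorted l hl, hMN.right.sorted l hl]
    · simp [length_pass]
      omega
    · simpa using (ke_pass h hs (sig r L M).2).append_right N.flatten

/-- The Yang–Baxter equation. -/
theorem sig_braid (h : Bumping r) {L M N : List (List A)} (hL : Tab r L) (hM : Tab r M)
    (hN : Tab r N) :
    ((sig r (sig r L M).1 (sig r (sig r L M).2 N).1).1,
      (sig r (sig r L M).1 (sig r (sig r L M).2 N).1).2, (sig r (sig r L M).2 N).2) =
    ((sig r L (sig r M N).1).1, (sig r (sig r L (sig r M N).1).2 (sig r M N).2).1,
      (sig r (sig r L (sig r M N).1).2 (sig r M N).2).2) := by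
  have h1 := norm_append_right h (hL.sig h hM) hN.sorted
  have h2 := norm_append_left h hL.sorted (hM.sig h hN)
  -- Both sides of the equation will be blocks of this one tableau, the product of `L`, `M` and `N`.
  -- The block sizes agree, so the blocks can be identified.
  have h3 : norm r ((sig r L M).1 ++ (sig r L M).2 ++ N) =
      norm r (L ++ (sig r M N).1 ++ (sig r M N).2) := by
    have e1 := ke_norm h (L := L ++ M) (by
      intro l hl
      rcases List.mem_append.1 hl with hl | hl
      exacts [hL.sorted l hl, hM.sorted l hl])
    have e2 := ke_norm h (L := M ++ N) (by
      intro l hl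
      rcases List.mem_append.1 hl with hl | hl
      exacts [hM.sorted l hl, hN.sorted l hl])
    refine norm_congr h ?_ ?_ ?_ ?_
    · intro l hl
      rcases List.mem_append.1 hl with hl | hl
      exacts [(hL.sig h hM).sorted l hl, hN.sorted l hl]
    · intro l hl
      rw [List.append_assoc] at hl
      rcases List.mem_append.1 hl with hl | hl
      exacts [hL.sorted l hl, (hM.sig h hN).sorted l hl]
    · simp [length_sig_fst, length_sig_snd]; omega
    · have e3 := e1.symm.append_right N.flatten
      have e4 := e2.append_left L.flatten
      rw [← sig_append] at e3 e4
      simp only [List.flatten_append, List.append_assoc] at e3 e4 ⊢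
      exact e3.trans e4
  rw [h1, h2, ← sig_append, ← sig_append, List.append_assoc] at h3
  obtain ⟨h4, h5⟩ := List.append_inj h3 (by simp [length_sig_fst])
  obtain ⟨h6, h7⟩ := List.append_inj h5 (by simp [length_sig_fst, length_sig_snd])
  rw [h4, h6, h7]

end Norm

end Plactic

namespace Plactic

/-! ### Dual equivalence: simultaneous Knuth swaps on two words -/

section Parallel

variable {A : Type*}

/-- A triple as a word. -/
def triple (t : A × A × A) : List A := [t.1, t.2.1, t.2.2]

@[simp] theorem length_triple (t : A × A × A) : (triple t).length = 3 := rfl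

theorem triple_injective {t t' : A × A × A} (h : triple t = triple t') : t = t' := by
  obtain ⟨x, y, z⟩ := t
  obtain ⟨x', y', z'⟩ := t'
  simpa [triple] using h

/-- The involution exchanging the two sides of the elementary Knuth relations. -/
def knuthSwap (r : A → A → Prop) [DecidableRel r] (t : A × A × A) : A × A × A :=
  if r t.2.1 t.1 then
    if r t.2.2 t.2.1 then t
    else if r t.2.2 t.1 then (t.2.1, t.1, t.2.2) else (t.1, t.2.2, t.2.1)
  else
    if r t.2.2 t.2.1 then
      if r t.2.2 t.1 then (t.1, t.2.2, t.2.1) else (t.2.1, t.1, t.2.2)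
    else t

variable {r : A → A → Prop} [DecidableRel r]

theorem knuthSwap_knuthSwap (h : Bumping r) (t : A × A × A) :
    knuthSwap r (knuthSwap r t) = t := by
  obtain ⟨x, y, z⟩ := t
  have h1 := @h.trans x y z
  have h2 := @h.trans x z y
  have h3 := @h.trans y x z
  have h4 := @h.trans y z x
  have h5 := @h.trans z x y
  have h6 := @h.trans z y x
  have h7 := @h.neg_trans x y z
  have h8 := @h.neg_trans x z y
  have h9 := @h.neg_trans y x z
  have h10 := @h.neg_trans y z x
  have h11 := @h.neg_trans z x y
  have h12 := @h.neg_trans z y x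
  unfold knuthSwap
  -- A finite check on the possible comparisons of three letters; the transitivity statements
  -- exclude the inconsistent combinations.
  by_cases a1 : r x y <;> by_cases a2 : r y x <;> by_cases a3 : r x z <;> by_cases a4 : r z x <;>
    by_cases a5 : r y z <;> by_cases a6 : r z y <;> simp_all

/-- `Par r W W' V V'`: the same sequence of (positions of) applications of `knuthSwap` transforms
`W` into `V` and `W'` into `V'`. -/
inductive Par (r : A → A → Prop) [DecidableRel r] (W W' : List A) : List A → List A → Prop
  | refl : Par r W W' W W'
  | step (a a' b b' : List A) (t t' : A × A × A) (ha : a.length = a'.length)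
      (hb : b.length = b'.length) (h : Par r W W' (a ++ triple t ++ b) (a' ++ triple t' ++ b')) :
      Par r W W' (a ++ triple (knuthSwap r t) ++ b) (a' ++ triple (knuthSwap r t') ++ b')

theorem Par.trans {W W' V V' U U' : List A} (h1 : Par r W W' V V') (h2 : Par r V V' U U') :
    Par r W W' U U' := by
  induction h2 with
  | refl => exact h1
  | step a a' b b' t t' ha hb _ ih => exact ih.step a a' b b' t t' ha hb

theorem Par.context {W W' V V' : List A} (h : Par r W W' V V') {u u' : List A}
    (hu : u.length = u'.length) {v v' : List A} (hv : v.length = v'.length) :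
    Par r (u ++ W ++ v) (u' ++ W' ++ v') (u ++ V ++ v) (u' ++ V' ++ v') := by
  induction h with
  | refl => exact Par.refl
  | step a a' b b' t t' ha hb _ ih =>
    have := Par.step (u ++ a) (u' ++ a') (b ++ v) (b' ++ v') t t' (by simp [hu, ha])
      (by simp [hv, hb]) (W := u ++ W ++ v) (W' := u' ++ W' ++ v') (by simpa using ih)
    simpa using this

theorem Par.length_eq {W W' V V' : List A} (h : Par r W W' V V') :
    V.length = W.length ∧ V'.length = W'.length := by
  induction h with
  | refl => simp
  | step a a' b b' t t' ha hb _ ih => simpa using ih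

theorem Par.eq_of_eq {W W' V V' : List A} (h : Par r W W' V V') (hW : W = W') : V = V' := by
  induction h with
  | refl => exact hW
  | step a a' b b' t t' ha hb _ ih =>
    obtain ⟨h1, h2⟩ := List.append_inj ih (by simp [ha])
    obtain ⟨h3, h4⟩ := List.append_inj h1 ha
    rw [h2, h3, triple_injective h4]

/-- Each swap is an involution, so the whole sequence can be undone from equal final words. -/
theorem Par.injective (h : Bumping r) {W W' V V' : List A} (hp : Par r W W' V V')
    (hV : V = V') : W = W' := by
  induction hp with
  | refl => exact hV
  | step a a' b b' t t' ha hb _ ih =>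
    obtain ⟨h1, h2⟩ := List.append_inj hV (by simp [ha])
    obtain ⟨h3, h4⟩ := List.append_inj h1 ha
    refine ih ?_
    rw [h2, h3, ← knuthSwap_knuthSwap h t, triple_injective h4, knuthSwap_knuthSwap h]

/-- Two words have the same (dual) behaviour: they have the same descents, and still do after
the same applications of `knuthSwap`. -/
structure SameQ (r : A → A → Prop) [DecidableRel r] (W W' : List A) : Prop where
  length_eq : W.length = W'.length
  descent : ∀ {V V' : List A}, Par r W W' V V' → ∀ (a b a' b' : List A) (x y x' y' : A),
    V = a ++ x :: y :: b → V' = a' ++ x' :: y' :: b' → a.length = a'.length → (r y x ↔ r y' x')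

theorem SameQ.par {W W' V V' : List A} (h : SameQ r W W') (hp : Par r W W' V V') :
    SameQ r V V' where
  length_eq := by rw [hp.length_eq.1, hp.length_eq.2, h.length_eq]
  descent hq := h.descent (hp.trans hq)

theorem SameQ.refl (W : List A) : SameQ r W W where
  length_eq := rfl
  descent hp a b a' b' x y x' y' h1 h2 h3 := by
    rw [← hp.eq_of_eq rfl, h1] at h2
    obtain ⟨-, h4⟩ := List.append_inj h2 h3
    simp only [List.cons.injEq] at h4
    rw [h4.1, h4.2.1]

/-- Swaps inside a factor are swaps of the whole word, and the descents of a factor are descents of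
the word. -/
theorem SameQ.factor {u u' w w' v v' : List A} (h : SameQ r (u ++ w ++ v) (u' ++ w' ++ v'))
    (hu : u.length = u'.length) (hw : w.length = w'.length) : SameQ r w w' where
  length_eq := hw
  descent hp a b a' b' x y x' y' h1 h2 h3 := by
    have hv : v.length = v'.length := by
      have := h.length_eq
      simp only [List.length_append] at this
      omega
    exact h.descent (hp.context hu hv) (u ++ a) (b ++ v) (u' ++ a') (b' ++ v') x y x' y'
      (by simp [h1]) (by simp [h2]) (by simp [hu, h3])

theorem SameQ.left {w w' v v' : List A} (h : SameQ r (w ++ v) (w' ++ v'))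
    (hw : w.length = w'.length) : SameQ r w w' :=
  SameQ.factor (u := []) (u' := []) (by simpa using h) rfl hw

theorem SameQ.right {u u' w w' : List A} (h : SameQ r (u ++ w) (u' ++ w'))
    (hu : u.length = u'.length) : SameQ r w w' :=
  SameQ.factor (v := []) (v' := []) (by simpa using h) hu (by
    have := h.length_eq
    simp only [List.length_append] at this
    omega)

/-- A row is a word without descents: by negative transitivity, comparing neighbours suffices. -/
theorem SameQ.sorted (h : Bumping r) {l l' : List A} (hQ : SameQ r l l') (hl : Sorted r l) :
    Sorted r l' := by
  induction l generalizing l' with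
  | nil =>
    have := hQ.length_eq
    simp only [List.length_nil] at this
    rw [List.eq_nil_of_length_eq_zero this.symm]
    exact List.Pairwise.nil
  | cons x l ih =>
    rcases l' with _ | ⟨x', l'⟩
    · simp
    have h1 := ih (SameQ.right (u := [x]) (u' := [x']) hQ rfl) (List.pairwise_cons.1 hl).2
    refine List.pairwise_cons.2 ⟨?_, h1⟩
    rcases l with _ | ⟨y, l⟩ <;> rcases l' with _ | ⟨y', l'⟩
    · simp
    · simpa using hQ.length_eq
    · simp
    · have h2 := hQ.descent Par.refl [] l [] l' x y x' y' rfl rfl rfl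
      have h3 : ¬ r y' x' := by
        rw [← h2]
        exact (List.pairwise_cons.1 hl).1 y (by simp)
      intro z hz
      rcases List.mem_cons.1 hz with rfl | hz
      · exact h3
      · exact h.neg_trans ((List.pairwise_cons.1 h1).1 z hz) h3

/-- If the tail bumps out a letter, one more letter in front costs exactly one swap of the first
three letters, whether or not the inserted letter displaces the head. This uniformity makes the
positions of the swaps independent of the letters. -/
theorem knuthSwap_ins (h : Bumping r) {a d x : A} {u : List A} (hu : Sorted r (a :: u))
    (hd : (ins r x u).1 = [d]) :
    ∃ e v f, (ins r x u).2 = e :: v ∧ (ins r x (a :: u)).1 = [f] ∧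
      [f] ++ (ins r x (a :: u)).2 = triple (knuthSwap r (a, d, e)) ++ v := by
  have hu' := List.pairwise_cons.1 hu
  have hda : ¬ r d a := hu'.1 d (mem_ins_fst (r := r) (x := x) (by rw [hd]; simp)).2
  by_cases hxa : r x a
  · rcases u with _ | ⟨b, u⟩
    · simp [ins] at hd
    have hxb := h.left hxa (hu'.1 b (by simp))
    simp only [ins, hxb, if_true, List.cons.injEq, and_true] at hd
    subst hd
    refine ⟨x, u, a, by simp [ins, hxb], by simp [ins, hxa], ?_⟩
    simp [ins, hxa, triple, knuthSwap, hda, hxb]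
  · obtain ⟨e, v, h1, h2, h3⟩ := ins_cons_ne_nil h hu hd hxa
    refine ⟨e, v, d, h1, by simp [ins, hxa, hd], ?_⟩
    simp [ins, hxa, h1, triple, knuthSwap, hda, h2, h3]

theorem ins_cons_of_not {x a : A} (hx : ¬ r x a) (u : List A) :
    ins r x (a :: u) = ((ins r x u).1, a :: (ins r x u).2) := if_neg hx

/-- For a row of one letter the outcome is decided by a descent. For longer rows, a tail that bumps
out nothing leaves the head alone as well, and otherwise `knuthSwap_ins` prescribes the same swap on
both sides. -/
theorem SameQ.ins (h : Bumping r) {u u' : List A} {x x' : A} (hu : Sorted r u)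
    (hu' : Sorted r u') (hl : u.length = u'.length) (hQ : SameQ r (u ++ [x]) (u' ++ [x'])) :
    (ins r x u).1.length = (ins r x' u').1.length ∧
    Par r (u ++ [x]) (u' ++ [x']) ((ins r x u).1 ++ (ins r x u).2)
      ((ins r x' u').1 ++ (ins r x' u').2) := by
  induction u generalizing u' with
  | nil =>
    obtain rfl : u' = [] := List.eq_nil_of_length_eq_zero hl.symm
    exact ⟨rfl, Par.refl⟩
  | cons a u ih =>
    rcases u' with _ | ⟨a', u'⟩
    · simp at hl
    have hs := List.pairwise_cons.1 hu
    have hs' := List.pairwise_cons.1 hu'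
    have hl' : u.length = u'.length := by simpa using hl
    obtain ⟨ih1, ih2⟩ := ih hs.2 hs'.2 hl' (SameQ.right (u := [a]) (u' := [a']) hQ rfl)
    have ih3 := ih2.context (u := [a]) (u' := [a']) rfl (v := []) (v' := []) rfl
    simp only [List.append_nil] at ih3
    rcases u with _ | ⟨b, u⟩
    · obtain rfl : u' = [] := List.eq_nil_of_length_eq_zero hl'.symm
      have := hQ.descent Par.refl [] [] [] [] a x a' x' rfl rfl rfl
      by_cases hxa : r x a
      · simp only [Plactic.ins, hxa, this.1 hxa, if_true]
        exact ⟨by simp, Par.refl⟩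
      · have hxa' : ¬ r x' a' := by rwa [← this]
        simp only [Plactic.ins, hxa, hxa', if_false]
        exact ⟨by simp, Par.refl⟩
    · rcases u' with _ | ⟨b', u'⟩
      · simp at hl'
      rcases ins_fst_cases (r := r) x (b :: u) with h0 | ⟨d, h0⟩
      · have h0' : (Plactic.ins r x' (b' :: u')).1 = [] := by
          rw [h0] at ih1
          exact List.eq_nil_of_length_eq_zero ih1.symm
        have key : ∀ {x a b : A} {u : List A}, Sorted r (a :: b :: u) →
            (Plactic.ins r x (b :: u)).1 = [] → ¬ r x a := by
          intro x a b u hu h0 hxa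
          have := h.left hxa ((List.pairwise_cons.1 hu).1 b (by simp))
          simp [Plactic.ins, this] at h0
        have hx := key hu h0
        have hx' := key hu' h0'
        rw [ins_cons_of_not hx, ins_cons_of_not hx']
        rw [h0, h0'] at ih3 ⊢
        exact ⟨rfl, ih3⟩
      · have : ∃ d', (Plactic.ins r x' (b' :: u')).1 = [d'] := by
          rw [h0] at ih1
          exact List.length_eq_one_iff.1 ih1.symm
        obtain ⟨d', h0'⟩ := this
        obtain ⟨e, v, f, h1, h2, h3⟩ := knuthSwap_ins h hu h0
        obtain ⟨e', v', f', h1', h2', h3'⟩ := knuthSwap_ins h hu' h0'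
        rw [h2, h2', h3, h3']
        refine ⟨rfl, ?_⟩
        refine Par.step [] [] v v' (a, d, e) (a', d', e') rfl ?_ ?_
        · have := ih2.length_eq
          rw [h0, h0', h1, h1'] at this
          simp at this hl'
          omega
        · rw [h0, h0', h1, h1'] at ih3
          exact ih3

theorem SameQ.insW (h : Bumping r) {u u' w w' : List A} (hu : Sorted r u)
    (hu' : Sorted r u') (hl : u.length = u'.length) (hQ : SameQ r (u ++ w) (u' ++ w')) :
    (insW r w u).1.length = (insW r w' u').1.length ∧
    (insW r w u).2.length = (insW r w' u').2.length ∧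
    Par r (u ++ w) (u' ++ w') ((insW r w u).1 ++ (insW r w u).2)
      ((insW r w' u').1 ++ (insW r w' u').2) := by
  have hw : w.length = w'.length := by
    have := hQ.length_eq
    simp only [List.length_append] at this
    omega
  suffices H : (Plactic.insW r w u).1.length = (Plactic.insW r w' u').1.length ∧
      Par r (u ++ w) (u' ++ w') ((Plactic.insW r w u).1 ++ (Plactic.insW r w u).2)
      ((Plactic.insW r w' u').1 ++ (Plactic.insW r w' u').2) by
    refine ⟨H.1, ?_, H.2⟩
    have h1 := insW_length (r := r) w u
    have h2 := insW_length (r := r) w' u'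
    have := H.1
    omega
  induction w generalizing u u' w' with
  | nil =>
    obtain rfl : w' = [] := List.eq_nil_of_length_eq_zero hw.symm
    simpa using Par.refl
  | cons x w ih =>
    rcases w' with _ | ⟨x', w'⟩
    · simp at hw
    have hw' : w.length = w'.length := by simpa using hw
    have hQ1 : SameQ r ((u ++ [x]) ++ w) ((u' ++ [x']) ++ w') := by simpa using hQ
    have hQ2 := hQ1.left (by simp [hl])
    obtain ⟨h1, h2⟩ := hQ2.ins h hu hu' hl
    have h3 := h2.context (u := []) (u' := []) rfl hw'
    have hQ3 := hQ1.par (by simpa using h3)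
    have hlen : (Plactic.ins r x u).2.length = (Plactic.ins r x' u').2.length := by
      have h4 := h2.length_eq
      simp only [List.length_append] at h4
      simp at h4
      omega
    have hQ4 := SameQ.right (u := (Plactic.ins r x u).1) (u' := (Plactic.ins r x' u').1)
      (w := (Plactic.ins r x u).2 ++ w) (w' := (Plactic.ins r x' u').2 ++ w') (by simpa using hQ3) h1
    obtain ⟨h5, h6⟩ := ih (sorted_ins h x hu) (sorted_ins h x' hu') hlen hQ4 hw'
    refine ⟨by simp [Plactic.insW, h1, h5], ?_⟩
    have h7 := h6.context h1 (v := []) (v' := []) rfl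
    have h8 := h3.trans (U := (Plactic.insW r (x :: w) u).1 ++ (Plactic.insW r (x :: w) u).2)
      (U' := (Plactic.insW r (x' :: w') u').1 ++ (Plactic.insW r (x' :: w') u').2)
      (by simpa [Plactic.insW] using h7)
    simpa using h8

theorem SameQ.pass (h : Bumping r) {u u' : List A} {L L' : List (List A)} (hu : Sorted r u)
    (hu' : Sorted r u') (hl : u.length = u'.length)
    (hL : L.map List.length = L'.map List.length)
    (hQ : SameQ r (u ++ L.flatten) (u' ++ L'.flatten)) :
    (pass r u L).1.map List.length = (pass r u' L').1.map List.length ∧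
    (pass r u L).2.length = (pass r u' L').2.length ∧
    Par r (u ++ L.flatten) (u' ++ L'.flatten) ((pass r u L).1.flatten ++ (pass r u L).2)
      ((pass r u' L').1.flatten ++ (pass r u' L').2) := by
  induction L generalizing u u' L' with
  | nil =>
    obtain rfl : L' = [] := by simpa using hL.symm
    simpa [Plactic.pass] using ⟨hl, Par.refl⟩
  | cons l L ih =>
    rcases L' with _ | ⟨l', L'⟩
    · simp at hL
    simp only [List.map_cons, List.cons.injEq] at hL
    have hf : L.flatten.length = L'.flatten.length := by simp [List.length_flatten, hL.2]
    have hQ1 : SameQ r ((u ++ l) ++ L.flatten) ((u' ++ l') ++ L'.flatten) := by simpa using hQ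
    obtain ⟨h1, h2, h3⟩ := (hQ1.left (by simp [hl, hL.1])).insW h hu hu' hl
    have h4 := h3.context (u := []) (u' := []) rfl hf
    have hQ2 := hQ1.par (by simpa using h4)
    have hQ3 := SameQ.right (u := (Plactic.insW r l u).1) (u' := (Plactic.insW r l' u').1)
      (w := (Plactic.insW r l u).2 ++ L.flatten) (w' := (Plactic.insW r l' u').2 ++ L'.flatten)
      (by simpa using hQ2) h1
    obtain ⟨h5, h6, h7⟩ := ih (sorted_insW h l hu) (sorted_insW h l' hu') h2 hL.2 hQ3
    refine ⟨by simp [Plactic.pass, h1, h5], h6, ?_⟩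
    have h8 := h7.context h1 (v := []) (v' := []) rfl
    have h9 := h4.trans
      (U := (Plactic.pass r u (l :: L)).1.flatten ++ (Plactic.pass r u (l :: L)).2)
      (U' := (Plactic.pass r u' (l' :: L')).1.flatten ++ (Plactic.pass r u' (l' :: L')).2)
      (by simpa [Plactic.pass] using h8)
    simpa using h9

/-- Normalisation is a composite of insertions, hence a sequence of swaps whose positions are common
to both words. The equality of shapes is what keeps the cuts into rows aligned throughout. -/
theorem SameQ.norm (h : Bumping r) {L L' : List (List A)} (hs : ∀ l ∈ L, Sorted r l)
    (hs' : ∀ l ∈ L', Sorted r l) (hL : L.map List.length = L'.map List.length)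
    (hQ : SameQ r L.flatten L'.flatten) :
    (norm r L).map List.length = (norm r L').map List.length ∧
    Par r L.flatten L'.flatten (norm r L).flatten (norm r L').flatten := by
  induction L generalizing L' with
  | nil =>
    obtain rfl : L' = [] := by simpa using hL.symm
    exact ⟨rfl, Par.refl⟩
  | cons l L ih =>
    rcases L' with _ | ⟨l', L'⟩
    · simp at hL
    simp only [List.map_cons, List.cons.injEq] at hL
    simp only [List.mem_cons, forall_eq_or_imp] at hs hs'
    rw [List.flatten_cons, List.flatten_cons] at hQ
    obtain ⟨h1, h2⟩ := ih hs.2 hs'.2 hL.2 (hQ.right hL.1)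
    have h3 := h2.context hL.1 (v := []) (v' := []) rfl
    simp only [List.append_nil] at h3
    obtain ⟨h4, h5, h6⟩ := (hQ.par h3).pass h hs.1 hs'.1 hL.1 h1
    refine ⟨by simp [Plactic.norm, h4, h5], ?_⟩
    simpa [Plactic.norm] using h3.trans h6

/-- Descents detect that a row is sorted, and the number of bumped letters detects that two rows are
stacked; both are shared by the two words. -/
theorem SameQ.tab (h : Bumping r) {L L' : List (List A)} (hT : Tab r L)
    (hL : L.map List.length = L'.map List.length) (hQ : SameQ r L.flatten L'.flatten) :
    Tab r L' := by
  induction L generalizing L' with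
  | nil =>
    obtain rfl : L' = [] := by simpa using hL.symm
    exact Tab.nil
  | cons l L ih =>
    rcases L' with _ | ⟨l', L'⟩
    · simp at hL
    simp only [List.map_cons, List.cons.injEq] at hL
    rw [List.flatten_cons, List.flatten_cons] at hQ
    rw [tab_cons] at hT ⊢
    have hl' := (hQ.left hL.1).sorted h hT.1
    refine ⟨hl', ?_, ih hT.2.2 hL.2 (hQ.right hL.1)⟩
    rcases L with _ | ⟨m, L⟩
    · obtain rfl : L' = [] := by simpa using hL.2.symm
      simp
    · rcases L' with _ | ⟨m', L'⟩
      · simp at hL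
      simp only [List.map_cons, List.cons.injEq] at hL
      have hQ1 : SameQ r ((l ++ m) ++ L.flatten) ((l' ++ m') ++ L'.flatten) := by
        simpa using hQ
      have hQ2 := hQ1.left (by simp [hL])
      have hm := hT.2.2.sorted m (by simp)
      have hm' := (hQ2.right hL.1).sorted h hm
      obtain ⟨h1, -, -⟩ := hQ2.insW h hT.1 hl' hL.1
      rw [insW_of_above hm (hT.2.1 m (by simp))] at h1
      simp only [List.head?_cons, Option.mem_def, Option.some.injEq, forall_eq']
      exact above_of_length_eq h hm' (by rw [← h1]; exact hL.1)

/-- Operators on words which preserve the length and the descents, and commute with the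
applications of `knuthSwap`. -/
structure NatOp (r : A → A → Prop) [DecidableRel r] (φ : List A → List A) : Prop where
  length_eq : ∀ W, (φ W).length = W.length
  descent : ∀ {a b a' b' : List A} {x y x' y' : A}, a.length = a'.length →
    φ (a ++ x :: y :: b) = a' ++ x' :: y' :: b' → (r y x ↔ r y' x')
  swap : ∀ {a b a' b' : List A} {t t' : A × A × A}, a.length = a'.length →
    φ (a ++ triple t ++ b) = a' ++ triple t' ++ b' →
    φ (a ++ triple (knuthSwap r t) ++ b) = a' ++ triple (knuthSwap r t') ++ b'

theorem exists_triple (w : List A) (m n : ℕ) (h : w.length = m + 3 + n) :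
    ∃ a t b, w = a ++ triple t ++ b ∧ a.length = m := by
  refine ⟨w.take m, (w[m], w[m + 1], w[m + 2]), w.drop (m + 3), ?_, by simp; omega⟩
  conv_lhs => rw [← List.take_append_drop m w]
  rw [List.append_assoc]
  congr 1
  rw [List.drop_eq_getElem_cons (show m < w.length by omega),
    List.drop_eq_getElem_cons (show m + 1 < w.length by omega),
    List.drop_eq_getElem_cons (show m + 2 < w.length by omega)]
  rfl

theorem exists_pair (w : List A) (m n : ℕ) (h : w.length = m + 2 + n) :
    ∃ a x y b, w = a ++ x :: y :: b ∧ a.length = m := by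
  refine ⟨w.take m, w[m], w[m + 1], w.drop (m + 2), ?_, by simp; omega⟩
  conv_lhs => rw [← List.take_append_drop m w]
  congr 1
  rw [List.drop_eq_getElem_cons (show m < w.length by omega),
    List.drop_eq_getElem_cons (show m + 1 < w.length by omega)]

theorem NatOp.comp {φ ψ : List A → List A} (hφ : NatOp r φ) (hψ : NatOp r ψ) :
    NatOp r (φ ∘ ψ) where
  length_eq W := by simp [hφ.length_eq, hψ.length_eq]
  descent {a b a' b' x y x' y'} ha h := by
    obtain ⟨a'', x'', y'', b'', h1, h2⟩ := exists_pair (ψ (a ++ x :: y :: b)) a.length b.length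
      (by rw [hψ.length_eq]; simp; omega)
    rw [Function.comp, h1] at h
    exact (hψ.descent h2.symm h1).trans (hφ.descent (h2.trans ha) h)
  swap {a b a' b' t t'} ha h := by
    obtain ⟨a'', t'', b'', h1, h2⟩ := exists_triple (ψ (a ++ triple t ++ b)) a.length b.length
      (by rw [hψ.length_eq]; simp; omega)
    rw [Function.comp, h1] at h
    rw [Function.comp, hψ.swap h2.symm h1]
    exact hφ.swap (h2.trans ha) h

theorem NatOp.eq_of_par {φ : List A → List A} (hφ : NatOp r φ) {W V V' : List A}
    (hp : Par r W (φ W) V V') : V' = φ V := by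
  induction hp with
  | refl => rfl
  | step a a' b b' t t' ha hb _ ih => exact (hφ.swap ha ih.symm).symm

theorem NatOp.sameQ {φ : List A → List A} (hφ : NatOp r φ) (W : List A) : SameQ r W (φ W) where
  length_eq := (hφ.length_eq W).symm
  descent hp a b a' b' x y x' y' h1 h2 h3 := by
    have := hφ.eq_of_par hp
    rw [h1, h2] at this
    exact hφ.descent h3 this.symm

/-- Natural operators commute with every swap, so they carry a parallel sequence of swaps to a
parallel sequence at the same positions. -/
theorem NatOp.par {φ ψ : List A → List A} (hφ : NatOp r φ) (hψ : NatOp r ψ) {W W' V V' : List A}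
    (hp : Par r W W' V V') : Par r (φ W) (ψ W') (φ V) (ψ V') := by
  induction hp with
  | refl => exact Par.refl
  | step a a' b b' t t' ha hb _ ih =>
    obtain ⟨c, s, d, h1, h2⟩ := exists_triple (φ (a ++ triple t ++ b)) a.length b.length
      (by rw [hφ.length_eq]; simp; omega)
    obtain ⟨c', s', d', h1', h2'⟩ := exists_triple (ψ (a' ++ triple t' ++ b')) a'.length b'.length
      (by rw [hψ.length_eq]; simp; omega)
    rw [hφ.swap h2.symm h1, hψ.swap h2'.symm h1']
    rw [h1, h1'] at ih
    refine ih.step c c' d d' s s' (by omega) ?_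
    have h3 := congrArg List.length h1
    have h4 := congrArg List.length h1'
    simp [hφ.length_eq, hψ.length_eq] at h3 h4
    omega

/-- Two natural operators agree on a word if they agree on its tableau. -/
theorem NatOp.eq_of_norm (h : Bumping r) {φ ψ : List A → List A} (hφ : NatOp r φ)
    (hψ : NatOp r ψ) {L : List (List A)} (hL : ∀ l ∈ L, Sorted r l)
    (heq : φ (norm r L).flatten = ψ (norm r L).flatten) : φ L.flatten = ψ L.flatten := by
  -- The word is joined to its tableau by swaps. Applying `φ` to one copy of this path and `ψ` to
  -- another gives parallel paths with a common end, hence with a common start.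
  have h1 := hφ.par hψ ((SameQ.refl (r := r) L.flatten).norm h hL hL rfl).2
  rw [heq] at h1
  exact h1.injective h rfl

end Parallel

end Plactic

namespace Plactic

/-! ### The letter permuting operator as a recursion on words -/

section Letters

variable {A : Type*}

/-- Reversing words exchanges the two kinds of Knuth relations when `<` is replaced by `≤`. This
carries letter operators from rows to columns. -/
theorem NatOp.reverse [LinearOrder A] {φ : List A → List A}
    (hφ : NatOp (fun x y : A => x < y) φ) :
    NatOp (fun x y : A => x ≤ y) (fun w => (φ w.reverse).reverse) where
  length_eq W := by simp [hφ.length_eq]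
  descent {a b a' b' x y x' y'} ha h := by
    have h0 := congrArg List.length h
    simp only [List.length_reverse, hφ.length_eq] at h0
    have h1 := congrArg List.reverse h
    simp only [List.reverse_reverse, List.reverse_append, List.reverse_cons, List.append_assoc,
      List.cons_append, List.nil_append] at h1
    have := hφ.descent (a := b.reverse) (a' := b'.reverse) (by simp at h0 ⊢; omega) h1
    simpa using not_congr this
  swap {a b a' b' t t'} ha h := by
    have key : ∀ s : A × A × A, (triple s).reverse = triple (s.2.2, s.2.1, s.1) := fun s => rfl
    have key2 : ∀ s : A × A × A, triple (knuthSwap (fun x y : A => x ≤ y) s) =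
        (triple (knuthSwap (fun x y : A => x < y) (s.2.2, s.2.1, s.1))).reverse := by
      rintro ⟨x, y, z⟩
      simp only [knuthSwap, key]
      split_ifs <;> first | rfl | (exfalso; order)
    have h0 := congrArg List.length h
    simp only [List.length_reverse, hφ.length_eq] at h0
    have h1 := congrArg List.reverse h
    simp only [List.reverse_reverse, List.reverse_append, key] at h1
    rw [← List.append_assoc, ← List.append_assoc] at h1
    have h2 := hφ.swap (by simp at h0 ⊢; omega) h1
    simp only [List.reverse_append, key2, List.reverse_reverse]
    rw [← List.append_assoc, h2]
    simp

variable [DecidableEq A]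

/-- The number of unmatched letters `a`, when letters `b` are matched with letters `a` to their
right. -/
def freeA (a b : A) : List A → ℕ
  | [] => 0
  -- If no `a` is free in `w`, truncated subtraction gives `0`: the letter `b` has nothing to cancel
  -- and stays unmatched.
  | x :: w => if x = a then freeA a b w + 1 else if x = b then freeA a b w - 1 else freeA a b w

/-- The number of unmatched letters `b`. -/
def freeB (a b : A) : List A → ℕ
  | [] => 0
  | x :: w => if x = b ∧ freeA a b w = 0 then freeB a b w + 1 else freeB a b w

/-- Replace the first `t` unmatched letters by `a`, and the remaining ones by `b`. -/
def fill (a b : A) : ℕ → List A → List A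
  | _, [] => []
  | t, x :: w =>
    if x = a ∨ x = b ∧ freeA a b w = 0 then (if t = 0 then b else a) :: fill a b (t - 1) w
    -- The partner of this `b` is the first unmatched `a` of `w` taken alone; the additional unit
    -- makes `fill` keep it equal to `a`.
    else if x = b then b :: fill a b (t + 1) w
    else x :: fill a b t w

/-- The letter permuting operator. -/
def flip (a b : A) (w : List A) : List A := fill a b (freeB a b w) w

theorem length_fill (a b : A) (t : ℕ) (w : List A) : (fill a b t w).length = w.length := by
  induction w generalizing t with
  | nil => rfl
  | cons x w ih => unfold fill; split_ifs <;> simp [ih]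

variable {a b : A}

/-- The unmatched letters are replaced by a word `a … a b … b`, which creates no new match `b a`.
The matching is therefore preserved and only the two counts change. -/
theorem free_fill (hab : a ≠ b) (t : ℕ) (w : List A) :
    freeA a b (fill a b t w) = min t (freeA a b w + freeB a b w) ∧
    freeB a b (fill a b t w) = freeA a b w + freeB a b w - t := by
  induction w generalizing t with
  | nil => simp [fill, freeA, freeB]
  | cons x w ih =>
    have h1 := ih (t - 1)
    have h2 := ih t
    have h3 := ih (t + 1)
    clear ih
    unfold fill
    by_cases hxa : x = a
    · subst hxa
      by_cases ht : t = 0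
      · subst ht
        simp only [Nat.zero_sub] at h1
        simp [freeA, freeB, hab, hab.symm]
        grind
      · simp [freeA, freeB, hab, hab.symm, ht]
        grind
    · by_cases hxb : x = b
      · subst hxb
        by_cases h0 : freeA a x w = 0
        · by_cases ht : t = 0
          · simp [freeA, freeB, hab, hab.symm, ht, h0]
            grind
          · simp [freeA, freeB, hab, hab.symm, ht, h0]
            grind
        · simp [freeA, freeB, hab, hab.symm, h0]
          grind
      · simp [freeA, freeB, hxa, hxb]
        grind

theorem fill_fill (hab : a ≠ b) (t t' : ℕ) (w : List A) :
    fill a b t (fill a b t' w) = fill a b t w := by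
  induction w generalizing t t' with
  | nil => rfl
  | cons x w ih =>
    by_cases hxa : x = a
    · subst hxa
      by_cases ht : t' = 0
      · simp [fill, ht, hab.symm, ih, free_fill hab]
      · simp [fill, ht, ih]
    · by_cases hxb : x = b
      · subst hxb
        by_cases h0 : freeA a x w = 0
        · by_cases ht : t' = 0
          · simp [fill, ht, hab.symm, ih, free_fill hab, h0]
          · simp [fill, ht, ih, h0]
        · simp [fill, hxa, ih, h0, free_fill hab]
      · simp [fill, hxa, hxb, ih]

theorem fill_freeA (w : List A) : fill a b (freeA a b w) w = w := by
  induction w with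
  | nil => rfl
  | cons x w ih =>
    by_cases hxa : x = a
    · simp [fill, hxa, freeA, ih]
    · by_cases hxb : x = b
      · subst hxb
        by_cases h0 : freeA a x w = 0
        · rw [h0] at ih
          simp [fill, freeA, hxa, h0, ih]
        · have : freeA a x w - 1 + 1 = freeA a x w := by omega
          simp [fill, freeA, hxa, h0, this, ih]
      · simp [fill, hxa, hxb, freeA, ih]

/-- `flip` exchanges the numbers of unmatched `a` and `b` and leaves the matching alone. The second
application thus prescribes the original number of `a`, and a later `fill` overrides an earlier one.
-/
theorem flip_flip (hab : a ≠ b) (w : List A) : flip a b (flip a b w) = w := by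
  unfold flip
  rw [fill_fill hab, (free_fill hab _ _).2, Nat.add_sub_cancel, fill_freeA]

end Letters

end Plactic

namespace Plactic

/-! ### Naturality of the letter permuting operators -/

section LettersNat

variable {A : Type*} [LinearOrder A] {a b : A}

theorem free_append_congr {v v' : List A} (hA : freeA a b v = freeA a b v')
    (hB : freeB a b v = freeB a b v') (u : List A) :
    freeA a b (u ++ v) = freeA a b (u ++ v') ∧ freeB a b (u ++ v) = freeB a b (u ++ v') := by
  induction u with
  | nil => exact ⟨hA, hB⟩
  | cons x u ih => simp [freeA, freeB, ih.1, ih.2]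

/-- The effect of `fill` on the first letter. -/
def fillHead (a b : A) (t R : ℕ) (x : A) : A :=
  if x = a ∨ x = b ∧ R = 0 then (if t = 0 then b else a) else x

/-- The number of letters `a` still to be distributed by `fill` after the first letter. -/
def fillNext (a b : A) (t R : ℕ) (x : A) : ℕ :=
  if x = a ∨ x = b ∧ R = 0 then t - 1 else if x = b then t + 1 else t

theorem fill_cons (t : ℕ) (x : A) (w : List A) : fill a b t (x :: w) =
    fillHead a b t (freeA a b w) x :: fill a b (fillNext a b t (freeA a b w) x) w := by
  unfold fillHead fillNext
  rw [fill]
  split_ifs <;> first | rfl | simp_all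

theorem fillHead_of_ne {x : A} (hxa : x ≠ a) (hxb : x ≠ b) (t R : ℕ) :
    fillHead a b t R x = x := by
  simp [fillHead, hxa, hxb]

theorem fillNext_of_ne {x : A} (hxa : x ≠ a) (hxb : x ≠ b) (t R : ℕ) :
    fillNext a b t R x = t := by
  simp [fillNext, hxa, hxb]

theorem freeA_cons_of_ne {x : A} (hxa : x ≠ a) (hxb : x ≠ b) (w : List A) :
    freeA a b (x :: w) = freeA a b w := by
  simp [freeA, hxa, hxb]

theorem freeB_cons_of_ne {x : A} (hxb : x ≠ b) (w : List A) :
    freeB a b (x :: w) = freeB a b w := by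
  simp [freeB, hxb]

theorem freeA_cons_eq_of_eq (x : A) {w w' : List A} (h : freeA a b w = freeA a b w') :
    freeA a b (x :: w) = freeA a b (x :: w') := by
  simp [freeA, h]

/-- By `hcov` no letter lies strictly between `a` and `b`, so another letter cannot tell them apart
by comparison. -/
theorem lt_fillHead_iff (hab : a < b) (hcov : ∀ x, x ≤ a ∨ b ≤ x) {x : A} (hxa : x ≠ a)
    (hxb : x ≠ b) (t R : ℕ) (y : A) : x < fillHead a b t R y ↔ x < y := by
  unfold fillHead
  have := hcov x
  split_ifs with h1 h2
  · rcases h1 with rfl | ⟨rfl, -⟩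
    · constructor <;> intro <;> rcases this with h | h <;> order
    · rfl
  · rcases h1 with rfl | ⟨rfl, -⟩
    · rfl
    · constructor <;> intro <;> rcases this with h | h <;> order
  · rfl

theorem fillHead_lt_iff (hab : a < b) (hcov : ∀ x, x ≤ a ∨ b ≤ x) {x : A} (hxa : x ≠ a)
    (hxb : x ≠ b) (t R : ℕ) (y : A) : fillHead a b t R y < x ↔ y < x := by
  unfold fillHead
  have := hcov x
  split_ifs with h1 h2
  · rcases h1 with rfl | ⟨rfl, -⟩
    · constructor <;> intro <;> rcases this with h | h <;> order
    · rfl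
  · rcases h1 with rfl | ⟨rfl, -⟩
    · rfl
    · constructor <;> intro <;> rcases this with h | h <;> order
  · rfl

/-- For neighbours in `{a, b}`, a descent is a factor `b a`. Such letters are matched with each
other and hence kept, and no new factor `b a` arises because the matching is preserved. -/
theorem fill_descent (hab : a < b) (hcov : ∀ x, x ≤ a ∨ b ≤ x) (t : ℕ) (x y : A) (v : List A) :
    fillHead a b (fillNext a b t (freeA a b (y :: v)) x) (freeA a b v) y <
      fillHead a b t (freeA a b (y :: v)) x ↔ y < x := by
  by_cases hx : x ≠ a ∧ x ≠ b
  · rw [fillHead_of_ne hx.1 hx.2, fillHead_lt_iff hab hcov hx.1 hx.2]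
  by_cases hy : y ≠ a ∧ y ≠ b
  · rw [fillHead_of_ne hy.1 hy.2, lt_fillHead_iff hab hcov hy.1 hy.2]
  have hx' : x = a ∨ x = b := by tauto
  have hy' : y = a ∨ y = b := by tauto
  have := hab.ne
  have := hab.ne'
  have := hab.not_gt
  rcases hx' with rfl | rfl <;> rcases hy' with rfl | rfl
  all_goals
    simp [freeA, fillHead, fillNext, *]
  all_goals (try split_ifs) <;> simp_all

/-- If the smallest letter `x` or the largest letter `z` of the move is neither `a` nor `b`, its
comparisons with the others survive `fill`, and so does the kind of the move. Otherwise the three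
letters are `a, b, b` or `a, a, b`, and changing an unmatched one can turn one kind of move into the
other. -/
theorem fill_knuthMove (hab : a < b) (hcov : ∀ x, x ≤ a ∨ b ≤ x) {s s' : List A}
    (hs : KnuthMove (fun x y : A => x < y) s s') (t : ℕ) (v : List A) :
    freeA a b (s ++ v) = freeA a b (s' ++ v) ∧ freeB a b (s ++ v) = freeB a b (s' ++ v) ∧
    ∃ m m' t', KnuthMove (fun x y : A => x < y) m m' ∧ fill a b t (s ++ v) = m ++ fill a b t' v ∧
      fill a b t (s' ++ v) = m' ++ fill a b t' v := by
  have hne := hab.ne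
  have hne' := hab.ne'
  cases hs with
  | @one x y z hxy hyz =>
    simp only [List.cons_append, List.nil_append]
    by_cases hx : x ≠ a ∧ x ≠ b
    · obtain ⟨hxa, hxb⟩ := hx
      refine ⟨by simp [freeA, hxa, hxb], by simp [freeA, freeB, hxa, hxb], _, _,
        fillNext a b (fillNext a b t (freeA a b (z :: v)) y) (freeA a b v) z,
        KnuthMove.one (x := x) (y := fillHead a b t (freeA a b (z :: v)) y)
        (z := fillHead a b (fillNext a b t (freeA a b (z :: v)) y) (freeA a b v) z) ?_ ?_, ?_, ?_⟩
      · exact (lt_fillHead_iff hab hcov hxa hxb _ _ _).2 hxy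
      · rwa [fill_descent hab hcov]
      · have := freeA_cons_eq_of_eq z (freeA_cons_of_ne hxa hxb v)
        simp only [fill_cons, this, freeA_cons_of_ne hxa hxb, fillHead_of_ne hxa hxb,
          fillNext_of_ne hxa hxb, List.cons_append, List.nil_append]
      · simp only [fill_cons, freeA_cons_of_ne hxa hxb, fillHead_of_ne hxa hxb,
          fillNext_of_ne hxa hxb, List.cons_append, List.nil_append]
    by_cases hz : z ≠ a ∧ z ≠ b
    · obtain ⟨hza, hzb⟩ := hz
      refine ⟨by simp [freeA, hza, hzb], by simp [freeA, freeB, hza, hzb], _, _,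
        fillNext a b (fillNext a b t (freeA a b (x :: v)) y) (freeA a b v) x,
        KnuthMove.one (z := z) (y := fillHead a b t (freeA a b (x :: v)) y)
        (x := fillHead a b (fillNext a b t (freeA a b (x :: v)) y) (freeA a b v) x) ?_ ?_, ?_, ?_⟩
      · rwa [fill_descent hab hcov]
      · rwa [lt_fillHead_iff hab hcov hza hzb]
      · simp only [fill_cons, freeA_cons_of_ne hza hzb, fillHead_of_ne hza hzb,
          fillNext_of_ne hza hzb, List.cons_append, List.nil_append]
      · have := freeA_cons_eq_of_eq x (freeA_cons_of_ne hza hzb v)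
        simp only [fill_cons, this, freeA_cons_of_ne hza hzb, fillHead_of_ne hza hzb,
          fillNext_of_ne hza hzb, List.cons_append, List.nil_append]
    have hx' : x = a ∨ x = b := by tauto
    have hz' : z = a ∨ z = b := by tauto
    obtain ⟨rfl, rfl, rfl⟩ : x = a ∧ y = b ∧ z = b := by
      have := hcov y
      rcases hx' with rfl | rfl <;> rcases hz' with rfl | rfl
      · exact absurd hxy hyz
      · refine ⟨rfl, ?_, rfl⟩
        rcases this with h | h <;> order
      · exfalso; order
      · exact absurd hxy hyz
    by_cases hR : freeA x z v = 0
    · refine ⟨by simp [freeA, hR, hne'], by simp [freeA, freeB, hR, hne, hne'], ?_⟩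
      -- Exactly one letter `b` is unmatched in each word. For `t = 0` it stays; otherwise it
      -- becomes `a`, and `b b a`, `b a b` turn into `a b a`, `b a a`.
      rcases t with _ | t
      · exact ⟨_, _, 0, KnuthMove.one hab hyz, by simp [fill, freeA, hR, hne, hne'],
          by simp [fill, freeA, hR, hne, hne']⟩
      · exact ⟨_, _, t, KnuthMove.two (lt_irrefl _) hab, by simp [fill, freeA, hR, hne, hne'],
          by simp [fill, freeA, hR, hne, hne']⟩
    · refine ⟨by simp [freeA, hne'], by simp [freeA, freeB, hR, hne, hne'], _, _, t + 1, KnuthMove.one hab hyz,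
        by simp [fill, freeA, hR, hne, hne'], by simp [fill, freeA, hR, hne, hne']⟩
  | @two x y z hxy hyz =>
    simp only [List.cons_append, List.nil_append]
    by_cases hx : x ≠ a ∧ x ≠ b
    · obtain ⟨hxa, hxb⟩ := hx
      refine ⟨by simp [freeA, hxa, hxb], (freeB_cons_of_ne hxb _).trans
        (free_append_congr (freeA_cons_of_ne hxa hxb _) (freeB_cons_of_ne hxb _) [z]).2.symm, _, _,
        fillNext a b (fillNext a b t (freeA a b (y :: v)) z) (freeA a b v) y,
        KnuthMove.two (x := x) (z := fillHead a b t (freeA a b (y :: v)) z)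
        (y := fillHead a b (fillNext a b t (freeA a b (y :: v)) z) (freeA a b v) y) ?_ ?_, ?_, ?_⟩
      · rwa [fillHead_lt_iff hab hcov hxa hxb]
      · rwa [fill_descent hab hcov]
      · simp only [fill_cons, freeA_cons_of_ne hxa hxb, fillHead_of_ne hxa hxb,
          fillNext_of_ne hxa hxb, List.cons_append, List.nil_append]
      · have := freeA_cons_of_ne hxa hxb (y :: v)
        simp only [fill_cons, this, freeA_cons_of_ne hxa hxb, fillHead_of_ne hxa hxb,
          fillNext_of_ne hxa hxb, List.cons_append, List.nil_append]
    by_cases hz : z ≠ a ∧ z ≠ b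
    · obtain ⟨hza, hzb⟩ := hz
      refine ⟨by simp [freeA, hza, hzb], ((freeB_cons_of_ne hzb _).trans
        (free_append_congr (freeA_cons_of_ne hza hzb _) (freeB_cons_of_ne hzb _) [x]).2.symm).symm, _, _,
        fillNext a b (fillNext a b t (freeA a b (y :: v)) x) (freeA a b v) y,
        KnuthMove.two (z := z) (x := fillHead a b t (freeA a b (y :: v)) x)
        (y := fillHead a b (fillNext a b t (freeA a b (y :: v)) x) (freeA a b v) y) ?_ ?_, ?_, ?_⟩
      · rwa [fill_descent hab hcov]
      · exact (fillHead_lt_iff hab hcov hza hzb _ _ _).2 hyz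
      · have := freeA_cons_of_ne hza hzb (y :: v)
        simp only [fill_cons, this, freeA_cons_of_ne hza hzb, fillHead_of_ne hza hzb,
          fillNext_of_ne hza hzb, List.cons_append, List.nil_append]
      · simp only [fill_cons, freeA_cons_of_ne hza hzb, fillHead_of_ne hza hzb,
          fillNext_of_ne hza hzb, List.cons_append, List.nil_append]
    have hx' : x = a ∨ x = b := by tauto
    have hz' : z = a ∨ z = b := by tauto
    obtain ⟨rfl, rfl, rfl⟩ : x = a ∧ y = a ∧ z = b := by
      have := hcov y
      rcases hx' with rfl | rfl <;> rcases hz' with rfl | rfl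
      · exfalso; order
      · refine ⟨rfl, ?_, rfl⟩
        rcases this with h | h <;> order
      · exfalso; order
      · exfalso; order
    refine ⟨by simp [freeA, hne'], by simp [freeA, freeB, hne, hne'], ?_⟩
    rcases t with _ | t
    · exact ⟨_, _, 0, KnuthMove.one hab (lt_irrefl _), by simp [fill, freeA, hne, hne'],
        by simp [fill, freeA, hne, hne']⟩
    · exact ⟨_, _, t, KnuthMove.two hxy hab, by simp [fill, freeA, hne, hne'],
        by simp [fill, freeA, hne, hne']⟩

theorem KnuthMove.eq_triple {r : A → A → Prop} [DecidableRel r] (h : Bumping r) {m m' : List A}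
    (hm : KnuthMove r m m') : ∃ s, m = triple s ∧ m' = triple (knuthSwap r s) := by
  cases hm with
  | @one x y z hxy hyz =>
    refine ⟨(y, z, x), rfl, ?_⟩
    simp [knuthSwap, triple, hxy, hyz, h.left hxy hyz]
  | @two x y z hxy hyz =>
    refine ⟨(x, z, y), rfl, ?_⟩
    have : ¬ r z x := fun hzx => hxy (h.trans hyz hzx)
    simp [knuthSwap, triple, hxy, hyz, this]

theorem knuthMove_or {r : A → A → Prop} [DecidableRel r] (s : A × A × A) :
    KnuthMove r (triple s) (triple (knuthSwap r s)) ∨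
    KnuthMove r (triple (knuthSwap r s)) (triple s) ∨ (r s.2.1 s.1 ↔ r s.2.2 s.2.1) := by
  obtain ⟨x, y, z⟩ := s
  simp only [triple, knuthSwap]
  split_ifs with h1 h2 h3 h4 h5
  · tauto
  · exact Or.inr (Or.inl (KnuthMove.two h2 h3))
  · exact Or.inr (Or.inl (KnuthMove.one h1 h3))
  · exact Or.inl (KnuthMove.one h5 h1)
  · exact Or.inl (KnuthMove.two h5 h4)
  · tauto

theorem knuthSwap_of_iff {r : A → A → Prop} [DecidableRel r] {s : A × A × A}
    (hs : r s.2.1 s.1 ↔ r s.2.2 s.2.1) : knuthSwap r s = s := by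
  unfold knuthSwap
  split_ifs <;> tauto

theorem free_knuthSwap (hab : a < b) (hcov : ∀ x, x ≤ a ∨ b ≤ x) (s : A × A × A) (v : List A) :
    freeA a b (triple (knuthSwap (fun x y : A => x < y) s) ++ v) = freeA a b (triple s ++ v) ∧
    freeB a b (triple (knuthSwap (fun x y : A => x < y) s) ++ v) = freeB a b (triple s ++ v) := by
  rcases knuthMove_or (r := fun x y => x < y) s with h | h | h
  · obtain ⟨h1, h2, -⟩ := fill_knuthMove hab hcov h 0 v
    exact ⟨h1.symm, h2.symm⟩
  · obtain ⟨h1, h2, -⟩ := fill_knuthMove hab hcov h 0 v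
    exact ⟨h1, h2⟩
  · rw [knuthSwap_of_iff h]
    exact ⟨rfl, rfl⟩

theorem fill_knuthSwap (hab : a < b) (hcov : ∀ x, x ≤ a ∨ b ≤ x) {t : ℕ} {s s' : A × A × A}
    {v v' : List A} (h : fill a b t (triple s ++ v) = triple s' ++ v') :
    fill a b t (triple (knuthSwap (fun x y : A => x < y) s) ++ v) =
      triple (knuthSwap (fun x y : A => x < y) s') ++ v' := by
  rcases knuthMove_or (r := fun x y => x < y) s with hs | hs | hs
  · obtain ⟨-, -, m, m', t', hm, h1, h2⟩ := fill_knuthMove hab hcov hs t v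
    obtain ⟨s1, rfl, rfl⟩ := hm.eq_triple Bumping.lt
    rw [h] at h1
    obtain ⟨h3, h4⟩ := List.append_inj h1 rfl
    rw [h2, h4, triple_injective h3]
  · obtain ⟨-, -, m, m', t', hm, h1, h2⟩ := fill_knuthMove hab hcov hs t v
    obtain ⟨s1, rfl, rfl⟩ := hm.eq_triple Bumping.lt
    rw [h] at h2
    obtain ⟨h3, h4⟩ := List.append_inj h2 rfl
    rw [h1, h4, triple_injective h3, knuthSwap_knuthSwap Bumping.lt]
  -- A triple with two descents, or with none, is fixed by the swap; so is its image, since `fill`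
  -- preserves descents.
  · rw [knuthSwap_of_iff hs, knuthSwap_of_iff, h]
    obtain ⟨x, y, z⟩ := s
    obtain ⟨x', y', z'⟩ := s'
    simp only [triple, List.cons_append, List.nil_append, fill_cons, List.cons.injEq] at h hs ⊢
    rw [← h.1, ← h.2.1, ← h.2.2.1, fill_descent hab hcov, fill_descent hab hcov, hs]

theorem natOp_flip (hab : a < b) (hcov : ∀ x, x ≤ a ∨ b ≤ x) :
    NatOp (fun x y : A => x < y) (flip a b) where
  length_eq W := length_fill _ _ _ _
  descent {p v p' v' x y x' y'} hp h := by
    unfold flip at h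
    -- The parameter of `fill` changes along the prefix, so the induction needs an arbitrary `t`.
    generalize freeB a b (p ++ x :: y :: v) = t at h
    induction p generalizing p' t with
    | nil =>
      obtain rfl : p' = [] := List.eq_nil_of_length_eq_zero hp.symm
      simp only [List.nil_append, fill_cons, List.cons.injEq] at h
      rw [← h.1, ← h.2.1, fill_descent hab hcov]
    | cons c p ih =>
      rcases p' with _ | ⟨c', p'⟩
      · simp at hp
      simp only [List.cons_append, fill_cons, List.cons.injEq] at h
      exact ih (by simpa using hp) _ h.2
  swap {p v p' v' s s'} hp h := by
    unfold flip at h ⊢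
    have hf := free_knuthSwap hab hcov s v
    have hf' := fun q => free_append_congr (a := a) (b := b) hf.1 hf.2 q
    simp only [List.append_assoc] at h ⊢
    rw [(hf' p).2]
    generalize freeB a b (p ++ (triple s ++ v)) = t at h
    induction p generalizing p' t with
    | nil =>
      obtain rfl : p' = [] := List.eq_nil_of_length_eq_zero hp.symm
      exact fill_knuthSwap hab hcov h
    | cons c p ih =>
      rcases p' with _ | ⟨c', p'⟩
      · simp at hp
      simp only [List.cons_append, fill_cons, List.cons.injEq] at h ⊢
      rw [(hf' p).1]
      exact ⟨h.1, ih (by simpa using hp) _ h.2⟩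

theorem freeA_fill_of_ne {c d : A} (hca : c ≠ a) (hcb : c ≠ b) (hda : d ≠ a) (hdb : d ≠ b)
    (t : ℕ) (w : List A) :
    freeA c d (fill a b t w) = freeA c d w ∧ freeB c d (fill a b t w) = freeB c d w := by
  induction w generalizing t with
  | nil => exact ⟨rfl, rfl⟩
  | cons x w ih =>
    rw [fill_cons]
    by_cases hx : x = a ∨ x = b
    · have h1 : fillHead a b t (freeA a b w) x = a ∨ fillHead a b t (freeA a b w) x = b := by
        unfold fillHead
        split_ifs <;> tauto
      generalize fillHead a b t (freeA a b w) x = y at h1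
      have h2 : x ≠ c ∧ x ≠ d ∧ y ≠ c ∧ y ≠ d := by
        rcases hx with rfl | rfl <;> rcases h1 with rfl | rfl <;> tauto
      rw [freeA_cons_of_ne h2.2.2.1 h2.2.2.2, freeA_cons_of_ne h2.1 h2.2.1,
        freeB_cons_of_ne h2.2.2.2, freeB_cons_of_ne h2.2.1]
      exact ih _
    · push Not at hx
      rw [fillHead_of_ne hx.1 hx.2]
      exact free_append_congr (ih _).1 (ih _).2 [x]

theorem fill_comm {c d : A} (hca : c ≠ a) (hcb : c ≠ b) (hda : d ≠ a) (hdb : d ≠ b)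
    (t t' : ℕ) (w : List A) :
    fill c d t' (fill a b t w) = fill a b t (fill c d t' w) := by
  induction w generalizing t t' with
  | nil => rfl
  | cons x w ih =>
    rw [fill_cons, fill_cons, fill_cons (a := c), fill_cons (a := a)]
    have h1 := fun t => (freeA_fill_of_ne hca hcb hda hdb t w).1
    have h2 := fun t => (freeA_fill_of_ne hca.symm hda.symm hcb.symm hdb.symm t w).1
    rw [h1, h2]
    by_cases hx : x = a ∨ x = b
    · have h3 : fillHead a b t (freeA a b w) x = a ∨ fillHead a b t (freeA a b w) x = b := by
        unfold fillHead
        split_ifs <;> tauto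
      have h2 : x ≠ c ∧ x ≠ d := by
        rcases hx with rfl | rfl <;> tauto
      have h4 : fillHead a b t (freeA a b w) x ≠ c ∧ fillHead a b t (freeA a b w) x ≠ d := by
        rcases h3 with h3 | h3 <;> rw [h3] <;> tauto
      simp only [fillHead_of_ne h2.1 h2.2, fillNext_of_ne h2.1 h2.2, fillHead_of_ne h4.1 h4.2,
        fillNext_of_ne h4.1 h4.2, ih]
    · push Not at hx
      simp only [fillHead_of_ne hx.1 hx.2, fillNext_of_ne hx.1 hx.2, ih]
      have h4 : fillHead c d t' (freeA c d w) x ≠ a ∧ fillHead c d t' (freeA c d w) x ≠ b := by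
        unfold fillHead
        split_ifs
        · exact ⟨hda, hdb⟩
        · exact ⟨hca, hcb⟩
        · exact hx
      simp only [fillHead_of_ne h4.1 h4.2, fillNext_of_ne h4.1 h4.2]

theorem flip_comm {c d : A} (hca : c ≠ a) (hcb : c ≠ b) (hda : d ≠ a) (hdb : d ≠ b)
    (w : List A) : flip c d (flip a b w) = flip a b (flip c d w) := by
  unfold flip
  rw [(freeA_fill_of_ne hca hcb hda hdb _ _).2,
    (freeA_fill_of_ne hca.symm hda.symm hcb.symm hdb.symm _ _).2, fill_comm hca hcb hda hdb]

end LettersNat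

end Plactic

namespace Plactic

/-! ### The braid relation on three-letter tableaux -/

section Braid

variable {A : Type*} [LinearOrder A] {a b c : A}

theorem free_replicate_left (m : ℕ) (w : List A) :
    freeA a b (List.replicate m a ++ w) = freeA a b w + m := by
  induction m with
  | zero => rfl
  | succ m ih =>
    simp [List.replicate_succ, freeA, ih]
    omega

theorem freeB_replicate_left (hab : a ≠ b) (m : ℕ) (w : List A) :
    freeB a b (List.replicate m a ++ w) = freeB a b w := by
  induction m with
  | zero => rfl
  | succ m ih => simp [List.replicate_succ, freeB, ih, hab]

theorem freeA_replicate_right (hab : a ≠ b) (m : ℕ) (w : List A) :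
    freeA a b (List.replicate m b ++ w) = freeA a b w - m := by
  induction m with
  | zero => rfl
  | succ m ih =>
    simp [List.replicate_succ, freeA, ih, hab.symm]
    omega

theorem freeB_replicate_right (hab : a ≠ b) (m : ℕ) (w : List A) :
    freeB a b (List.replicate m b ++ w) = freeB a b w + (m - freeA a b w) := by
  induction m with
  | zero => simp
  | succ m ih =>
    simp only [List.replicate_succ, List.cons_append, freeB, ih, freeA_replicate_right hab,
      true_and]
    split_ifs <;> omega

theorem free_replicate_of_ne (hca : c ≠ a) (hcb : c ≠ b) (m : ℕ) (w : List A) :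
    freeA a b (List.replicate m c ++ w) = freeA a b w ∧
    freeB a b (List.replicate m c ++ w) = freeB a b w := by
  induction m with
  | zero => exact ⟨rfl, rfl⟩
  | succ m ih => simpa [List.replicate_succ, freeA, freeB, hca, hcb] using ih

theorem fill_replicate_of_ne (hca : c ≠ a) (hcb : c ≠ b) (t m : ℕ) (w : List A) :
    fill a b t (List.replicate m c ++ w) = List.replicate m c ++ fill a b t w := by
  induction m with
  | zero => rfl
  | succ m ih => simp [List.replicate_succ, fill, hca, hcb, ih]

theorem fill_replicate_left (t m : ℕ) (w : List A) :
    fill a b t (List.replicate m a ++ w) =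
      List.replicate (min t m) a ++ (List.replicate (m - t) b ++ fill a b (t - m) w) := by
  induction m generalizing t with
  | zero => simp
  | succ m ih =>
    rw [List.replicate_succ, List.cons_append, fill, if_pos (Or.inl rfl)]
    rcases t with _ | t
    · rw [if_pos rfl, ih]
      simp only [Nat.zero_sub, Nat.zero_min, Nat.sub_zero, List.replicate_zero, List.nil_append,
        List.replicate_succ, List.cons_append]
    · rw [if_neg (Nat.succ_ne_zero t), Nat.add_sub_add_right, Nat.add_sub_add_right]
      change a :: fill a b t (List.replicate m a ++ w) = _
      rw [ih, ← Nat.succ_eq_add_one, ← Nat.succ_eq_add_one, Nat.succ_min_succ, List.replicate_succ,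
        List.cons_append, Nat.succ_sub_succ]

/-- In a block of letters `b` placed before `w`, the last ones are matched with the free letters `a`
of `w`. The earlier ones stay unmatched and are filled. -/
theorem fill_replicate_right (hab : a ≠ b) (t m : ℕ) (w : List A) :
    fill a b t (List.replicate m b ++ w) =
      List.replicate (min t (m - freeA a b w)) a ++ (List.replicate (m - freeA a b w - t) b ++
        (List.replicate (min m (freeA a b w)) b ++
          fill a b (t - (m - freeA a b w) + min m (freeA a b w)) w)) := by
  induction m generalizing t with
  | zero => simp
  | succ m ih =>
    simp only [List.replicate_succ, List.cons_append, fill, hab.symm, false_or, true_and,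
      freeA_replicate_right hab, ih, if_true]
    by_cases h : freeA a b w - m = 0
    · have h1 : m + 1 - freeA a b w = (m - freeA a b w) + 1 := by omega
      have h2 : min (m + 1) (freeA a b w) = min m (freeA a b w) := by omega
      rw [if_pos h, h1, h2]
      rcases t with _ | t
      · simp [List.replicate_succ]
      · simp [List.replicate_succ]
    · have h1 : m + 1 - freeA a b w = 0 := by omega
      have h2 : m - freeA a b w = 0 := by omega
      have h3 : min (m + 1) (freeA a b w) = min m (freeA a b w) + 1 := by omega
      rw [if_neg h, h1, h2, h3]
      simp only [Nat.min_zero, List.replicate_zero, List.nil_append, Nat.zero_sub, Nat.sub_zero,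
        List.replicate_succ, List.cons_append]
      rw [Nat.add_right_comm, Nat.add_assoc]

/-- The row reading of a tableau with letters `a < b < c`. -/
def threeRows (a b c : A) (f d e g h k : ℕ) : List A :=
  List.replicate f c ++ (List.replicate d b ++ (List.replicate e c ++
    (List.replicate g a ++ (List.replicate h b ++ (List.replicate k c ++ [])))))

theorem replicate_merge {x y m n m' n' : ℕ} (h : m = 0 ∨ x = 0) (h1 : n + x = n')
    (h2 : m + y = m') (w : List A) :
    List.replicate n a ++ (List.replicate m b ++ (List.replicate x a ++
      (List.replicate y b ++ w))) = List.replicate n' a ++ (List.replicate m' b ++ w) := by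
  subst h1 h2
  rcases h with rfl | rfl
  · simp [← List.append_assoc]
  · simp [← List.append_assoc]

theorem replicate_append_replicate_append (m n : ℕ) (x : A) (w : List A) :
    List.replicate m x ++ (List.replicate n x ++ w) = List.replicate (m + n) x ++ w := by
  rw [List.replicate_add, List.append_assoc]

/-- The `d` letters `b` of the middle row are matched with the first `d` letters `a` of the bottom
row, so only the remaining `g - d` letters `a` and the `h` letters `b` of that row exchange their
numbers. -/
theorem flip_threeRows_left (hab : a < b) (hbc : b < c) {f d e g h k : ℕ} (hdg : d ≤ g) :
    flip a b (threeRows a b c f d e g h k) = threeRows a b c f d e (d + h) (g - d) k := by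
  have hca := (hab.trans hbc).ne'
  have hcb := hbc.ne'
  unfold flip threeRows
  simp only [free_replicate_left, freeB_replicate_left hab.ne, freeA_replicate_right hab.ne,
    freeB_replicate_right hab.ne, (free_replicate_of_ne hca hcb _ _).1,
    (free_replicate_of_ne hca hcb _ _).2, fill_replicate_of_ne hca hcb, fill_replicate_left,
    fill_replicate_right hab.ne, freeA, freeB, fill]
  simp only [Nat.zero_sub, Nat.zero_add, Nat.sub_zero]
  have e1 : d - g = 0 := by omega
  have e2 : min d g = d := by omega
  simp only [e1, e2, Nat.min_zero, Nat.zero_sub, Nat.sub_zero, List.replicate_zero,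
    List.nil_append, Nat.zero_add, Nat.add_zero]
  congr 2
  rw [replicate_merge (n' := d + h) (m' := g - d)]
  all_goals omega

/-- All letters `c` of the top row are matched with the first `f` letters `b` of the middle row, and
`min e h` letters `c` of the middle row with letters `b` of the bottom row. The unmatched places
are, in order, `d - f` and `e - h` in the middle row, then `h - e` and `k` in the bottom row; they
are refilled with the two numbers exchanged. -/
theorem flip_threeRows_right (hab : a < b) (hbc : b < c) {f d e g h k : ℕ} (hfd : f ≤ d) :
    flip b c (threeRows a b c f d e g h k) = threeRows a b c f
      (min d (k + f) + (e - h)) (d - (k + f) + min e h) g (min e h + (k + f - d))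
      (h - e + min k (d - f)) := by
  have hac := (hab.trans hbc).ne
  have hne := hab.ne
  unfold flip threeRows
  simp only [free_replicate_left, freeB_replicate_left hbc.ne, freeA_replicate_right hbc.ne,
    freeB_replicate_right hbc.ne, (free_replicate_of_ne hne hac _ _).1,
    (free_replicate_of_ne hne hac _ _).2, fill_replicate_of_ne hne hac, fill_replicate_left,
    fill_replicate_right hbc.ne, freeA, freeB, fill]
  simp only [Nat.zero_sub, Nat.zero_add, Nat.min_zero, Nat.sub_zero, List.replicate_zero,
    List.nil_append, Nat.add_zero]
  have e1 : f - (h - e + d) = 0 := by omega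
  have e2 : min f (h - e + d) = f := by omega
  simp only [e1, e2, Nat.min_zero, Nat.zero_sub, Nat.sub_zero, List.replicate_zero,
    List.nil_append, Nat.zero_add, Nat.add_zero]
  congr 1
  generalize hu : k + (e - h) + f - d = u
  rw [replicate_merge (by omega) rfl rfl, replicate_merge (by omega) rfl rfl,
    replicate_append_replicate_append]
  repeat' first | omega | congr 1

/-- The previous formulas make each side a three-row reading with piecewise linear exponents,
compared on each domain of linearity. -/
theorem threeRows_braid (hab : a < b) (hbc : b < c) {f d e g h k : ℕ} (hfd : f ≤ d) (hdg : d ≤ g)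
    (hde : d + e ≤ g + h) :
    flip a b (flip b c (flip a b (threeRows a b c f d e g h k))) =
      flip b c (flip a b (flip b c (threeRows a b c f d e g h k))) := by
  rw [flip_threeRows_left hab hbc hdg, flip_threeRows_right hab hbc hfd,
    flip_threeRows_left hab hbc (by omega), flip_threeRows_right hab hbc hfd,
    flip_threeRows_left hab hbc (by omega), flip_threeRows_right hab hbc (by omega)]
  congr 1
  all_goals
    rcases le_total d (k + f) with h1 | h1 <;> rcases le_total e h with h2 | h2 <;>
    rcases le_total e (g - d) with h3 | h3 <;> simp only [min_eq_left, min_eq_right, h1, h2, h3,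
      Nat.sub_eq_zero_of_le, Nat.add_zero, Nat.zero_add] <;> omega

end Braid

end Plactic

namespace Plactic

/-! ### Reduction of the braid relation to three-letter tableaux -/

section BraidWords

variable {A : Type*} [LinearOrder A] {a b c : A}

theorem free_filter {p : A → Bool} (ha : p a) (hb : p b) (w : List A) :
    freeA a b (w.filter p) = freeA a b w ∧ freeB a b (w.filter p) = freeB a b w := by
  induction w with
  | nil => exact ⟨rfl, rfl⟩
  | cons x w ih =>
    by_cases hx : p x
    · rw [List.filter_cons_of_pos hx]
      exact free_append_congr ih.1 ih.2 [x]
    · have hxa : x ≠ a := fun h => hx (h ▸ ha)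
      have hxb : x ≠ b := fun h => hx (h ▸ hb)
      rw [List.filter_cons_of_neg hx, freeA_cons_of_ne hxa hxb, freeB_cons_of_ne hxb]
      exact ih

theorem fillHead_eq_or (t R : ℕ) (x : A) : fillHead a b t R x = x ∨
    (x = a ∨ x = b) ∧ (fillHead a b t R x = a ∨ fillHead a b t R x = b) := by
  unfold fillHead
  split_ifs <;> tauto

/-- Letters outside `p` stay in place and play no role in the matching. With `eq_of_filter_eq` this
reduces identities between such operators to subwords in few letters. -/
theorem filter_fill {p : A → Bool} (ha : p a) (hb : p b) (t : ℕ) (w : List A) :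
    (fill a b t w).filter p = fill a b t (w.filter p) ∧
    (fill a b t w).map (fun x => if p x then none else some x) =
      w.map (fun x => if p x then none else some x) := by
  induction w generalizing t with
  | nil => exact ⟨rfl, rfl⟩
  | cons x w ih =>
    rw [fill_cons]
    by_cases hx : p x
    · have hx' : p (fillHead a b t (freeA a b w) x) := by
        rcases fillHead_eq_or (a := a) (b := b) t (freeA a b w) x with h | ⟨-, h | h⟩ <;>
          rw [h] <;> assumption
      rw [List.filter_cons_of_pos hx', List.filter_cons_of_pos hx, fill_cons,
        (free_filter ha hb w).1, (ih _).1]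
      exact ⟨rfl, by simp [hx, hx', (ih _).2]⟩
    · have hxa : x ≠ a := fun h => hx (h ▸ ha)
      have hxb : x ≠ b := fun h => hx (h ▸ hb)
      rw [fillHead_of_ne hxa hxb, fillNext_of_ne hxa hxb, List.filter_cons_of_neg hx,
        List.filter_cons_of_neg hx]
      exact ⟨(ih _).1, by simp [(ih _).2]⟩

theorem filter_flip {p : A → Bool} (ha : p a) (hb : p b) (w : List A) :
    (flip a b w).filter p = flip a b (w.filter p) ∧
    (flip a b w).map (fun x => if p x then none else some x) =
      w.map (fun x => if p x then none else some x) := by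
  unfold flip
  rw [(free_filter ha hb w).2]
  exact filter_fill ha hb _ w

theorem eq_of_filter_eq {p : A → Bool} {w w' : List A} (h1 : w.filter p = w'.filter p)
    (h2 : w.map (fun x => if p x then none else some x) =
      w'.map (fun x => if p x then none else some x)) : w = w' := by
  induction w generalizing w' with
  | nil => exact (List.map_eq_nil_iff.1 h2.symm).symm
  | cons x w ih =>
    rcases w' with _ | ⟨x', w'⟩
    · simp at h2
    simp only [List.map_cons, List.cons.injEq] at h2
    by_cases hx : p x <;> by_cases hx' : p x'
    · rw [List.filter_cons_of_pos hx, List.filter_cons_of_pos hx', List.cons.injEq] at h1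
      rw [h1.1, ih h1.2 h2.2]
    · simp [hx, hx'] at h2
    · simp [hx, hx'] at h2
    · rw [List.filter_cons_of_neg hx, List.filter_cons_of_neg hx'] at h1
      simp only [hx, hx', Bool.false_eq_true, if_false, Option.some.injEq] at h2
      rw [h2.1, ih h1 h2.2]

/-- Each letter at most `z` of the upper row stands on a strictly smaller letter of the lower row.
-/
theorem countP_le_of_above {x y : List A} (h : Above (fun x y : A => x < y) x y) (z : A) :
    x.countP (· ≤ z) ≤ y.countP (· < z) := by
  induction x generalizing y with
  | nil => simp
  | cons u x ih =>
    rcases y with _ | ⟨v, y⟩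
    · simp at h
    have h1 := ih h.2
    have h2 : u ≤ z → v < z := fun hu => lt_of_lt_of_le h.1 hu
    simp only [List.countP_cons, decide_eq_true_eq]
    split_ifs <;> first | omega | tauto

theorem exists_replicate {l : List A} (hab : a < b) (hbc : b < c)
    (hs : Sorted (fun x y : A => x < y) l) (hl : ∀ x ∈ l, x = a ∨ x = b ∨ x = c) :
    ∃ i j k, l = List.replicate i a ++ (List.replicate j b ++ List.replicate k c) := by
  induction l with
  | nil => exact ⟨0, 0, 0, rfl⟩
  | cons x l ih =>
    rw [Sorted, List.pairwise_cons] at hs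
    simp only [List.mem_cons, forall_eq_or_imp] at hl
    obtain ⟨i, j, k, rfl⟩ := ih hs.2 hl.2
    have hs := hs.1
    rcases hl.1 with rfl | rfl | rfl
    · exact ⟨i + 1, j, k, by simp [List.replicate_succ]⟩
    · have : i = 0 := by
        by_contra h0
        exact hs a (by simp [h0]) hab
      subst this
      exact ⟨0, j + 1, k, by simp [List.replicate_succ]⟩
    · have hi : i = 0 := by
        by_contra h0
        exact hs a (by simp [h0]) (hab.trans hbc)
      have hj : j = 0 := by
        by_contra h0
        exact hs b (by simp [h0]) hbc
      subst hi hj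
      exact ⟨0, 0, k + 1, by simp [List.replicate_succ]⟩

theorem flatten_eq_nil_of_above_nil {r : A → A → Prop} {L : List (List A)}
    (h : Tab r (L ++ [[]])) : L.flatten = [] := by
  induction L with
  | nil => rfl
  | cons l L ih =>
    rw [List.cons_append, tab_cons] at h
    have h1 := ih h.2.2
    have h2 : l = [] := by
      have h3 := h.2.1
      rcases L with _ | ⟨m, L⟩
      · have := (h3 [] (by simp)).length_le
        simpa using this
      · have := (h3 m (by simp)).length_le
        simp only [List.flatten_cons, List.append_eq_nil_iff] at h1
        simpa [h1.1] using this
    simp [h1, h2]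

/-- Columns are strictly monotone, so three letters fill at most three rows. Counting letters in
consecutive rows determines which blocks are empty and gives the inequalities between the others. -/
theorem exists_threeRows (hab : a < b) (hbc : b < c) {L : List (List A)}
    (hL : Tab (fun x y : A => x < y) L)
    (hl : ∀ x ∈ L.flatten, x = a ∨ x = b ∨ x = c) :
    ∃ f d e g h k, L.flatten = threeRows a b c f d e g h k ∧ f ≤ d ∧ d ≤ g ∧ d + e ≤ g + h := by
  -- Four added empty rows guarantee that the four lowest rows exist. The fourth from below is shown
  -- to be empty, and with it everything above.
  have hP := hL.pad 4
  rw [← flatten_pad 4 L] at hl ⊢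
  generalize hM : List.replicate 4 [] ++ L = M at *
  have hlen : 4 ≤ M.length := by simp [← hM]
  obtain ⟨M1, l1, rfl⟩ : ∃ M1 l1, M = M1 ++ [l1] := by
    rcases List.eq_nil_or_concat M with rfl | ⟨M1, l1, rfl⟩
    · simp at hlen
    · exact ⟨M1, l1, by simp⟩
  obtain ⟨M2, l2, rfl⟩ : ∃ M2 l2, M1 = M2 ++ [l2] := by
    rcases List.eq_nil_or_concat M1 with rfl | ⟨M2, l2, rfl⟩
    · simp at hlen
    · exact ⟨M2, l2, by simp⟩
  obtain ⟨M3, l3, rfl⟩ : ∃ M3 l3, M2 = M3 ++ [l3] := by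
    rcases List.eq_nil_or_concat M2 with rfl | ⟨M3, l3, rfl⟩
    · simp at hlen
    · exact ⟨M3, l3, by simp⟩
  obtain ⟨M4, l4, rfl⟩ : ∃ M4 l4, M3 = M4 ++ [l4] := by
    rcases List.eq_nil_or_concat M3 with rfl | ⟨M4, l4, rfl⟩
    · simp at hlen
    · exact ⟨M4, l4, by simp⟩
  have hP' : Tab (fun x y : A => x < y) (M4 ++ [l4, l3, l2, l1]) := by simpa using hP
  have h4 := hP'.right
  simp only [tab_cons, List.head?_cons, Option.mem_def, Option.some.injEq, forall_eq'] at h4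
  obtain ⟨s4, a4, s3, a3, s2, a2, s1, -⟩ := h4
  obtain ⟨i4, j4, k4, rfl⟩ := exists_replicate hab hbc s4 fun x hx => hl x (by simp [hx])
  obtain ⟨i3, j3, k3, rfl⟩ := exists_replicate hab hbc s3 fun x hx => hl x (by simp [hx])
  obtain ⟨i2, j2, k2, rfl⟩ := exists_replicate hab hbc s2 fun x hx => hl x (by simp [hx])
  obtain ⟨i1, j1, k1, rfl⟩ := exists_replicate hab hbc s1 fun x hx => hl x (by simp [hx])
  have hac := hab.trans hbc
  have c4 := fun z => countP_le_of_above a4 z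
  have c3 := fun z => countP_le_of_above a3 z
  have c2 := fun z => countP_le_of_above a2 z
  have c4c := c4 c
  have c3a := c3 a
  have c3b := c3 b
  have c3c := c3 c
  have c2a := c2 a
  have c2b := c2 b
  have c2c := c2 c
  simp [List.countP_append, List.countP_replicate, hab, hbc, hac, hab.le, hbc.le, hac.le,
    hab.not_gt, hbc.not_gt, hac.not_gt, hab.not_ge, hbc.not_ge, hac.not_ge] at c4c c3a c3b c3c c2a c2b c2c
  obtain rfl : i3 = 0 := c3a
  obtain rfl : i2 = 0 := c2a
  obtain rfl : j3 = 0 := by omega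
  obtain ⟨rfl, rfl, rfl⟩ : i4 = 0 ∧ j4 = 0 ∧ k4 = 0 := by omega
  have hM4 := flatten_eq_nil_of_above_nil (Tab.left (L := M4 ++ [[]])
    (M := [List.replicate k3 c, List.replicate j2 b ++ List.replicate k2 c,
      List.replicate i1 a ++ (List.replicate j1 b ++ List.replicate k1 c)]) (by simpa using hP'))
  refine ⟨k3, j2, k2, i1, j1, k1, ?_, by omega, by omega, by omega⟩
  simp [threeRows, hM4]

/-- The braid relation for the letter permuting operators. -/
theorem flip_braid (hab : a < b) (hbc : b < c) (h1 : ∀ x, x ≤ a ∨ b ≤ x)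
    (h2 : ∀ x, x ≤ b ∨ c ≤ x) (w : List A) :
    flip a b (flip b c (flip a b w)) = flip b c (flip a b (flip b c w)) := by
  let p : A → Bool := fun x => decide (x = a ∨ x = b ∨ x = c)
  have pa : p a := by simp [p]
  have pb : p b := by simp [p]
  have pc : p c := by simp [p]
  have e1 := fun v => filter_flip pa pb v
  have e2 := fun v => filter_flip pb pc v
  refine eq_of_filter_eq (p := p) ?_ ?_
  swap
  · rw [(e1 _).2, (e2 _).2, (e1 _).2, (e2 _).2, (e1 _).2, (e2 _).2]
  rw [(e1 _).1, (e2 _).1, (e1 _).1, (e2 _).1, (e1 _).1, (e2 _).1]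
  have n1 := natOp_flip hab h1
  have n2 := natOp_flip hbc h2
  -- Each letter is taken as a row of its own, so that `norm` yields the tableau of the word, up to
  -- empty rows.
  have hs : ∀ l ∈ (w.filter p).map fun x => [x], Sorted (fun x y : A => x < y) l := by
    intro l hl
    obtain ⟨x, -, rfl⟩ := List.mem_map.1 hl
    exact List.pairwise_singleton _ _
  have hf : ((w.filter p).map fun x => [x]).flatten = w.filter p := by
    simp [← List.flatMap_def]
  have hke := ke_norm Bumping.lt hs
  obtain ⟨f, d, e, g, h, k, h3, h4, h5, h6⟩ := exists_threeRows hab hbc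
    (tab_norm Bumping.lt hs) (by
      intro x hx
      have := hke.perm.mem_iff.2 hx
      rw [hf, List.mem_filter] at this
      simpa [p] using this.2)
  have := NatOp.eq_of_norm Bumping.lt ((n1.comp n2).comp n1) ((n2.comp n1).comp n2) hs (by
    rw [h3]
    exact threeRows_braid hab hbc h4 h5 h6)
  rw [hf] at this
  exact this

end BraidWords

end Plactic

namespace Plactic

/-! ### Agreement with the definition by cyclic matching -/

section PermuteWord

variable {A : Type*} [DecidableEq A] {a b : A}

/-- The unmatched letters `a`, `b` of a word, with their positions (counted from `n`), before
matching the last and the first letters. -/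
def freePos (a b : A) (n : ℕ) (w : List A) : List (A × ℕ) :=
  matchInner a b ((w.zipIdx n).filter (fun p => decide (p.1 = a ∨ p.1 = b)))

theorem freePos_cons_of_ne {x : A} (hxa : x ≠ a) (hxb : x ≠ b) (n : ℕ) (w : List A) :
    freePos a b n (x :: w) = freePos a b (n + 1) w := by
  simp [freePos, hxa, hxb]

/-- A new first letter is either put in front or, if it is `b` and an `a` is free, cancels the first
free `a`. The remaining word therefore keeps the form `a … a b … b`. -/
theorem freePos_map_fst (hab : a ≠ b) (n : ℕ) (w : List A) :
    (freePos a b n w).map Prod.fst =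
      List.replicate (freeA a b w) a ++ List.replicate (freeB a b w) b := by
  induction w generalizing n with
  | nil => rfl
  | cons x w ih =>
    have ih := ih (n + 1)
    by_cases hxa : x = a
    · subst hxa
      unfold freePos at ih ⊢
      simp only [List.zipIdx_cons, true_or, decide_true, List.filter_cons_of_pos, matchInner,
        freeA, freeB, if_true, hab, false_and, if_false, List.replicate_succ, List.cons_append]
      rw [← ih]
      split <;> simp_all
    by_cases hxb : x = b
    · subst hxb
      unfold freePos at ih ⊢
      simp only [List.zipIdx_cons, or_true, decide_true, List.filter_cons_of_pos, matchInner,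
        freeA, freeB, if_true, hxa, true_and, if_false]
      generalize matchInner a x (List.filter (fun p => decide (p.1 = a ∨ p.1 = x))
        (w.zipIdx (n + 1))) = U at ih
      rcases U with _ | ⟨q, U⟩
      · simp only [List.map_nil] at ih
        have h0 : freeA a x w = 0 ∧ freeB a x w = 0 := by simpa using ih.symm
        simp [h0.1, h0.2]
      · rcases hR : freeA a x w with _ | R
        · rw [hR] at ih
          rcases hS : freeB a x w with _ | S
          · simp [hS] at ih
          · rw [hS] at ih
            simp only [List.map_cons, List.replicate_zero, List.nil_append, List.replicate_succ,
              List.cons.injEq] at ih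
            simp [ih.1, hab.symm, ih.2, List.replicate_succ]
        · rw [hR] at ih
          simp only [List.map_cons, List.replicate_succ, List.cons_append,
            List.cons.injEq] at ih
          simp [ih.1, ih.2]
    · rw [freePos_cons_of_ne hxa hxb, ih]
      simp [freeA, freeB, hxa, hxb]

/-- The first letter is unmatched, or matched with the first unmatched letter of the rest. -/
theorem freePos_cons (hab : a ≠ b) {x : A} (n : ℕ) (w : List A) :
    (x = a ∨ x = b ∧ freeA a b w = 0 → freePos a b n (x :: w) = (x, n) :: freePos a b (n + 1) w) ∧
    (x = b → freeA a b w ≠ 0 → ∃ q, q.1 = a ∧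
      freePos a b (n + 1) w = q :: freePos a b n (x :: w)) := by
  have h := freePos_map_fst hab (n + 1) w
  unfold freePos at h ⊢
  constructor
  · intro hx
    have hx' : x = a ∨ x = b := by tauto
    simp only [List.zipIdx_cons, hx', decide_true, List.filter_cons_of_pos, matchInner]
    split
    · simp_all
    · next q t heq =>
      rw [heq] at h ⊢
      rw [if_neg]
      rintro ⟨h1, h2⟩
      rcases hx with rfl | ⟨-, hx⟩
      · exact hab h1
      · rw [hx] at h
        rcases hS : freeB a b w with _ | S
        · simp [hS] at h
        · rw [hS] at h
          simp only [List.map_cons, List.replicate_zero, List.nil_append, List.replicate_succ,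
            List.cons.injEq] at h
          exact hab (h2.symm.trans h.1)
  · intro hx h0
    subst hx
    simp only [List.zipIdx_cons, or_true, decide_true, List.filter_cons_of_pos, matchInner]
    obtain ⟨R, hR⟩ := Nat.exists_eq_succ_of_ne_zero h0
    rw [hR] at h
    split
    · simp_all [List.replicate_succ]
    · next q t heq =>
      rw [heq] at h
      simp only [List.map_cons, List.replicate_succ, List.cons_append, List.cons.injEq] at h
      exact ⟨q, h.1, by rw [heq, if_pos ⟨trivial, h.1⟩]⟩

theorem freePos_lt (hab : a ≠ b) (n : ℕ) (w : List A) :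
    (freePos a b n w).Pairwise (fun p q => p.2 < q.2) ∧ ∀ p ∈ freePos a b n w, n ≤ p.2 := by
  induction w generalizing n with
  | nil => simp [freePos, matchInner]
  | cons x w ih =>
    obtain ⟨ih1, ih2⟩ := ih (n + 1)
    by_cases hf : x = a ∨ x = b ∧ freeA a b w = 0
    · rw [(freePos_cons hab n w).1 hf]
      refine ⟨List.pairwise_cons.2 ⟨fun p hp => ih2 p hp, ih1⟩, fun p hp => ?_⟩
      rcases List.mem_cons.1 hp with rfl | hp
      · exact le_rfl
      · exact (Nat.le_succ n).trans (ih2 p hp)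
    by_cases hxb : x = b
    · obtain ⟨q, -, hq⟩ := (freePos_cons hab n w).2 hxb (by tauto)
      rw [hq] at ih1 ih2
      exact ⟨(List.pairwise_cons.1 ih1).2, fun p hp => (Nat.le_succ n).trans
        (ih2 p (List.mem_cons_of_mem _ hp))⟩
    · rw [freePos_cons_of_ne (by tauto) hxb]
      exact ⟨ih1, fun p hp => (Nat.le_succ n).trans (ih2 p hp)⟩

/-- A description of the recursive `fill` by positions, needed for comparison with `permuteWord`,
which is defined through positions. -/
theorem getElem?_fill (hab : a ≠ b) (n t : ℕ) (w : List A) :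
    (∀ k p, (freePos a b n w)[k]? = some p → ∃ j, p.2 = n + j ∧ w[j]? = some p.1 ∧
      (fill a b t w)[j]? = some (if k < t then a else b)) ∧
    ∀ j, (∀ p ∈ freePos a b n w, p.2 ≠ n + j) → (fill a b t w)[j]? = w[j]? := by
  induction w generalizing n t with
  | nil => simp [freePos, matchInner, fill]
  | cons x w ih =>
    by_cases hf : x = a ∨ x = b ∧ freeA a b w = 0
    · obtain ⟨ih1, ih2⟩ := ih (n + 1) (t - 1)
      rw [(freePos_cons hab n w).1 hf, fill, if_pos hf]
      constructor
      · intro k p hk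
        rcases k with _ | k
        · simp only [List.getElem?_cons_zero, Option.some.injEq] at hk
          subst hk
          refine ⟨0, rfl, rfl, ?_⟩
          rcases t with _ | t <;> simp
        · obtain ⟨j, h1, h2, h3⟩ := ih1 k p (by simpa using hk)
          refine ⟨j + 1, by omega, by simpa using h2, ?_⟩
          have : k + 1 < t ↔ k < t - 1 := by omega
          simpa [this] using h3
      · intro j hj
        rcases j with _ | j
        · exact absurd rfl (hj (x, n) (by simp))
        · simpa using ih2 j fun p hp => by
            have := hj p (List.mem_cons_of_mem _ hp)
            omega
    by_cases hxb : x = b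
    · obtain ⟨ih1, ih2⟩ := ih (n + 1) (t + 1)
      obtain ⟨q, hqa, hq⟩ := (freePos_cons hab n w).2 hxb (by tauto)
      rw [fill, if_neg hf, if_pos hxb]
      rw [hq] at ih1 ih2
      constructor
      · intro k p hk
        obtain ⟨j, h1, h2, h3⟩ := ih1 (k + 1) p (by simpa using hk)
        exact ⟨j + 1, by omega, by simpa using h2, by simpa using h3⟩
      · intro j hj
        rcases j with _ | j
        · simp [hxb]
        · by_cases hqj : q.2 = n + 1 + j
          · obtain ⟨j', h1, h2, h3⟩ := ih1 0 q (by simp)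
            obtain rfl : j' = j := by omega
            simp [h2, h3, hqa]
          · simpa using ih2 j fun p hp => by
              rcases List.mem_cons.1 hp with rfl | hp
              · exact hqj
              · have := hj p hp
                omega
    · obtain ⟨ih1, ih2⟩ := ih (n + 1) t
      rw [freePos_cons_of_ne (by tauto) hxb, fill, if_neg hf, if_neg hxb]
      constructor
      · intro k p hk
        obtain ⟨j, h1, h2, h3⟩ := ih1 k p hk
        exact ⟨j + 1, by omega, by simpa using h2, by simpa using h3⟩
      · intro j hj
        rcases j with _ | j
        · simp
        · simpa using ih2 j fun p hp => by
            have := hj p hp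
            omega

/-- Every cyclic match removes one `a` at the front and one `b` at the back, until one kind is
exhausted. -/
theorem matchOuter_eq (hab : a ≠ b) {r s : ℕ} {U : List (A × ℕ)}
    (hU : U.map Prod.fst = List.replicate r a ++ List.replicate s b) :
    matchOuter a b U = (U.drop (min r s)).take (r + s - 2 * min r s) := by
  induction r generalizing s U with
  | zero =>
    have hlen := congrArg List.length hU
    simp only [List.length_map, List.length_append, List.length_replicate] at hlen
    rcases U with _ | ⟨p, U⟩
    · simp [matchOuter]
    · rcases s with _ | s
      · simp at hU
      · simp only [List.map_cons, List.replicate_zero, List.nil_append, List.replicate_succ,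
          List.cons.injEq] at hU
        rw [matchOuter, if_neg (by rw [hU.1]; exact fun h => hab h.1.symm)]
        simp at hlen ⊢
        omega
  | succ r ih =>
    have hlen := congrArg List.length hU
    simp only [List.length_map, List.length_append, List.length_replicate] at hlen
    rcases U with _ | ⟨p, U⟩
    · simp at hU
    simp only [List.map_cons, List.replicate_succ, List.cons_append, List.cons.injEq] at hU
    rcases s with _ | s
    · rw [matchOuter, if_neg]
      · rw [Nat.min_zero, List.drop_zero, List.take_of_length_le (by omega)]
      · rintro ⟨-, h⟩
        rw [← List.getLast?_map, hU.2] at h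
        rcases r with _ | r <;> simp [List.getLast?_replicate] at h
        exact hab h
    · rw [List.replicate_succ', ← List.append_assoc] at hU
      rcases List.eq_nil_or_concat U with rfl | ⟨V, q, rfl⟩
      · simp at hU
      · simp only [List.concat_eq_append, List.map_append, List.map_cons, List.map_nil] at hU
        obtain ⟨h1, h2⟩ := List.append_inj_left' hU.2 rfl, List.append_inj_right' hU.2 rfl
        simp only [List.cons.injEq, and_true] at h2
        rw [matchOuter, if_pos (by simp [hU.1, h2])]
        simp only [List.concat_eq_append, List.dropLast_concat]
        rw [ih h1]
        have hV := congrArg List.length h1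
        simp only [List.length_map, List.length_append, List.length_replicate] at hV
        have e1 : min (r + 1) (s + 1) = min r s + 1 := by omega
        rw [e1, List.drop_succ_cons, List.drop_append_of_le_length (by omega),
          List.take_append_of_le_length (by simp; omega)]
        congr 1
        omega

/-- With `R` free letters `a` and `S` free letters `b`, `flip` replaces `a^R b^S` by `a^S b^R`.
These words differ exactly at the indices from `min R S` to `max R S`, the upper end excluded, and
those are the letters left by the cyclic matching. -/
theorem permuteWord_eq_flip (hab : a ≠ b) (w : List A) : permuteWord a b w = flip a b w := by
  have hU := freePos_map_fst hab 0 w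
  have hm := matchOuter_eq hab hU
  have hlt := (freePos_lt hab 0 w).1
  obtain ⟨h1, h2⟩ := getElem?_fill hab 0 (freeB a b w) w
  have hun : unmatched a b w = (((freePos a b 0 w).drop (min (freeA a b w) (freeB a b w))).take
    (freeA a b w + freeB a b w - 2 * min (freeA a b w) (freeB a b w))).map Prod.snd := by
    rw [← hm]; rfl
  have hmem : ∀ k p, (freePos a b 0 w)[k]? = some p → (p.2 ∈ unmatched a b w ↔
      min (freeA a b w) (freeB a b w) ≤ k ∧ k < max (freeA a b w) (freeB a b w)) := by
    intro k p hk
    have hget : ∀ i q, (((freePos a b 0 w).drop (min (freeA a b w) (freeB a b w))).take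
        (freeA a b w + freeB a b w - 2 * min (freeA a b w) (freeB a b w)))[i]? = some q ↔
        i < freeA a b w + freeB a b w - 2 * min (freeA a b w) (freeB a b w) ∧
        (freePos a b 0 w)[min (freeA a b w) (freeB a b w) + i]? = some q := by
      intro i q
      rw [List.getElem?_take]
      split_ifs with hi <;> simp [hi]
    rw [hun, List.mem_map]
    constructor
    · rintro ⟨q, hq, hqp⟩
      obtain ⟨i, hi⟩ := List.mem_iff_getElem?.1 hq
      obtain ⟨hi1, hi2⟩ := (hget i q).1 hi
      rw [List.getElem?_eq_some_iff] at hi2 hk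
      obtain ⟨hk1, rfl⟩ := hk
      obtain ⟨hi3, rfl⟩ := hi2
      -- Positions increase strictly along `freePos`, so equal positions have equal indices.
      have : min (freeA a b w) (freeB a b w) + i = k := by
        rw [List.pairwise_iff_getElem] at hlt
        by_contra hne
        rcases lt_or_gt_of_ne hne with h | h
        · have := hlt _ _ hi3 hk1 h
          omega
        · have := hlt _ _ hk1 hi3 h
          omega
      omega
    · rintro ⟨hk1, hk2⟩
      refine ⟨p, List.mem_iff_getElem?.2 ⟨k - min (freeA a b w) (freeB a b w), ?_⟩, rfl⟩
      rw [hget]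
      refine ⟨by omega, ?_⟩
      rwa [Nat.add_sub_cancel' hk1]
  have hnot : ∀ j, (∀ p ∈ freePos a b 0 w, p.2 ≠ j) → j ∉ unmatched a b w := by
    intro j hj hj'
    rw [hun] at hj'
    obtain ⟨p, hp, rfl⟩ := List.mem_map.1 hj'
    exact hj p (List.mem_of_mem_drop (List.mem_of_mem_take hp)) rfl
  refine List.ext_getElem? fun j => ?_
  unfold permuteWord flip
  rw [List.getElem?_mapIdx]
  by_cases hj : ∀ p ∈ freePos a b 0 w, p.2 ≠ j
  · rw [h2 j (by simpa using hj)]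
    simp [hnot j hj]
  · push Not at hj
    obtain ⟨p, hp, hpj⟩ := hj
    obtain ⟨k, hk, hk'⟩ := List.getElem_of_mem hp
    have hk'' : (freePos a b 0 w)[k]? = some p := by rw [← hk', List.getElem?_eq_getElem hk]
    obtain ⟨j', h3, h4, h5⟩ := h1 k p hk''
    obtain rfl : j' = j := by omega
    rw [h5, h4]
    have h6 := hmem k p hk''
    rw [hpj] at h6
    simp only [Option.map_some, h6, Option.some.injEq]
    have h7 : p.1 = if k < freeA a b w then a else b := by
      have h8 : ((freePos a b 0 w).map Prod.fst)[k]? = some p.1 := by simp [hk'']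
      rw [hU] at h8
      simp only [List.getElem?_append, List.length_replicate, List.getElem?_replicate] at h8
      split_ifs at h8 ⊢ <;> simp_all
    have hk2 : k < freeA a b w + freeB a b w := by
      have := congrArg List.length hU
      simp at this
      omega
    rw [h7]
    split_ifs <;> first | rfl | omega | (exfalso; simp_all; done)

end PermuteWord

end Plactic

namespace Plactic

/-! ### The Coxeter presentation of the symmetric group -/

section SymmetricGroup

variable {P : Type*} [Monoid P]

/-- The product `x j * x (j + 1) * … * x (j + d - 1)`. -/
def ascending (x : ℕ → P) (j : ℕ) : ℕ → P
  | 0 => 1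
  | d + 1 => x j * ascending x (j + 1) d

/-- The Coxeter relations of the symmetric group on `n` letters. -/
structure CoxeterRel (n : ℕ) (x : ℕ → P) : Prop where
  sq : ∀ i, i + 1 < n → x i * x i = 1
  far : ∀ i j, i + 1 < j → j + 1 < n → x i * x j = x j * x i
  near : ∀ i, i + 2 < n → x i * x (i + 1) * x i = x (i + 1) * x i * x (i + 1)

theorem CoxeterRel.far_ascending {n : ℕ} {x : ℕ → P} (h : CoxeterRel n x) {i j d : ℕ}
    (hij : i + 1 < j) (hd : j + d < n) : x i * ascending x j d = ascending x j d * x i := by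
  induction d generalizing j with
  | zero => simp [ascending]
  | succ d ih =>
    rw [ascending, ← mul_assoc, h.far i j hij (by omega), mul_assoc, ih (by omega) (by omega),
      mul_assoc]

/-- The generator commutes with the factors up to `x (i - 1)`, crosses `x i * x (i + 1)` by the
braid relation, which lowers its index by one, and then commutes with the rest. -/
theorem CoxeterRel.mul_ascending {n : ℕ} {x : ℕ → P} (h : CoxeterRel n x) {i j d : ℕ}
    (hij : j ≤ i) (hid : i + 1 < j + d) (hd : j + d < n) :
    x (i + 1) * ascending x j d = ascending x j d * x i := by
  induction d generalizing j with
  | zero => omega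
  | succ d ih =>
    rw [ascending]
    rcases hij.eq_or_lt with rfl | hij
    · rcases d with _ | d
      · omega
      · rw [ascending, ← mul_assoc, ← mul_assoc, ← h.near j (by omega), mul_assoc _ (x j),
          h.far_ascending (by omega) (by omega)]
        simp only [mul_assoc]
    · rw [← mul_assoc, ← h.far j (i + 1) (by omega) (by omega), mul_assoc,
        ih hij (by omega) (by omega), mul_assoc]

/-- The submonoid generated by the first Coxeter generators. -/
def coxeterSub (x : ℕ → P) (m : ℕ) : Submonoid P := Submonoid.closure {y | ∃ i, i + 1 < m ∧ y = x i}

/-- The ascending products serve as coset representatives. A generator multiplied on the left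
commutes past the product, lengthens it, cancels its first factor, or crosses it with its index
lowered; what comes out on the right lies in the smaller submonoid. -/
theorem coxeterSub_decomp {n : ℕ} {x : ℕ → P} (h : CoxeterRel n x) {m : ℕ} (hm : m < n) {y : P}
    (hy : y ∈ coxeterSub x (m + 1)) :
    ∃ j d u, j + d = m ∧ u ∈ coxeterSub x m ∧ y = ascending x j d * u := by
  unfold coxeterSub at hy
  induction hy using Submonoid.closure_induction_left with
  | one => exact ⟨m, 0, 1, by omega, one_mem _, by simp [ascending]⟩
  | mul_left z hz y hy ih =>
    obtain ⟨j, d, u, hjd, hu, rfl⟩ := ih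
    obtain ⟨i, hi, rfl⟩ := hz
    have mem : ∀ i, i + 1 < m → x i ∈ coxeterSub x m :=
      fun i hi => Submonoid.subset_closure ⟨i, hi, rfl⟩
    rcases lt_trichotomy (i + 1) j with hij | hij | hij
    · refine ⟨j, d, x i * u, hjd, mul_mem (mem i (by omega)) hu, ?_⟩
      rw [← mul_assoc, h.far_ascending hij (by omega), mul_assoc]
    · exact ⟨i, d + 1, u, by omega, hu, by rw [ascending, hij, mul_assoc]⟩
    · rcases Nat.lt_or_ge j i with hlt | hge
      · obtain ⟨i, rfl⟩ : ∃ i', i = i' + 1 := ⟨i - 1, by omega⟩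
        refine ⟨j, d, x i * u, hjd, mul_mem (mem i (by omega)) hu, ?_⟩
        rw [← mul_assoc, h.mul_ascending (by omega) (by omega) (by omega), mul_assoc]
      · obtain rfl : i = j := by omega
        obtain ⟨d, rfl⟩ : ∃ d', d = d' + 1 := ⟨d - 1, by omega⟩
        refine ⟨i + 1, d, u, by omega, hu, ?_⟩
        rw [ascending, ← mul_assoc, ← mul_assoc, h.sq i (by omega), one_mul]

variable {M : Type*} [Monoid M]

/-- The transposition of `i` and `i + 1`. -/
def adjSwap (n i : ℕ) : Equiv.Perm (Fin n) :=
  if h : i + 1 < n then Equiv.swap ⟨i, Nat.lt_of_succ_lt h⟩ ⟨i + 1, h⟩ else 1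

theorem coxeterRel_adjSwap (n : ℕ) : CoxeterRel n (adjSwap n) where
  sq i hi := by simp [adjSwap, hi]
  far i j hij hj := by
    rw [adjSwap, adjSwap, dif_pos (by omega : i + 1 < n), dif_pos hj]
    refine (Equiv.Perm.disjoint_iff_disjoint_support.2 ?_).commute.eq
    rw [Equiv.Perm.support_swap (by simp), Equiv.Perm.support_swap (by simp)]
    simp
    omega
  near i hi := by
    rw [adjSwap, adjSwap, dif_pos (by omega : i + 1 < n), dif_pos hi]
    have h1 := Equiv.swap_mul_swap_mul_swap (x := (⟨i + 2, hi⟩ : Fin n)) (y := ⟨i + 1, by omega⟩)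
      (z := ⟨i, by omega⟩) (by simp) (by simp)
    have h2 := Equiv.swap_mul_swap_mul_swap (x := (⟨i, by omega⟩ : Fin n)) (y := ⟨i + 1, by omega⟩)
      (z := ⟨i + 2, hi⟩) (by simp) (by simp)
    rw [Equiv.swap_comm (⟨i + 1, _⟩ : Fin n) ⟨i, _⟩,
      Equiv.swap_comm (⟨i + 2, _⟩ : Fin n) ⟨i + 1, _⟩] at h1
    rw [Equiv.swap_comm (⟨i + 2, _⟩ : Fin n) ⟨i, _⟩, ← h1] at h2
    exact h2.symm

theorem adjSwap_apply_of_lt {n i : ℕ} (j : Fin n) (hij : i + 1 < j.val) : adjSwap n i j = j := by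
  unfold adjSwap
  split_ifs with h
  · exact Equiv.swap_apply_of_ne_of_ne (by rw [Ne, Fin.ext_iff]; simp; omega)
      (by rw [Ne, Fin.ext_iff]; simp; omega)
  · rfl

theorem CoxeterRel.prod {n : ℕ} {x : ℕ → P} {s : ℕ → M} (h : CoxeterRel n x)
    (h' : CoxeterRel n s) : CoxeterRel n (fun i => (x i, s i)) where
  sq i hi := Prod.ext (h.sq i hi) (h'.sq i hi)
  far i j hij hj := Prod.ext (h.far i j hij hj) (h'.far i j hij hj)
  near i hi := Prod.ext (h.near i hi) (h'.near i hi)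

theorem fst_apply_of_mem_coxeterSub {n : ℕ} {s : ℕ → M} {m : ℕ} {g : Equiv.Perm (Fin n) × M}
    (hg : g ∈ coxeterSub (fun i => (adjSwap n i, s i)) m) (j : Fin n) (hj : m ≤ j.val) :
    g.1 j = j := by
  unfold coxeterSub at hg
  induction hg using Submonoid.closure_induction with
  | mem z hz =>
    obtain ⟨i, hi, rfl⟩ := hz
    exact adjSwap_apply_of_lt j (by omega)
  | one => rfl
  | mul a b _ _ ha hb => simp [ha, hb]

theorem fst_ascending_apply {n : ℕ} (s : ℕ → M) {j d : ℕ} (h : j + d < n) :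
    (ascending (fun i => (adjSwap n i, s i)) j d).1 ⟨j + d, h⟩ = ⟨j, by omega⟩ := by
  induction d generalizing j with
  | zero => rfl
  | succ d ih =>
    have := ih (j := j + 1) (by omega)
    have he : (⟨j + (d + 1), h⟩ : Fin n) = ⟨j + 1 + d, by omega⟩ := by
      rw [Fin.mk.injEq]; omega
    rw [ascending, he, Prod.fst_mul, Equiv.Perm.mul_apply, this]
    simp only [adjSwap, dif_pos (show j + 1 < n by omega)]
    exact Equiv.swap_apply_right _ _

/-- The pairs form the graph of a map: in the decomposition of a pair, `j` is the image of `m` under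
the permutation, since `u` fixes `m`. Cancelling the ascending product leaves a pair one level
lower. -/
theorem coxeterSub_unique {n : ℕ} {s : ℕ → M} (h : CoxeterRel n s) {m : ℕ} (hm : m ≤ n)
    {g g' : Equiv.Perm (Fin n) × M}
    (hg : g ∈ coxeterSub (fun i => (adjSwap n i, s i)) m)
    (hg' : g' ∈ coxeterSub (fun i => (adjSwap n i, s i)) m) (hgg : g.1 = g'.1) :
    g.2 = g'.2 := by
  induction m generalizing g g' with
  | zero =>
    simp only [coxeterSub, Nat.not_lt_zero, false_and, exists_false, Set.ofPred_false,
      Submonoid.closure_empty, Submonoid.mem_bot] at hg hg'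
    rw [hg, hg']
  | succ m ih =>
    have hp := (coxeterRel_adjSwap n).prod h
    obtain ⟨j, d, u, hjd, hu, rfl⟩ := coxeterSub_decomp hp (by omega) hg
    obtain ⟨j', d', u', hjd', hu', rfl⟩ := coxeterSub_decomp hp (by omega) hg'
    have key : ∀ (j d : ℕ) (u : Equiv.Perm (Fin n) × M), j + d = m →
        u ∈ coxeterSub (fun i => (adjSwap n i, s i)) m →
        ((ascending (fun i => (adjSwap n i, s i)) j d * u).1 ⟨m, by omega⟩).val = j := by
      rintro j d u rfl hu
      rw [Prod.fst_mul, Equiv.Perm.mul_apply, fst_apply_of_mem_coxeterSub hu _ le_rfl,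
        fst_ascending_apply]
    have h1 := key j d u hjd hu
    rw [hgg] at h1
    obtain rfl : j = j' := h1.symm.trans (key j' d' u' hjd' hu')
    obtain rfl : d = d' := by omega
    rw [Prod.snd_mul, Prod.snd_mul, ih (by omega) hu hu' (mul_left_cancel hgg)]

theorem closure_adjSwap (n : ℕ) :
    Submonoid.closure {g | ∃ i, i + 1 < n ∧ g = adjSwap n i} = ⊤ := by
  rcases n with _ | n
  · exact Subsingleton.elim _ _
  · rw [eq_top_iff, ← Equiv.Perm.mclosure_swap_castSucc_succ n, Submonoid.closure_le]
    rintro _ ⟨i, rfl⟩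
    refine Submonoid.subset_closure ⟨i, by omega, ?_⟩
    rw [adjSwap, dif_pos (by omega)]
    rfl

/-- The submonoid generated by the pairs `(adjSwap n i, s i)` projects onto the symmetric group and
is single-valued by `coxeterSub_unique`, hence is the graph of a homomorphism. -/
theorem exists_hom_of_coxeterRel {n : ℕ} {s : ℕ → M} (h : CoxeterRel n s) :
    ∃ ρ : Equiv.Perm (Fin n) →* M, ∀ i, i + 1 < n → ρ (adjSwap n i) = s i := by
  have ex : ∀ g : Equiv.Perm (Fin n),
      ∃ y, (g, y) ∈ coxeterSub (fun i => (adjSwap n i, s i)) n := by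
    intro g
    have hg : g ∈ Submonoid.closure {g | ∃ i, i + 1 < n ∧ g = adjSwap n i} := by
      rw [closure_adjSwap]; trivial
    induction hg using Submonoid.closure_induction with
    | mem z hz =>
      obtain ⟨i, hi, rfl⟩ := hz
      exact ⟨s i, Submonoid.subset_closure ⟨i, hi, rfl⟩⟩
    | one => exact ⟨1, one_mem _⟩
    | mul a b _ _ ha hb =>
      obtain ⟨y, hy⟩ := ha
      obtain ⟨z, hz⟩ := hb
      exact ⟨y * z, mul_mem hy hz⟩
  choose f hf using ex
  refine ⟨⟨⟨f, coxeterSub_unique h le_rfl (hf 1) (one_mem _) rfl⟩, fun a b =>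
    coxeterSub_unique h le_rfl (hf (a * b)) (mul_mem (hf a) (hf b)) rfl⟩, fun i hi => ?_⟩
  exact coxeterSub_unique h le_rfl (hf _) (Submonoid.subset_closure ⟨i, hi, rfl⟩) rfl

end SymmetricGroup

end Plactic

namespace Plactic

/-! ### Young tableaux as chains of rows for `<` -/

section RowTableaux

variable {A : Type*} [LinearOrder A]

theorem rowGt_iff_above {x y : List A} : RowGt x y ↔ Above (fun a b : A => a < b) x y := by
  induction x generalizing y with
  | nil => simp [RowGt]
  | cons a x ih =>
    rcases y with _ | ⟨b, y⟩
    · simp [RowGt]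
    · rw [above_cons, ← ih]
      constructor
      · rintro ⟨h1, h2⟩
        exact ⟨h2 0 (by simp) (by simp), by simpa using h1, fun i hx hy =>
          h2 (i + 1) (by simpa using hx) (by simpa using hy)⟩
      · rintro ⟨h0, h1, h2⟩
        refine ⟨by simpa using h1, fun i hx hy => ?_⟩
        rcases i with _ | i
        · exact h0
        · exact h2 i (by simpa using hx) (by simpa using hy)

theorem YT.tab_rows (T : YT A) : Tab (fun a b : A => a < b) T.rows where
  sorted l hl := (T.nondecreasing l hl).imp not_lt.2
  chain := (T.decreasing.imp rowGt_iff_above.1).isChain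

/-- The tableau formed by a chain of non-empty rows. -/
def Tab.toYT {L : List (List A)} (h : Tab (fun a b : A => a < b) L) (hne : ∀ l ∈ L, l ≠ []) :
    YT A where
  rows := L
  ne_nil := hne
  nondecreasing l hl := (h.sorted l hl).imp not_lt.1
  decreasing := by
    have : Trans (α := List A) RowGt RowGt RowGt := ⟨RowGt.trans⟩
    exact (h.chain.imp fun _ _ => rowGt_iff_above.2).pairwise

theorem insertRow_eq (x : A) (u : List A) :
    insertRow x u = ((ins (fun a b : A => a < b) x u).2,
      (ins (fun a b : A => a < b) x u).1.head?) := by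
  induction u with
  | nil => simp [insertRow, ins]
  | cons a u ih =>
    by_cases hx : x < a
    · simp [insertRow, ins, List.findIdx_cons, hx]
    · unfold insertRow at ih ⊢
      simp only [List.findIdx_cons, hx, ins, decide_false, cond_false, List.length_cons,
        Nat.add_lt_add_iff_right, if_false] at ih ⊢
      split_ifs at ih ⊢ with h
      · simp only [Prod.mk.injEq] at ih
        simp [← ih.1, ← ih.2]
      · simp only [Prod.mk.injEq] at ih
        simp [← ih.1, ← ih.2]

theorem ke_insertRows (x : A) {L : List (List A)} (hL : ∀ l ∈ L, l.Pairwise (· ≤ ·)) :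
    KE (fun a b : A => a < b) (L.reverse.flatten ++ [x]) (insertRows x L).reverse.flatten := by
  induction L generalizing x with
  | nil => exact KE.refl _
  | cons u L ih =>
    simp only [List.mem_cons, forall_eq_or_imp] at hL
    have h1 := (ke_ins Bumping.lt x (hL.1.imp not_lt.2)).append_left L.reverse.flatten
    have h2 := insertRow_eq x u
    rcases ins_fst_cases (r := fun a b : A => a < b) x u with h | ⟨d, h⟩
    · rw [h] at h1 h2
      simpa [insertRows, h2] using h1
    · rw [h] at h1 h2
      have h3 := (ih d hL.2).append_right (ins (fun a b : A => a < b) x u).2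
      simpa [insertRows, h2] using h1.trans (by simpa using h3)

theorem YT.ke_insert (T : YT A) (x : A) :
    KE (fun a b : A => a < b) (T.rowReading ++ [x]) (T.insert x).rowReading := by
  have := ke_insertRows x (L := T.rows.reverse)
    (fun l hl => T.nondecreasing l (List.mem_reverse.1 hl))
  simpa [rowReading, insert] using this

theorem YT.ke_insertWord (T : YT A) (w : List A) :
    KE (fun a b : A => a < b) (T.rowReading ++ w) (T.insertWord w).rowReading := by
  induction w generalizing T with
  | nil => simp [insertWord, KE.refl]
  | cons x w ih =>
    have := ((T.ke_insert x).append_right w).trans (ih (T.insert x))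
    simpa [insertWord] using this

theorem YT.ke_prod (T T' : YT A) :
    KE (fun a b : A => a < b) (T.rowReading ++ T'.rowReading) (T.prod T').rowReading :=
  T.ke_insertWord _

theorem replicate_append_injective {m m' : ℕ} {L L' : List (List A)} (hL : ∀ l ∈ L, l ≠ [])
    (hL' : ∀ l ∈ L', l ≠ []) (h : List.replicate m [] ++ L = List.replicate m' [] ++ L') :
    m = m' ∧ L = L' := by
  induction m generalizing m' with
  | zero =>
    rcases m' with _ | m'
    · simpa using h
    · simp only [List.replicate_zero, List.nil_append, List.replicate_succ,
        List.cons_append] at h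
      exact absurd rfl (hL [] (by simp [h]))
  | succ m ih =>
    rcases m' with _ | m'
    · simp only [List.replicate_zero, List.nil_append, List.replicate_succ,
        List.cons_append] at h
      exact absurd rfl (hL' [] (by simp [← h]))
    · have := ih (m' := m') (by simpa [List.replicate_succ] using h)
      exact ⟨by rw [this.1], this.2⟩

/-- Padding each chain with as many empty rows as the other has rows equalises the numbers of rows,
so that the uniqueness in `Tab.eq_of_ke` applies. -/
theorem eq_of_ke_of_ne_nil {r : A → A → Prop} [DecidableRel r] (h : Bumping r)
    {L L' : List (List A)} (hT : Tab r L) (hT' : Tab r L') (hL : ∀ l ∈ L, l ≠ [])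
    (hL' : ∀ l ∈ L', l ≠ []) (hke : KE r L.flatten L'.flatten) : L = L' :=
  (replicate_append_injective hL hL' ((hT.pad L'.length).eq_of_ke h (hT'.pad L.length)
    (by simp [add_comm]) (by simpa using hke))).2

theorem YT.eq_of_ke {T T' : YT A}
    (h : KE (fun a b : A => a < b) T.rowReading T'.rowReading) : T = T' :=
  YT.ext (eq_of_ke_of_ne_nil Bumping.lt T.tab_rows T'.tab_rows T.ne_nil T'.ne_nil h)

theorem YT.ofWord_rowReading (T : YT A) : ofWord T.rowReading = T :=
  (eq_of_ke (empty.ke_insertWord T.rowReading)).symm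

/-- A chain of rows starts with its empty rows. -/
theorem Tab.exists_pad {r : A → A → Prop} {L : List (List A)} (hT : Tab r L) :
    ∃ m M, L = List.replicate m [] ++ M ∧ ∀ l ∈ M, l ≠ [] := by
  induction L with
  | nil => exact ⟨0, [], rfl, by simp⟩
  | cons l L ih =>
    have hT' := tab_cons.1 hT
    obtain ⟨m, M, rfl, hM⟩ := ih hT'.2.2
    by_cases hl : l = []
    · exact ⟨m + 1, M, by simp [hl, List.replicate_succ], hM⟩
    · rcases m with _ | m
      · refine ⟨0, l :: M, by simp, ?_⟩
        simpa [hl] using hM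
      · have := hT'.2.1 [] (by simp [List.replicate_succ])
        rcases l with _ | ⟨a, l⟩
        · simp at hl
        · simp at this

/-- Computation of the product of rows from a chain of non-empty rows in the same class. -/
theorem norm_eq_pad {r : A → A → Prop} [DecidableRel r] (h : Bumping r) {L M : List (List A)}
    (hL : ∀ l ∈ L, Sorted r l) (hM : Tab r M) (hne : ∀ l ∈ M, l ≠ [])
    (hke : KE r L.flatten M.flatten) :
    M.length ≤ L.length ∧ norm r L = List.replicate (L.length - M.length) [] ++ M := by
  obtain ⟨m, N, hN, hN0⟩ := (tab_norm h hL).exists_pad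
  have hT := tab_norm h hL
  rw [hN] at hT
  have hk := (ke_norm h hL).symm.trans hke
  rw [hN] at hk
  obtain rfl : N = M := eq_of_ke_of_ne_nil h hT.right hM hN0 hne (by simpa using hk)
  have hlen := congrArg List.length hN
  rw [length_norm] at hlen
  simp only [List.length_append, List.length_replicate] at hlen
  refine ⟨by omega, ?_⟩
  rw [hN, show L.length - N.length = m by omega]

end RowTableaux

end Plactic

namespace Plactic

/-! ### The row braiding as a braiding of padded chains -/

section RowBraiding

variable {A : Type*} [LinearOrder A]

theorem YT.numRows_prod_le (T T' : YT A) :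
    (T.prod T').numRows ≤ T.numRows + T'.numRows ∧
    norm (fun a b : A => a < b) (T.rows ++ T'.rows) =
      List.replicate (T.numRows + T'.numRows - (T.prod T').numRows) [] ++ (T.prod T').rows := by
  have := norm_eq_pad Bumping.lt (L := T.rows ++ T'.rows) (M := (T.prod T').rows)
    (fun l hl => (List.mem_append.1 hl).elim (T.tab_rows.sorted l) (T'.tab_rows.sorted l))
    (T.prod T').tab_rows (T.prod T').ne_nil (by simpa [rowReading] using T.ke_prod T')
  simpa [numRows] using this

theorem isSigmaR_sigmaR (T₁ : YT A) (α₁ : ℕ) (T₂ : YT A) (α₂ : ℕ) :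
    IsSigmaR T₁ α₁ T₂ α₂ (sigmaR ((T₁, α₁), (T₂, α₂))).1.1 (sigmaR ((T₁, α₁), (T₂, α₂))).1.2
      (sigmaR ((T₁, α₁), (T₂, α₂))).2.1 (sigmaR ((T₁, α₁), (T₂, α₂))).2.2 := by
  have hle := (T₁.numRows_prod_le T₂).1
  have h1 : ∀ m (T : YT A), (T.takeRows m).numRows = min m T.numRows := fun m T => by
    simp [YT.takeRows, YT.numRows]
  have h2 : ∀ m (T : YT A), (T.dropRows m).numRows = T.numRows - m := fun m T => by
    simp [YT.dropRows, YT.numRows]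
  constructor
  · simp [sigmaR, YT.takeRows, YT.dropRows]
  · simp only [sigmaR, h2]; omega
  · simp only [sigmaR, h1]; omega
  · simp only [sigmaR, h2]; omega
  · simp only [sigmaR, h2]
    intro h
    rw [show (T₁.prod T₂).numRows - (α₁ + T₁.numRows) = 0 by omega]
    ext1
    simp [YT.takeRows, YT.empty]

theorem IsSigmaR.unique {T₁ T₂ P Q P' Q' : YT A} {α₁ α₂ β γ β' γ' : ℕ}
    (h : IsSigmaR T₁ α₁ T₂ α₂ P β Q γ) (h' : IsSigmaR T₁ α₁ T₂ α₂ P' β' Q' γ') :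
    ((P, β), (Q, γ)) = ((P', β'), (Q', γ')) := by
  have hp := h.rows_append.trans h'.rows_append.symm
  have hl : P.numRows + Q.numRows = P'.numRows + Q'.numRows := by
    simpa [YT.numRows] using congrArg List.length hp
  have hn : P.numRows + Q.numRows = (T₁.prod T₂).numRows := by
    simpa [YT.numRows] using congrArg List.length h.rows_append
  have key : P.numRows = P'.numRows := by
    -- If `γ` is positive, both upper tableaux are empty. Otherwise `γ` and `γ'` vanish, and the
    -- size condition fixes the number of rows of the lower tableaux.
    by_cases hpos : 0 < γ
    · rw [h.eq_empty hpos, h'.eq_empty (h'.pos_iff.2 (h.pos_iff.1 hpos))]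
    · have hle := mt h.pos_iff.2 hpos
      have hpos' := fun hγ => hle (h'.pos_iff.1 hγ)
      have := h.size_one
      have := h'.size_one
      by_cases hγ : 0 < γ'
      · exact (hpos' hγ).elim
      · omega
  obtain ⟨h1, h2⟩ := List.append_inj hp key
  obtain rfl := YT.ext h1
  obtain rfl := YT.ext h2
  have := h.size_one
  have := h'.size_one
  have := h.size_two
  have := h'.size_two
  rw [Prod.mk.injEq, Prod.mk.injEq, Prod.mk.injEq]
  exact ⟨⟨rfl, by omega⟩, rfl, by omega⟩

theorem eq_sigmaR_iff (p q : DecYT A × DecYT A) :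
    q = sigmaR p ↔ IsSigmaR p.1.1 p.1.2 p.2.1 p.2.2 q.1.1 q.1.2 q.2.1 q.2.2 := by
  constructor
  · rintro rfl
    exact isSigmaR_sigmaR _ _ _ _
  · exact fun h => h.unique (isSigmaR_sigmaR _ _ _ _)

/-- The chain of rows, padded by empty rows, which encodes a decorated tableau. -/
def rowCode (x : DecYT A) : List (List A) := List.replicate x.2 [] ++ x.1.rows

theorem tab_rowCode (x : DecYT A) : Tab (fun a b : A => a < b) (rowCode x) :=
  x.1.tab_rows.pad x.2

theorem rowCode_injective : Function.Injective (rowCode (A := A)) := by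
  intro x y h
  obtain ⟨h1, h2⟩ := replicate_append_injective x.1.ne_nil y.1.ne_nil h
  exact Prod.ext (YT.ext h2) h1

/-- A braiding is encoded as the braiding of chains of rows. -/
def IsCoded {X : Type*} (r : A → A → Prop) [DecidableRel r] (Φ : X → List (List A))
    (σ : X × X → X × X) : Prop :=
  ∀ p, sig r (Φ p.1) (Φ p.2) = (Φ (σ p).1, Φ (σ p).2)

/-- All empty rows of the product lie on top, so the lower block takes the last `m` rows of `M`, or
all of them if there are fewer. The subtractions are written so as to match the decorations in
`sigmaR` and `sigmaC`. -/
theorem sig_of_pad {r : A → A → Prop} [DecidableRel r] (h : Bumping r) {L L' M : List (List A)}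
    (hL : ∀ l ∈ L, Sorted r l) (hL' : ∀ l ∈ L', Sorted r l) (hM : Tab r M)
    (hne : ∀ l ∈ M, l ≠ []) (hke : KE r (L ++ L').flatten M.flatten) {m m' : ℕ}
    (hm : L.length = m) (hm' : L'.length = m') :
    sig r L L' =
      (List.replicate (m' - (M.length - m)) [] ++ M.take (M.length - m),
        List.replicate (m - (M.length - (M.length - m))) [] ++ M.drop (M.length - m)) := by
  obtain ⟨h1, h2⟩ := norm_eq_pad h (L := L ++ L') (M := M)
    (fun l hl => (List.mem_append.1 hl).elim (hL l) (hL' l)) hM hne hke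
  simp only [List.length_append] at h1 h2
  rw [sig, h2, List.take_append, List.drop_append, List.length_replicate, List.take_replicate,
    List.drop_replicate]
  have e1 : min L'.length (L.length + L'.length - M.length) = m' - (M.length - m) := by omega
  have e2 : L.length + L'.length - M.length - L'.length = m - (M.length - (M.length - m)) := by
    omega
  have e3 : M.take (L'.length - (L.length + L'.length - M.length)) =
      M.take (M.length - m) := by
    congr 1; omega
  have e4 : M.drop (L'.length - (L.length + L'.length - M.length)) =
      M.drop (M.length - m) := by
    congr 1; omega
  rw [e1, e2, e3, e4]

theorem isCoded_sigmaR : IsCoded (fun a b : A => a < b) rowCode (sigmaR (A := A)) := by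
  rintro ⟨⟨T₁, α₁⟩, ⟨T₂, α₂⟩⟩
  have hle := (T₁.numRows_prod_le T₂).1
  rw [sig_of_pad Bumping.lt (m := α₁ + T₁.numRows) (m' := α₂ + T₂.numRows)
    (tab_rowCode _).sorted (tab_rowCode _).sorted (T₁.prod T₂).tab_rows (T₁.prod T₂).ne_nil
    (by simpa [rowCode, YT.rowReading] using T₁.ke_prod T₂) (by simp [rowCode, YT.numRows])
    (by simp [rowCode, YT.numRows])]
  simp only [YT.numRows] at hle ⊢
  simp [rowCode, sigmaR, YT.takeRows, YT.dropRows, YT.numRows]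

end RowBraiding

/-! ### From the Yang–Baxter equation to braid monoid actions -/

section Tuples

variable {A X : Type*} {k : ℕ}

/-- The set-theoretic Yang–Baxter equation. -/
def YangBaxter (σ : X × X → X × X) : Prop := ∀ x y z,
  ((σ ((σ (x, y)).1, (σ ((σ (x, y)).2, z)).1)).1, (σ ((σ (x, y)).1, (σ ((σ (x, y)).2, z)).1)).2,
    (σ ((σ (x, y)).2, z)).2) =
  ((σ (x, (σ (y, z)).1)).1, (σ ((σ (x, (σ (y, z)).1)).2, (σ (y, z)).2)).1,
    (σ ((σ (x, (σ (y, z)).1)).2, (σ (y, z)).2)).2)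

theorem YangBaxter.applyAt {σ : X × X → X × X} (h : YangBaxter σ) {i j : Fin (k - 1)}
    (hij : i.val + 1 = j.val) (x : Fin k → X) :
    applyAt σ i (applyAt σ j (applyAt σ i x)) = applyAt σ j (applyAt σ i (applyAt σ j x)) := by
  obtain ⟨i, hi⟩ := i
  obtain ⟨j, hj⟩ := j
  obtain rfl : i + 1 = j := hij
  have h0 := h (x ⟨i, by omega⟩) (x ⟨i + 1, by omega⟩) (x ⟨i + 1 + 1, by omega⟩)
  simp only [Prod.mk.injEq] at h0
  obtain ⟨h1, h2, h3⟩ := h0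
  have f1 : i ≠ i + 1 + 1 := by omega
  have f2 : i + 1 + 1 ≠ i := by omega
  funext m
  obtain ⟨m, hm⟩ := m
  by_cases e1 : m = i
  · subst e1
    simpa [f1, f2, Plactic.applyAt] using h1
  · by_cases e2 : m = i + 1
    · subst e2
      simpa [f1, f2, Plactic.applyAt] using h2
    · by_cases e3 : m = i + 1 + 1
      · subst e3
        simpa [f1, f2, Plactic.applyAt] using h3
      · simp [Plactic.applyAt, e1, e2, e3]

theorem applyAt_comm (σ : X × X → X × X) {i j : Fin (k - 1)} (hij : i.val + 1 < j.val)
    (x : Fin k → X) : applyAt σ i (applyAt σ j x) = applyAt σ j (applyAt σ i x) := by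
  obtain ⟨i, hi⟩ := i
  obtain ⟨j, hj⟩ := j
  simp only at hij
  funext m
  obtain ⟨m, hm⟩ := m
  have f1 : i ≠ j := by omega
  have f2 : i ≠ j + 1 := by omega
  have f3 : i + 1 ≠ j := by omega
  have f4 : j ≠ i := by omega
  have f5 : j ≠ i + 1 := by omega
  have f6 : j + 1 ≠ i := by omega
  by_cases e1 : m = i
  · subst e1; simp [Plactic.applyAt, *]
  · by_cases e2 : m = i + 1
    · subst e2; simp [Plactic.applyAt, *]
    · simp [Plactic.applyAt, *]

/-- The action of the positive braid monoid defined by a solution of the Yang–Baxter equation. -/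
theorem exists_hom_of_yangBaxter {σ : X × X → X × X} (h : YangBaxter σ) :
    ∃ β : PosBraidMonoid k →* Function.End (Fin k → X),
      ∀ l, β (braidGen k l) = applyAt σ l := by
  let f : Fin (k - 1) → Function.End (Fin k → X) := fun l => applyAt σ l
  refine ⟨PresentedMonoid.lift f ?_, ?_⟩
  · rintro _ _ (⟨i, j, hij⟩ | ⟨i, j, hij⟩)
    · simp only [map_mul, FreeMonoid.lift_eval_of]
      exact funext fun x => applyAt_comm σ hij x
    · simp only [map_mul, FreeMonoid.lift_eval_of]
      exact funext fun x => h.applyAt hij x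
  · intro l
    rfl

theorem IsCoded.yangBaxter {r : A → A → Prop} [DecidableRel r] (h : Bumping r)
    {Φ : X → List (List A)} (hΦ : Function.Injective Φ) (hT : ∀ x, Tab r (Φ x))
    {σ : X × X → X × X} (hσ : IsCoded r Φ σ) : YangBaxter σ := by
  intro x y z
  have h0 := sig_braid h (hT x) (hT y) (hT z)
  have hσ' : ∀ u v, sig r (Φ u) (Φ v) = (Φ (σ (u, v)).1, Φ (σ (u, v)).2) :=
    fun u v => hσ (u, v)
  simp only [hσ', Prod.mk.injEq] at h0
  simp only [Prod.mk.injEq]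
  exact ⟨hΦ h0.1, hΦ h0.2.1, hΦ h0.2.2⟩

end Tuples

end Plactic

namespace Plactic

/-! ### Operators on tuples realized on words -/

section Realization

variable {A X : Type*} {k : ℕ}

/-- The concatenation of the words encoding the components of a tuple. -/
def codeWord (Φ : X → List (List A)) (x : Fin k → X) : List A :=
  (List.ofFn fun j => (Φ (x j)).flatten).flatten

/-- The operator `s` on tuples acts by `φ` on the encoding words, and preserves the lengths of the
rows. -/
structure Realizes (Φ : X → List (List A)) (φ : List A → List A)
    (s : (Fin k → X) → Fin k → X) : Prop where
  shape : ∀ x j, (Φ (s x j)).map List.length = (Φ (x j)).map List.length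
  word : ∀ x, codeWord Φ (s x) = φ (codeWord Φ x)

theorem length_flatten_congr {L L' : List (List A)}
    (h : L.map List.length = L'.map List.length) : L.flatten.length = L'.flatten.length := by
  rw [List.length_flatten, List.length_flatten, h]

/-- The row lengths tell where to cut the word, first into components and then into rows. -/
theorem eq_of_codeWord {Φ : X → List (List A)} (hΦ : Function.Injective Φ) {x y : Fin k → X}
    (hs : ∀ j, (Φ (x j)).map List.length = (Φ (y j)).map List.length)
    (hw : codeWord Φ x = codeWord Φ y) : x = y := by
  have h := List.eq_iff_flatten_eq.2 ⟨hw, by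
    simp only [List.map_ofFn]
    exact congrArg List.ofFn (funext fun j => length_flatten_congr (hs j))⟩
  funext j
  exact hΦ (List.eq_iff_flatten_eq.2 ⟨congrFun (List.ofFn_injective h) j, hs j⟩)

theorem Realizes.id (Φ : X → List (List A)) : Realizes (k := k) Φ id id :=
  ⟨fun _ _ => rfl, fun _ => rfl⟩

theorem Realizes.comp {Φ : X → List (List A)} {φ ψ : List A → List A}
    {s t : (Fin k → X) → Fin k → X} (hs : Realizes Φ φ s) (ht : Realizes Φ ψ t) :
    Realizes Φ (φ ∘ ψ) (s ∘ t) :=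
  ⟨fun x j => (hs.shape (t x) j).trans (ht.shape x j), fun x => by
    simp only [Function.comp, hs.word, ht.word]⟩

theorem Realizes.eq {Φ : X → List (List A)} (hΦ : Function.Injective Φ) {φ : List A → List A}
    {s t : (Fin k → X) → Fin k → X} (hs : Realizes Φ φ s) (ht : Realizes Φ φ t) : s = t :=
  funext fun x => eq_of_codeWord hΦ (fun j => (hs.shape x j).trans (ht.shape x j).symm)
    ((hs.word x).trans (ht.word x).symm)

theorem ofFn_split {β : Type*} (f g : Fin k → β) {l : ℕ} (hl : l + 1 < k)
    (hfg : ∀ j : Fin k, j.val ≠ l → j.val ≠ l + 1 → f j = g j) :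
    ∃ u v, u.length = l ∧ List.ofFn f = u ++ f ⟨l, by omega⟩ :: f ⟨l + 1, hl⟩ :: v ∧
      List.ofFn g = u ++ g ⟨l, by omega⟩ :: g ⟨l + 1, hl⟩ :: v := by
  have key : ∀ f : Fin k → β, List.ofFn f = (List.ofFn f).take l ++ f ⟨l, by omega⟩ ::
      f ⟨l + 1, hl⟩ :: (List.ofFn f).drop (l + 2) := by
    intro f
    conv_lhs => rw [← List.take_append_drop l (List.ofFn f)]
    rw [List.drop_eq_getElem_cons (by simp; omega), List.drop_eq_getElem_cons (by simp; omega)]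
    simp
  refine ⟨(List.ofFn f).take l, (List.ofFn f).drop (l + 2), by simp; omega, key f, ?_⟩
  have h1 : (List.ofFn f).take l = (List.ofFn g).take l := by
    refine List.ext_getElem (by simp) fun i h h' => ?_
    simp only [List.length_take, List.length_ofFn] at h
    simpa using hfg ⟨i, by omega⟩ (by simp; omega) (by simp; omega)
  have h2 : (List.ofFn f).drop (l + 2) = (List.ofFn g).drop (l + 2) := by
    refine List.ext_getElem (by simp) fun i h h' => ?_
    simp only [List.length_drop, List.length_ofFn] at h
    simpa using hfg ⟨l + 2 + i, by omega⟩ (by simp; omega) (by simp; omega)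
  rw [h1, h2]
  exact key g

/-- The words of `x` and `s x` have the same behaviour under swaps, and so do their factors at
places `l`, `l + 1`. Normalising these factors yields equal shapes through swaps at equal positions,
and `φ` commutes with swaps; thus both sides have the same word and the same row lengths. -/
theorem Realizes.applyAt {r : A → A → Prop} [DecidableRel r] (h : Bumping r)
    {Φ : X → List (List A)} (hΦ : Function.Injective Φ) (hT : ∀ x, Tab r (Φ x))
    {σ : X × X → X × X} (hσ : IsCoded r Φ σ) {φ : List A → List A} (hφ : NatOp r φ)
    {s : (Fin k → X) → Fin k → X} (hs : Realizes Φ φ s) (l : Fin (k - 1)) (x : Fin k → X) :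
    s (applyAt σ l x) = applyAt σ l (s x) := by
  obtain ⟨l, hl⟩ := l
  have hl' : l + 1 < k := by omega
  -- splitting of the words before and after the application of `σ`
  have split : ∀ x : Fin k → X, ∃ u v : List (List A), u.length = l ∧
      (List.ofFn fun j => (Φ (x j)).flatten) = u ++ (Φ (x ⟨l, by omega⟩)).flatten ::
        (Φ (x ⟨l + 1, hl'⟩)).flatten :: v ∧
      codeWord Φ x = u.flatten ++ (Φ (x ⟨l, by omega⟩) ++ Φ (x ⟨l + 1, hl'⟩)).flatten ++
        v.flatten ∧
      codeWord Φ (Plactic.applyAt σ ⟨l, hl⟩ x) = u.flatten ++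
        (norm r (Φ (x ⟨l, by omega⟩) ++ Φ (x ⟨l + 1, hl'⟩))).flatten ++ v.flatten := by
    intro x
    obtain ⟨u, v, hu, h1, h2⟩ := ofFn_split (fun j => (Φ (x j)).flatten)
      (fun j => (Φ (Plactic.applyAt σ ⟨l, hl⟩ x j)).flatten) hl'
      (fun j hj hj' => by simp [Plactic.applyAt, hj, hj'])
    refine ⟨u, v, hu, h1, by rw [codeWord, h1]; simp, ?_⟩
    have h3 := hσ (x ⟨l, by omega⟩, x ⟨l + 1, hl'⟩)
    rw [codeWord, h2, ← sig_append, h3]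
    simp [Plactic.applyAt]
  obtain ⟨u, v, hu, hx, hw, hw'⟩ := split x
  obtain ⟨u', v', hu', hy, hv, hv'⟩ := split (s x)
  have hlen : (List.ofFn fun j => (Φ (x j)).flatten).map List.length =
      (List.ofFn fun j => (Φ (s x j)).flatten).map List.length := by
    simp only [List.map_ofFn]
    exact congrArg List.ofFn (funext fun j => length_flatten_congr (hs.shape x j).symm)
  rw [hx, hy, List.map_append, List.map_append] at hlen
  obtain ⟨hlu, hlv⟩ := List.append_inj hlen (by simp [hu, hu'])
  simp only [List.map_cons, List.cons.injEq] at hlv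
  have hshape : (Φ (x ⟨l, by omega⟩) ++ Φ (x ⟨l + 1, hl'⟩)).map List.length =
      (Φ (s x ⟨l, by omega⟩) ++ Φ (s x ⟨l + 1, hl'⟩)).map List.length := by
    simp only [List.map_append, hs.shape]
  have sorted : ∀ y z, ∀ m ∈ Φ y ++ Φ z, Sorted r m := fun y z m hm =>
    (List.mem_append.1 hm).elim ((hT y).sorted m) ((hT z).sorted m)
  have hQ := hφ.sameQ (codeWord Φ x)
  rw [← hs.word, hw, hv] at hQ
  obtain ⟨hn, hp⟩ := (hQ.factor (length_flatten_congr hlu)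
    (length_flatten_congr hshape)).norm h (sorted _ _) (sorted _ _) hshape
  have hp := hp.context (length_flatten_congr hlu) (length_flatten_congr hlv.2.2)
  rw [← hw, ← hv, ← hw', ← hv', hs.word] at hp
  -- The words agree because `φ` follows the swaps. For the row lengths, only the two blocks cut out
  -- of the product need `hn`.
  refine eq_of_codeWord hΦ (fun j => ?_) ((hs.word _).trans (hφ.eq_of_par hp).symm)
  rw [hs.shape]
  have e := hσ (x ⟨l, by omega⟩, x ⟨l + 1, hl'⟩)
  have e' := hσ (s x ⟨l, by omega⟩, s x ⟨l + 1, hl'⟩)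
  simp only [sig, Prod.mk.injEq] at e e'
  have hM : (Φ (x ⟨l + 1, hl'⟩)).length = (Φ (s x ⟨l + 1, hl'⟩)).length := by
    simpa using (congrArg List.length (hs.shape x ⟨l + 1, hl'⟩)).symm
  simp only [Plactic.applyAt]
  split_ifs with h1 h2
  · rw [← e.1, ← e'.1, List.map_take, List.map_take, hn, hM]
  · rw [← e.2, ← e'.2, List.map_drop, List.map_drop, hn, hM]
  · exact (hs.shape x j).symm

end Realization

end Plactic

namespace Plactic

/-! ### Cutting words into pieces of given lengths -/

section Cutting

variable {A : Type*}

theorem take_drop_flatten (L : List (List A)) (j : ℕ) (hj : j < L.length) :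
    (L.flatten.drop ((L.map List.length).take j).sum).take L[j].length = L[j] := by
  induction L generalizing j with
  | nil => simp at hj
  | cons l L ih =>
    rcases j with _ | j
    · simp
    · have := ih j (by simpa using hj)
      rw [List.getElem_cons_succ, List.map_cons, List.take_succ_cons, List.sum_cons,
        List.flatten_cons, ← List.drop_drop, List.drop_left]
      exact this

/-- The pieces of given lengths into which a word is cut. -/
theorem cut_spec {k : ℕ} (len : Fin k → ℕ) (U : List A) (hU : U.length = (List.ofFn len).sum) :
    (List.ofFn fun j => (U.drop (∑ m ∈ Finset.Iio j, len m)).take (len j)).flatten = U ∧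
      ∀ j, ((U.drop (∑ m ∈ Finset.Iio j, len m)).take (len j)).length = len j := by
  set F := (List.ofFn len).splitLengths U with hF
  have hflat : F.flatten = U := List.flatten_splitLengths _ _ hU.le
  have hmap : F.map List.length = List.ofFn len := List.map_splitLengths_length _ _ hU.ge
  have hlen : F.length = k := by simp [hF]
  have key : ∀ j : Fin k, (U.drop (∑ m ∈ Finset.Iio j, len m)).take (len j) =
      F[j.val]'(by rw [hlen]; exact j.isLt) := by
    intro j
    have h1 := take_drop_flatten F j (by rw [hlen]; exact j.isLt)
    have h2 : (F[j.val]'(by rw [hlen]; exact j.isLt)).length = len j := by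
      have := List.getElem_of_eq hmap (i := j.val) (by simp [hlen])
      simpa using this
    rw [hflat, hmap, h2, List.sum_take_ofFn] at h1
    rw [← h1]
    congr 3
    ext m
    simp
  constructor
  · conv_rhs => rw [← hflat]
    congr 1
    refine List.ext_getElem (by simp [hlen]) fun i h h' => ?_
    rw [List.getElem_ofFn, key]
  · intro j
    have := List.getElem_of_eq hmap (i := j.val) (by simp [hlen])
    rw [key]
    simpa using this

variable {r : A → A → Prop} [DecidableRel r] {ι : Type*}

theorem SameQ.of_flatten {W W' : ι → List A} (hlen : ∀ i, (W i).length = (W' i).length)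
    {l : List ι} (h : SameQ r (l.map W).flatten (l.map W').flatten) {i : ι} (hi : i ∈ l) :
    SameQ r (W i) (W' i) := by
  induction l with
  | nil => simp at hi
  | cons a l ih =>
    simp only [List.map_cons, List.flatten_cons] at h
    rcases List.mem_cons.1 hi with rfl | hi
    · exact h.left (hlen _)
    · exact ih (h.right (hlen _)) hi

theorem Par.flatten {W W' V V' : ι → List A} (hlen : ∀ i, (W i).length = (W' i).length)
    (h : ∀ i, Par r (W i) (W' i) (V i) (V' i)) (l : List ι) :
    Par r (l.map W).flatten (l.map W').flatten (l.map V).flatten (l.map V').flatten := by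
  induction l with
  | nil => exact Par.refl
  | cons a l ih =>
    have h1 := (h a).context (u := []) (u' := []) rfl
      (v := (l.map W).flatten) (v' := (l.map W').flatten) (by simp [List.length_flatten, hlen,
        Function.comp_def])
    have h2 := ih.context (u := V a) (u' := V' a)
      (by rw [(h a).length_eq.1, (h a).length_eq.2, hlen]) (v := []) (v' := []) rfl
    simp only [List.append_nil, List.nil_append] at h1 h2
    exact h1.trans h2

end Cutting

/-! ### Letter permuting operators on tuples of tableaux -/

section LetterOperators

variable {A : Type*} [LinearOrder A]

/-- Cut at the row lengths of `T`, the word is itself the reading of a tableau by `SameQ.tab`, and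
`ofWord` recovers a tableau from its reading. -/
theorem YT.ofWord_of_sameQ {T : YT A} {w : List A}
    (hQ : SameQ (fun a b : A => a < b) T.rowReading w) :
    (ofWord w).rowReading = w ∧ (ofWord w).rows.map List.length = T.rows.map List.length := by
  have hlen : w.length = (T.rows.map List.length).sum := by
    rw [← hQ.length_eq, rowReading, List.length_flatten]
  have hflat := List.flatten_splitLengths w _ hlen.le
  have hmap := List.map_splitLengths_length w _ hlen.ge
  set L := (T.rows.map List.length).splitLengths w
  have hT : Tab (fun a b : A => a < b) L :=
    SameQ.tab Bumping.lt T.tab_rows hmap.symm (by rw [hflat]; exact hQ)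
  have hne : ∀ l ∈ L, l ≠ [] := by
    rintro _ hl rfl
    have h0 : 0 ∈ L.map List.length := List.mem_map.2 ⟨[], hl, rfl⟩
    rw [hmap] at h0
    obtain ⟨l, hl, h0⟩ := List.mem_map.1 h0
    exact T.ne_nil l hl (List.length_eq_zero_iff.1 h0)
  have h1 : (hT.toYT hne).rowReading = w := hflat
  have h2 := (hT.toYT hne).ofWord_rowReading
  rw [h1] at h2
  rw [h2]
  exact ⟨h1, hmap⟩

theorem codeWord_rowCode {k : ℕ} (x : Fin k → DecYT A) :
    codeWord rowCode x = (List.ofFn fun j => (x j).1.rowReading).flatten := by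
  simp [codeWord, rowCode, YT.rowReading]

variable {n k : ℕ}

theorem sWord_eq_flip {i : ℕ} (hi : i + 1 < n) :
    sWord i hi = flip (⟨i, Nat.lt_of_succ_lt hi⟩ : Fin n) ⟨i + 1, hi⟩ :=
  funext fun w => permuteWord_eq_flip (by simp) w

theorem natOp_sWord {i : ℕ} (hi : i + 1 < n) :
    NatOp (fun a b : Fin n => a < b) (sWord i hi) := by
  rw [sWord_eq_flip]
  refine natOp_flip (by simp) fun x => ?_
  rw [Fin.le_def, Fin.le_def]
  simp only
  omega

/-- Each piece of the permuted word behaves like the reading it comes from, so it already is the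
reading of a tableau of the same shape. Passing to tableaux therefore loses nothing. -/
theorem sTuple_spec {i : ℕ} (hi : i + 1 < n) (x : Fin k → DecYT (Fin n)) :
    (List.ofFn fun j => (sTuple i hi x j).1.rowReading).flatten =
        sWord i hi (List.ofFn fun j => (x j).1.rowReading).flatten ∧
      ∀ j, (sTuple i hi x j).1.rows.map List.length = (x j).1.rows.map List.length := by
  set W := (List.ofFn fun j => (x j).1.rowReading).flatten with hW
  obtain ⟨h1, h2⟩ := cut_spec (fun j => (x j).1.rowReading.length) (sWord i hi W) (by
    rw [(natOp_sWord hi).length_eq, hW, List.length_flatten, List.map_ofFn]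
    rfl)
  have hQ := (natOp_sWord hi).sameQ W
  rw [← h1] at hQ
  simp only [hW, List.ofFn_eq_map] at hQ
  have hQ' := fun j => YT.ofWord_of_sameQ (SameQ.of_flatten (fun j => (h2 j).symm) (by
    rw [hW, List.ofFn_eq_map]; exact hQ) (List.mem_finRange j))
  refine ⟨?_, fun j => (hQ' j).2⟩
  conv_rhs => rw [← h1]
  congr 2
  funext j
  exact (hQ' j).1

theorem realizes_sTuple {i : ℕ} (hi : i + 1 < n) :
    Realizes (k := k) rowCode (sWord i hi) (sTuple i hi) where
  shape x j := by
    simp only [rowCode, List.map_append, (sTuple_spec hi x).2 j]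
    rfl
  word x := by rw [codeWord_rowCode, codeWord_rowCode, (sTuple_spec hi x).1]

/-- The letter permuting operators as a sequence of self-maps. -/
def permuting (n k i : ℕ) : Function.End (Fin k → DecYT (Fin n)) :=
  if hi : i + 1 < n then sTuple i hi else 1

theorem permuting_of_lt {n k i : ℕ} (hi : i + 1 < n) : permuting n k i = sTuple i hi :=
  dif_pos hi

/-- By `Realizes.eq`, an operator on tuples is determined by the word operator it realizes, so the
relations are inherited from `flip`. -/
theorem coxeterRel_permuting (n k : ℕ) : CoxeterRel n (permuting n k) where
  sq i hi := by
    rw [permuting_of_lt hi]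
    refine ((realizes_sTuple hi).comp (realizes_sTuple hi)).eq rowCode_injective (t := id) ?_
    convert Realizes.id _
    funext w
    simp only [sWord_eq_flip, Function.comp]
    exact flip_flip (by simp) w
  far i j hij hj := by
    have hi : i + 1 < n := by omega
    rw [permuting_of_lt hi, permuting_of_lt hj]
    refine ((realizes_sTuple hi).comp (realizes_sTuple hj)).eq rowCode_injective (t := sTuple j hj ∘ sTuple i hi) ?_
    convert (realizes_sTuple hj).comp (realizes_sTuple hi) using 1
    funext w
    simp only [sWord_eq_flip, Function.comp]
    refine flip_comm ?_ ?_ ?_ ?_ w <;> simp <;> omega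
  near i hi := by
    have hi' : i + 1 < n := by omega
    rw [permuting_of_lt hi', permuting_of_lt hi]
    refine (((realizes_sTuple hi').comp (realizes_sTuple hi)).comp
      (realizes_sTuple hi')).eq rowCode_injective (t := (sTuple (i + 1) hi ∘ sTuple i hi') ∘ sTuple (i + 1) hi) ?_
    convert ((realizes_sTuple hi).comp (realizes_sTuple hi')).comp (realizes_sTuple hi) using 1
    funext w
    simp only [sWord_eq_flip, Function.comp]
    refine flip_braid (by simp) (by simp) (fun x => ?_) (fun x => ?_) w
    all_goals
      rw [Fin.le_def, Fin.le_def]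
      simp only
      omega

end LetterOperators

end Plactic

namespace Plactic

/-! ### Columns as rows for the comparison `≤` -/

section Columns

variable {A : Type*} [LinearOrder A]

theorem YT.pairwise_length {T : YT A} : T.rows.Pairwise fun x y => x.length ≤ y.length :=
  T.decreasing.imp fun h => h.1

theorem YT.numCols_le_iff (T : YT A) (m : ℕ) :
    T.numCols ≤ m ↔ ∀ l ∈ T.rows, l.length ≤ m := by
  unfold numCols
  have h := T.pairwise_length
  rcases List.eq_nil_or_concat T.rows with h0 | ⟨L, l, h0⟩
  · simp [h0]
  · rw [h0] at h ⊢
    simp only [List.concat_eq_append, List.pairwise_append] at h ⊢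
    simp only [List.getLast?_append, List.getLast?_singleton, Option.some_or, Option.getD_some,
      List.mem_append, List.mem_singleton]
    exact ⟨fun hm l' hl' => hl'.elim (fun hl' => (h.2.2 l' hl' l (by simp)).trans hm)
      (fun hl' => hl' ▸ hm), fun hm => hm l (Or.inr rfl)⟩

theorem YT.length_le_numCols (T : YT A) {l : List A} (hl : l ∈ T.rows) : l.length ≤ T.numCols :=
  (T.numCols_le_iff _).1 le_rfl l hl

theorem YT.length_cols (T : YT A) : T.cols.length = T.numCols := by simp [cols]

theorem YT.col_ne_nil (T : YT A) {j : ℕ} (hj : j < T.numCols) : T.col j ≠ [] := by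
  intro h
  refine absurd ((T.numCols_le_iff j).2 fun l hl => ?_) (not_le.2 hj)
  have := List.filterMap_eq_nil_iff.1 h l hl
  simpa using this

theorem filterMap_filter_ne_nil (L : List (List A)) (j : ℕ) :
    (L.filter fun l => decide (l ≠ [])).filterMap (fun l => l[j]?) =
      L.filterMap fun l => l[j]? := by
  induction L with
  | nil => rfl
  | cons l L ih =>
    rcases l with _ | ⟨a, l⟩
    · simpa using ih
    · rw [List.filter_cons_of_pos (by simp), List.filterMap_cons, List.filterMap_cons, ih]

theorem YT.col_dropCols (T : YT A) (m j : ℕ) : (T.dropCols m).col j = T.col (m + j) := by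
  simp only [col, dropCols, filterMap_filter_ne_nil, List.filterMap_map]
  congr 1
  funext l
  simp

theorem YT.col_takeCols (T : YT A) {m j : ℕ} (hj : j < m) : (T.takeCols m).col j = T.col j := by
  simp only [col, takeCols, filterMap_filter_ne_nil, List.filterMap_map]
  congr 1
  funext l
  simp [hj]

theorem YT.numCols_dropCols (T : YT A) (m : ℕ) : (T.dropCols m).numCols = T.numCols - m := by
  refine eq_of_forall_ge_iff fun c => ?_
  rw [numCols_le_iff, tsub_le_iff_left, numCols_le_iff]
  simp only [dropCols, List.mem_filter, List.mem_map, decide_eq_true_eq, and_imp,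
    forall_exists_index, forall_apply_eq_imp_iff₂, List.length_drop, tsub_le_iff_left]
  refine forall₂_congr fun l hl => ⟨fun h => ?_, fun h _ => h⟩
  by_contra hc
  refine hc (h fun h0 => ?_)
  rw [List.drop_eq_nil_iff] at h0
  omega

theorem YT.numCols_takeCols (T : YT A) (m : ℕ) :
    (T.takeCols m).numCols = min m T.numCols := by
  refine eq_of_forall_ge_iff fun c => ?_
  rw [numCols_le_iff, min_le_iff, numCols_le_iff]
  simp only [takeCols, List.mem_filter, List.mem_map, decide_eq_true_eq, and_imp,
    forall_exists_index, forall_apply_eq_imp_iff₂, List.length_take, min_le_iff]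
  constructor
  · intro h
    by_cases hc : m ≤ c
    · exact Or.inl hc
    · refine Or.inr fun l hl => ?_
      refine (h l hl fun h0 => ?_).resolve_left hc
      rcases List.take_eq_nil_iff.1 h0 with h0 | h0
      · omega
      · exact T.ne_nil l hl h0
  · exact fun h l hl _ => h.imp_right fun h => h l hl

theorem YT.cols_dropCols (T : YT A) (m : ℕ) : (T.dropCols m).cols = T.cols.drop m := by
  refine List.ext_getElem (by simp [length_cols, numCols_dropCols]) fun j h h' => ?_
  simp [cols, col_dropCols]

theorem YT.cols_takeCols (T : YT A) (m : ℕ) : (T.takeCols m).cols = T.cols.take m := by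
  refine List.ext_getElem (by simp [length_cols, numCols_takeCols]) fun j h h' => ?_
  have hj : j < m := by
    simp only [List.length_take] at h'
    omega
  simp [cols, col_takeCols T hj]

/-- Each letter of `hs`, inserted into the row, bumps the head, which is the preceding letter of the
column; the letters of `u` stay behind. -/
theorem ke_firstCol {a : A} {u hs : List A} (hu : (a :: u).Pairwise (· ≤ ·))
    (hh : (a :: hs).Pairwise (· > ·)) :
    KE (fun x y : A => x < y) (a :: u ++ hs) (a :: hs ++ u) := by
  induction hs generalizing a with
  | nil => simp [KE.refl]
  | cons b hs ih =>
    have hu' := List.pairwise_cons.1 hu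
    have hh' := List.pairwise_cons.1 hh
    have hba : b < a := hh'.1 b (by simp)
    have h1 := (ke_ins Bumping.lt b (hu.imp not_lt.2)).append_right hs
    simp only [ins, hba, if_true] at h1
    have h2 := (ih (a := b) (List.pairwise_cons.2
      ⟨fun c hc => hba.le.trans (hu'.1 c hc), hu'.2⟩) hh'.2).append_left [a]
    simpa using h1.trans (by simpa using h2)

theorem filterMap_getElem_pairwise {L : List (List A)} (hL : L.Pairwise RowGt) (j : ℕ) :
    (L.filterMap fun l => l[j]?).Pairwise (· > ·) := by
  refine hL.filterMap _ ?_
  intro x y hxy b hb c hc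
  obtain ⟨hj, rfl⟩ := List.getElem?_eq_some_iff.1 hb
  obtain ⟨hj', rfl⟩ := List.getElem?_eq_some_iff.1 hc
  exact hxy.2 j hj hj'

/-- The first column is split off row by row from the bottom: by `ke_firstCol`, the part of it
already extracted from the lower rows passes to the left of the remaining letters of the current
row. -/
theorem ke_strip {L : List (List A)} (hne : ∀ l ∈ L, l ≠ []) (hs : ∀ l ∈ L, l.Pairwise (· ≤ ·))
    (hL : L.Pairwise RowGt) :
    KE (fun x y : A => x < y) L.flatten
      ((L.filterMap fun l => l[0]?) ++ (L.map (List.drop 1)).flatten) := by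
  induction L with
  | nil => exact KE.refl _
  | cons l L ih =>
    have hc := filterMap_getElem_pairwise hL 0
    simp only [List.mem_cons, forall_eq_or_imp] at hne hs
    have ih := (ih hne.2 hs.2 (List.pairwise_cons.1 hL).2).append_left l
    rcases l with _ | ⟨a, u⟩
    · exact absurd rfl hne.1
    · rw [List.filterMap_cons] at hc ⊢
      simp only [List.getElem?_cons_zero] at hc ⊢
      have := (ke_firstCol hs.1 hc).append_right (L.map (List.drop 1)).flatten
      simpa using ih.trans (by simpa using this)

theorem flatten_filter_ne_nil (L : List (List A)) :
    (L.filter fun l => decide (l ≠ [])).flatten = L.flatten := by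
  induction L with
  | nil => rfl
  | cons l L ih =>
    rcases l with _ | ⟨a, l⟩
    · simpa using ih
    · rw [List.filter_cons_of_pos (by simp), List.flatten_cons, List.flatten_cons, ih]

theorem YT.cols_eq_cons (T : YT A) (h : T.numCols ≠ 0) :
    T.cols = T.col 0 :: (T.dropCols 1).cols := by
  rw [cols_dropCols]
  obtain ⟨m, hm⟩ := Nat.exists_eq_succ_of_ne_zero h
  rw [cols, hm, List.range_succ_eq_map]
  simp

/-- The row reading is Knuth equivalent to the column reading. -/
theorem YT.ke_cols (T : YT A) :
    KE (fun x y : A => x < y) T.rowReading T.cols.flatten := by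
  induction h : T.numCols generalizing T with
  | zero =>
    have h0 : T.rows = [] := List.eq_nil_iff_forall_not_mem.2 fun l hl => T.ne_nil l hl
      (List.length_eq_zero_iff.1 (Nat.le_zero.1 (h ▸ T.length_le_numCols hl)))
    simp [rowReading, cols, h, h0, KE.refl]
  | succ m ih =>
    have h1 := ke_strip T.ne_nil T.nondecreasing T.decreasing
    have h2 := (ih (T.dropCols 1) (by rw [numCols_dropCols, h]; rfl)).append_left (T.col 0)
    rw [T.cols_eq_cons (by omega)]
    refine h1.trans ?_
    rw [rowReading, dropCols, flatten_filter_ne_nil] at h2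
    exact h2

theorem YT.eq_of_cols {T T' : YT A} (h : T.cols = T'.cols) : T = T' :=
  YT.eq_of_ke (T.ke_cols.trans (h ▸ T'.ke_cols.symm))

/-- Reversal exchanges the two kinds of Knuth moves, with strict and weak inequalities trading
places. -/
theorem KE.reverse {w w' : List A} (h : KE (fun x y : A => x < y) w w') :
    KE (fun x y : A => x ≤ y) w.reverse w'.reverse := by
  induction h with
  | move u v hst =>
    simp only [List.reverse_append, ← List.append_assoc]
    rw [List.append_assoc, List.append_assoc, ← List.append_assoc, ← List.append_assoc]
    refine KE.context ?_ _ _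
    cases hst with
    | one hxy hyz => exact (KE.of_move (KnuthMove.two (by simpa using hxy) (by simpa using hyz)))
    | two hxy hyz => exact (KE.of_move (KnuthMove.one (by simpa using hxy) (by simpa using hyz)))
  | refl => exact KE.refl _
  | symm _ ih => exact ih.symm
  | trans _ _ ih ih' => exact ih.trans ih'

/-- The columns, from right to left, read from bottom to top. -/
def YT.revCols (T : YT A) : List (List A) := (T.cols.map List.reverse).reverse

theorem YT.flatten_revCols (T : YT A) : T.revCols.flatten = T.cols.flatten.reverse := by
  rw [revCols, List.reverse_flatten]

theorem YT.length_revCols (T : YT A) : T.revCols.length = T.numCols := by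
  simp [revCols, length_cols]

theorem YT.revCols_ne_nil (T : YT A) : ∀ l ∈ T.revCols, l ≠ [] := by
  intro l hl
  simp only [revCols, cols, List.map_map, List.mem_reverse, List.mem_map, List.mem_range] at hl
  obtain ⟨j, hj, rfl⟩ := hl
  simpa using T.col_ne_nil hj

theorem YT.ke_revCols (T : YT A) :
    KE (fun x y : A => x ≤ y) T.rowReading.reverse T.revCols.flatten := by
  rw [flatten_revCols]
  exact T.ke_cols.reverse

/-- Rows are listed from bottom to top with decreasing lengths, so those that reach column `j + 1`
form an initial segment, and neighbouring columns are compared along the rows. -/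
theorem above_col {L : List (List A)} (hs : ∀ l ∈ L, l.Pairwise (· ≤ ·))
    (hL : L.Pairwise fun x y => y.length ≤ x.length) (j : ℕ) :
    Above (fun x y : A => x ≤ y) (L.filterMap fun l => l[j + 1]?) (L.filterMap fun l => l[j]?) := by
  induction L with
  | nil => simp
  | cons l L ih =>
    simp only [List.mem_cons, forall_eq_or_imp] at hs
    have hL' := List.pairwise_cons.1 hL
    by_cases hj : j + 1 < l.length
    · have hj' : j < l.length := by omega
      rw [List.filterMap_cons, List.filterMap_cons, List.getElem?_eq_getElem hj,
        List.getElem?_eq_getElem hj']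
      exact ⟨List.pairwise_iff_getElem.1 hs.1 _ _ hj' hj (by omega), ih hs.2 hL'.2⟩
    · have : (l :: L).filterMap (fun l => l[j + 1]?) = [] := by
        refine List.filterMap_eq_nil_iff.2 fun m hm => ?_
        rcases List.mem_cons.1 hm with rfl | hm
        · simpa using hj
        · have := hL'.1 m hm
          simp
          omega
      rw [this]
      exact above_nil _

theorem YT.reverse_col (T : YT A) (j : ℕ) :
    (T.col j).reverse = T.rows.reverse.filterMap fun l => l[j]? := by
  rw [col, List.filterMap_reverse]

theorem YT.tab_revCols (T : YT A) : Tab (fun x y : A => x ≤ y) T.revCols where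
  sorted l hl := by
    simp only [revCols, cols, List.map_map, List.mem_reverse, List.mem_map, List.mem_range] at hl
    obtain ⟨j, hj, rfl⟩ := hl
    have := filterMap_getElem_pairwise T.decreasing j
    rw [Function.comp, Sorted, List.pairwise_reverse]
    exact this.imp fun h => not_le.2 h
  chain := by
    rw [revCols, List.isChain_reverse, cols, List.map_map, List.isChain_map]
    refine (List.isChain_range _ _).2 fun m _ => ?_
    simp only [Function.comp, reverse_col]
    exact above_col (fun l hl => T.nondecreasing l (List.mem_reverse.1 hl))
      (List.pairwise_reverse.2 T.pairwise_length) m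

/-- The chain which encodes a decorated tableau by its columns. -/
def colCode (x : DecYT A) : List (List A) := List.replicate x.2 [] ++ x.1.revCols

theorem tab_colCode (x : DecYT A) : Tab (fun a b : A => a ≤ b) (colCode x) :=
  x.1.tab_revCols.pad x.2

theorem YT.revCols_injective {T T' : YT A} (h : T.revCols = T'.revCols) : T = T' :=
  eq_of_cols (List.map_injective_iff.2 List.reverse_injective (List.reverse_injective h))

theorem colCode_injective : Function.Injective (colCode (A := A)) := by
  intro x y h
  obtain ⟨h1, h2⟩ := replicate_append_injective x.1.revCols_ne_nil y.1.revCols_ne_nil h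
  exact Prod.ext (YT.revCols_injective h2) h1

end Columns

end Plactic

namespace Plactic

/-! ### The column braiding -/

section ColumnBraiding

variable {A : Type*} [LinearOrder A]

theorem YT.sorted_revCols_append (T T' : YT A) :
    ∀ l ∈ T'.revCols ++ T.revCols, Sorted (fun x y : A => x ≤ y) l := fun l hl =>
  (List.mem_append.1 hl).elim (T'.tab_revCols.sorted l) (T.tab_revCols.sorted l)

theorem YT.ke_revCols_prod (T T' : YT A) :
    KE (fun x y : A => x ≤ y) (T'.revCols ++ T.revCols).flatten (T.prod T').revCols.flatten := by
  have h1 := ((T.ke_prod T').reverse).trans (T.prod T').ke_revCols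
  rw [List.reverse_append] at h1
  rw [List.flatten_append]
  exact (T'.ke_revCols.symm.append T.ke_revCols.symm).trans h1

theorem YT.numCols_prod_le (T T' : YT A) :
    (T.prod T').numCols ≤ T.numCols + T'.numCols := by
  have := (norm_eq_pad Bumping.le (T.sorted_revCols_append T') (T.prod T').tab_revCols
    (T.prod T').revCols_ne_nil (T.ke_revCols_prod T')).1
  simp only [List.length_append, length_revCols] at this
  omega

theorem isSigmaC_sigmaC (T₁ : YT A) (α₁ : ℕ) (T₂ : YT A) (α₂ : ℕ) :
    IsSigmaC T₁ α₁ T₂ α₂ (sigmaC ((T₁, α₁), (T₂, α₂))).1.1 (sigmaC ((T₁, α₁), (T₂, α₂))).1.2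
      (sigmaC ((T₁, α₁), (T₂, α₂))).2.1 (sigmaC ((T₁, α₁), (T₂, α₂))).2.2 := by
  have hle := T₁.numCols_prod_le T₂
  constructor
  · simp [sigmaC, YT.cols_takeCols, YT.cols_dropCols]
  · simp only [sigmaC, YT.numCols_dropCols]; omega
  · simp only [sigmaC, YT.numCols_takeCols]; omega
  · simp only [sigmaC, YT.numCols_takeCols]; omega
  · simp only [sigmaC, YT.numCols_takeCols]
    intro h
    refine YT.eq_of_cols ?_
    rw [YT.cols_dropCols, List.drop_eq_nil_of_le (by rw [YT.length_cols]; omega)]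
    rfl

theorem IsSigmaC.unique {T₁ T₂ P Q P' Q' : YT A} {α₁ α₂ β γ β' γ' : ℕ}
    (h : IsSigmaC T₁ α₁ T₂ α₂ P β Q γ) (h' : IsSigmaC T₁ α₁ T₂ α₂ P' β' Q' γ') :
    ((P, β), (Q, γ)) = ((P', β'), (Q', γ')) := by
  have hp := h.cols_append.trans h'.cols_append.symm
  have hl : P.numCols + Q.numCols = P'.numCols + Q'.numCols := by
    simpa [YT.length_cols] using congrArg List.length hp
  have hn : P.numCols + Q.numCols = (T₁.prod T₂).numCols := by
    simpa [YT.length_cols] using congrArg List.length h.cols_append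
  have key : P.numCols = P'.numCols := by
    by_cases hpos : 0 < β
    · rw [h.eq_empty hpos, h'.eq_empty (h'.pos_iff.2 (h.pos_iff.1 hpos))] at hl
      omega
    · have hpos' : ¬ 0 < β' := fun hβ => hpos (h.pos_iff.2 (h'.pos_iff.1 hβ))
      have := h.size_two
      have := h'.size_two
      omega
  obtain ⟨h1, h2⟩ := List.append_inj hp (by rw [YT.length_cols, YT.length_cols, key])
  obtain rfl := YT.eq_of_cols h1
  obtain rfl := YT.eq_of_cols h2
  have := h.size_one
  have := h'.size_one
  have := h.size_two
  have := h'.size_two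
  rw [Prod.mk.injEq, Prod.mk.injEq, Prod.mk.injEq]
  exact ⟨⟨rfl, by omega⟩, rfl, by omega⟩

theorem eq_sigmaC_iff (p q : DecYT A × DecYT A) :
    q = sigmaC p ↔ IsSigmaC p.1.1 p.1.2 p.2.1 p.2.2 q.1.1 q.1.2 q.2.1 q.2.2 := by
  constructor
  · rintro rfl
    exact isSigmaC_sigmaC _ _ _ _
  · exact fun h => h.unique (isSigmaC_sigmaC _ _ _ _)

/-- The conjugate of a braiding by the flip. -/
def opposite {X : Type*} (σ : X × X → X × X) (p : X × X) : X × X := (σ p.swap).swap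

/-- The columns are read backwards, which exchanges the factors of a product (`YT.ke_revCols_prod`);
this is why the opposite of `sigmaC` appears. -/
theorem isCoded_sigmaC :
    IsCoded (fun a b : A => a ≤ b) colCode (opposite (sigmaC (A := A))) := by
  rintro ⟨⟨T₂, α₂⟩, ⟨T₁, α₁⟩⟩
  have hle := T₁.numCols_prod_le T₂
  rw [sig_of_pad Bumping.le (m := α₂ + T₂.numCols) (m' := α₁ + T₁.numCols)
    (tab_colCode _).sorted (tab_colCode _).sorted (T₁.prod T₂).tab_revCols
    (T₁.prod T₂).revCols_ne_nil
    (by simpa [colCode] using T₁.ke_revCols_prod T₂) (by simp [colCode, YT.length_revCols])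
    (by simp [colCode, YT.length_revCols])]
  simp only [opposite, Prod.swap_prod_mk, sigmaC, colCode,
    YT.numCols_takeCols, YT.numCols_dropCols, YT.length_revCols, Prod.mk.injEq]
  simp only [YT.revCols, YT.cols_takeCols, YT.cols_dropCols, List.map_take, List.map_drop,
    List.take_reverse, List.drop_reverse, List.length_map, YT.length_cols]
  have e : (T₁.prod T₂).numCols - ((T₁.prod T₂).numCols - (α₂ + T₂.numCols)) =
    min (α₂ + T₂.numCols) (T₁.prod T₂).numCols := by omega
  rw [e]
  refine ⟨?_, ?_⟩
  · congr 2
    rcases le_total (α₂ + T₂.numCols) (T₁.prod T₂).numCols with h | h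
    · rw [min_eq_left h]
    · rw [min_eq_right h, List.drop_eq_nil_of_le (by simp [YT.length_cols]),
        List.drop_eq_nil_of_le (by simpa [YT.length_cols] using h)]
  · congr 2
    rcases le_total (α₂ + T₂.numCols) (T₁.prod T₂).numCols with h | h
    · rw [min_eq_left h]
    · rw [min_eq_right h, List.take_of_length_le (by simp [YT.length_cols]),
        List.take_of_length_le (by simpa [YT.length_cols] using h)]

/-- Read on the reversed triple, the equation for the opposite map has its two sides and its outer
components exchanged. -/
theorem YangBaxter.of_opposite {X : Type*} {σ : X × X → X × X} (h : YangBaxter (opposite σ)) :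
    YangBaxter σ := by
  intro x y z
  have h0 := h z y x
  simp only [opposite, Prod.swap_prod_mk, Prod.fst_swap, Prod.snd_swap, Prod.mk.injEq] at h0
  simp only [Prod.mk.injEq]
  exact ⟨h0.2.2.symm, h0.2.1.symm, h0.1.symm⟩

theorem applyAt_eq_opposite {X : Type*} {k : ℕ} (σ : X × X → X × X) (l : Fin (k - 1))
    (x : Fin k → X) :
    applyAt σ l x = applyAt (opposite σ) (Fin.rev l) (x ∘ Fin.rev) ∘ Fin.rev := by
  obtain ⟨l, hl⟩ := l
  funext j
  obtain ⟨j, hj⟩ := j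
  have e1 : Fin.rev (⟨k - 1 - (l + 1), by omega⟩ : Fin k) = ⟨l + 1, by omega⟩ := by
    ext; simp [Fin.val_rev]; omega
  have e2 : Fin.rev (⟨k - 1 - (l + 1) + 1, by omega⟩ : Fin k) = ⟨l, by omega⟩ := by
    ext; simp [Fin.val_rev]; omega
  simp only [applyAt, opposite, Function.comp, Fin.val_rev, e1, e2, Prod.swap_prod_mk,
    Prod.fst_swap, Prod.snd_swap, Fin.rev_rev]
  by_cases h1 : j = l
  · subst h1
    rw [if_pos rfl, if_neg (by omega), if_pos (by omega)]
  · by_cases h2 : j = l + 1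
    · subst h2
      rw [if_neg h1, if_pos rfl, if_pos (by omega)]
    · rw [if_neg h1, if_neg h2, if_neg (by omega), if_neg (by omega)]

end ColumnBraiding

/-! ### Letter operators realized on column words -/

section ColumnRealization

variable {A : Type*} [LinearOrder A] {k : ℕ}

theorem flatten_singletons (w : List A) : (w.map fun a => [a]).flatten = w := by
  simp [← List.flatMap_def]

/-- With one row per letter there is room for the whole tableau, so `norm` leads from the reversed
row reading to the columns. Unlike a bare Knuth equivalence, it does so by swaps whose positions can
be controlled. -/
theorem norm_singletons (T : YT A) :
    norm (fun x y : A => x ≤ y) (T.rowReading.reverse.map fun a => [a]) =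
      List.replicate (T.rowReading.length - T.numCols) [] ++ T.revCols := by
  have := (norm_eq_pad Bumping.le (L := T.rowReading.reverse.map fun a => [a])
    (M := T.revCols) (by simp [Sorted]) T.tab_revCols T.revCols_ne_nil
    (by rw [flatten_singletons]; exact T.ke_revCols)).2
  simpa [YT.length_revCols] using this

theorem map_length_eq_of_pad {m m' : ℕ} {L L' : List (List A)} (hL : ∀ l ∈ L, l ≠ [])
    (hL' : ∀ l ∈ L', l ≠ []) (h : (List.replicate m [] ++ L).map List.length =
      (List.replicate m' [] ++ L').map List.length) :
    L.map List.length = L'.map List.length := by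
  have key : ∀ (m : ℕ) (L : List (List A)), (∀ l ∈ L, l ≠ []) →
      ((List.replicate m [] ++ L).map List.length).filter (fun i => decide (i ≠ 0)) =
        L.map List.length := by
    intro m L hL
    rw [List.map_append, List.filter_append, List.map_replicate,
      List.filter_replicate_of_neg (by simp), List.nil_append, List.filter_eq_self]
    simpa using hL
  rw [← key m L hL, h, key m' L' hL']

/-- The reversed readings, cut into single letters, normalise to the columns by swaps at common
positions, so the column shapes agree and the column words remain parallel. -/
theorem SameQ.revCols {T T' : YT A}
    (hQ : SameQ (fun x y : A => x ≤ y) T.rowReading.reverse T'.rowReading.reverse) :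
    T.revCols.map List.length = T'.revCols.map List.length ∧
      Par (fun x y : A => x ≤ y) T.rowReading.reverse T'.rowReading.reverse
        T.revCols.flatten T'.revCols.flatten := by
  have h := SameQ.norm Bumping.le (L := T.rowReading.reverse.map fun a => [a])
    (L' := T'.rowReading.reverse.map fun a => [a]) (by simp [Sorted]) (by simp [Sorted])
    (by
      have hl := hQ.length_eq
      rw [List.map_map, List.map_map]
      change List.map (fun _ => 1) _ = List.map (fun _ => 1) _
      rw [List.map_const', List.map_const', hl])
    (by rw [flatten_singletons, flatten_singletons]; exact hQ)
  rw [norm_singletons, norm_singletons, flatten_singletons, flatten_singletons, flatten_pad, flatten_pad] at h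
  exact ⟨map_length_eq_of_pad T.revCols_ne_nil T'.revCols_ne_nil h.1, h.2⟩

theorem reverse_codeWord (x : Fin k → DecYT A) :
    (codeWord rowCode (x ∘ Fin.rev)).reverse =
      ((List.finRange k).map fun j => (x j).1.rowReading.reverse).flatten := by
  rw [codeWord_rowCode, List.reverse_flatten, List.ofFn_eq_map, List.map_map, ← List.map_reverse,
    List.finRange_reverse, List.map_map]
  congr 2
  funext j
  simp

theorem codeWord_colCode (x : Fin k → DecYT A) :
    codeWord colCode x = ((List.finRange k).map fun j => (x j).1.revCols.flatten).flatten := by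
  rw [codeWord, List.ofFn_eq_map]
  simp [colCode]

/-- An operator realized on row words is also realized on column words. -/
theorem Realizes.colCode {φ : List A → List A} (hφ : NatOp (fun x y : A => x < y) φ)
    {s : (Fin k → DecYT A) → Fin k → DecYT A} (hs : Realizes rowCode φ s)
    (hα : ∀ x j, (s x j).2 = (x j).2) :
    Realizes colCode (fun w => (φ w.reverse).reverse)
      (fun x => s (x ∘ Fin.rev) ∘ Fin.rev) := by
  have key : ∀ x : Fin k → DecYT A,
      (∀ j, (x j).1.revCols.map List.length =
        (s (x ∘ Fin.rev) (Fin.rev j)).1.revCols.map List.length) ∧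
      codeWord Plactic.colCode (s (x ∘ Fin.rev) ∘ Fin.rev) =
        (φ (codeWord Plactic.colCode x).reverse).reverse := by
    intro x
    have h1 := reverse_codeWord x
    have h2 := reverse_codeWord (s (x ∘ Fin.rev) ∘ Fin.rev)
    have e : (s (x ∘ Fin.rev) ∘ Fin.rev) ∘ Fin.rev = s (x ∘ Fin.rev) := by
      funext j; simp
    rw [e, hs.word] at h2
    have hlen : ∀ j, (x j).1.rowReading.reverse.length =
        (s (x ∘ Fin.rev) (Fin.rev j)).1.rowReading.reverse.length := by
      intro j
      have := length_flatten_congr (hs.shape (x ∘ Fin.rev) (Fin.rev j))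
      simpa [rowCode, YT.rowReading] using this.symm
    -- Reversal makes the operator natural for `≤`. Hence the reversed words of the tuple and of its
    -- image behave alike, and so do their components, which are turned into columns one by one.
    have hQ := hφ.reverse.sameQ (codeWord rowCode (x ∘ Fin.rev)).reverse
    simp only [List.reverse_reverse] at hQ
    rw [h2, h1] at hQ
    have hP := fun j => (SameQ.of_flatten hlen hQ (List.mem_finRange j)).revCols
    refine ⟨fun j => (hP j).1, ?_⟩
    have hpar := Par.flatten hlen (fun j => (hP j).2) (List.finRange k)
    have hfin : ((List.finRange k).map fun j =>
        (s (x ∘ Fin.rev) (Fin.rev j)).1.rowReading.reverse).flatten =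
        (φ ((List.finRange k).map fun j => (x j).1.rowReading.reverse).flatten.reverse).reverse := by
      rw [← h1, List.reverse_reverse, h2]
      rfl
    rw [hfin] at hpar
    rw [codeWord_colCode, codeWord_colCode]
    exact hφ.reverse.eq_of_par hpar
  refine ⟨fun x j => ?_, fun x => (key x).2⟩
  simp only [Plactic.colCode, List.map_append, Function.comp, hα, Fin.rev_rev]
  rw [(key x).1 j]

end ColumnRealization

/-! ### Commutation of the two actions -/

section Commutation

variable {n k : ℕ}

theorem sTuple_sigmaR {i : ℕ} (hi : i + 1 < n) (l : Fin (k - 1)) (x : Fin k → DecYT (Fin n)) :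
    sTuple i hi (applyAt sigmaR l x) = applyAt sigmaR l (sTuple i hi x) :=
  (realizes_sTuple hi).applyAt Bumping.lt rowCode_injective tab_rowCode isCoded_sigmaR
    (natOp_sWord hi) l x

theorem sTuple_sigmaC {i : ℕ} (hi : i + 1 < n) (l : Fin (k - 1)) (x : Fin k → DecYT (Fin n)) :
    sTuple i hi (applyAt sigmaC l x) = applyAt sigmaC l (sTuple i hi x) := by
  -- After reversal of the tuple, `sigmaC` is coded by `sig` for `≤` and the letter operator is
  -- realized on column words, so `Realizes.applyAt` applies as for rows.
  have hs := (realizes_sTuple (k := k) hi).colCode (natOp_sWord hi) (fun _ _ => rfl)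
  have h := hs.applyAt Bumping.le colCode_injective tab_colCode isCoded_sigmaC
    (natOp_sWord hi).reverse (Fin.rev l) (x ∘ Fin.rev)
  have e : ∀ y : Fin k → DecYT (Fin n), (y ∘ Fin.rev) ∘ Fin.rev = y := fun y => by
    funext j; simp
  rw [applyAt_eq_opposite, applyAt_eq_opposite sigmaC l]
  rw [e] at h
  rw [← h, e]

theorem commute_of_generators {M : Type*} [Monoid M] {ρ : Equiv.Perm (Fin n) →* M}
    {β : PosBraidMonoid k →* M}
    (h : ∀ i, i + 1 < n → ∀ l, Commute (ρ (adjSwap n i)) (β (braidGen k l)))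
    (g : Equiv.Perm (Fin n)) (b : PosBraidMonoid k) : Commute (ρ g) (β b) := by
  have hb : b ∈ Submonoid.closure (Set.range (PresentedMonoid.of (BraidRel k))) := by
    rw [PresentedMonoid.closure_range_of]; trivial
  have hg : g ∈ Submonoid.closure {g | ∃ i, i + 1 < n ∧ g = adjSwap n i} := by
    rw [closure_adjSwap]; trivial
  induction hg using Submonoid.closure_induction with
  | mem z hz =>
    obtain ⟨i, hi, rfl⟩ := hz
    induction hb using Submonoid.closure_induction with
    | mem z hz =>
      obtain ⟨l, rfl⟩ := hz
      exact h i hi l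
    | one => rw [map_one]; exact Commute.one_right _
    | mul a b _ _ ha hb => rw [map_mul]; exact ha.mul_right hb
  | one => rw [map_one]; exact Commute.one_left _
  | mul a b _ _ ha hb => rw [map_mul]; exact ha.mul_left hb

theorem exists_braidAction {ρ : Equiv.Perm (Fin n) →* Function.End (Fin k → DecYT (Fin n))}
    (hρ : ∀ i (hi : i + 1 < n), ρ (adjSwap n i) = sTuple i hi)
    {σ : DecYT (Fin n) × DecYT (Fin n) → DecYT (Fin n) × DecYT (Fin n)} (hσ : YangBaxter σ)
    (hcomm : ∀ i (hi : i + 1 < n) (l : Fin (k - 1)) (x : Fin k → DecYT (Fin n)),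
      sTuple i hi (applyAt σ l x) = applyAt σ l (sTuple i hi x)) :
    ∃ β : PosBraidMonoid k →* Function.End (Fin k → DecYT (Fin n)),
      (∀ l : Fin (k - 1), β (braidGen k l) = applyAt σ l) ∧
      ∀ (g : Equiv.Perm (Fin n)) (b : PosBraidMonoid k) (x : Fin k → DecYT (Fin n)),
        ρ g (β b x) = β b (ρ g x) := by
  obtain ⟨β, hβ⟩ := exists_hom_of_yangBaxter (k := k) hσ
  refine ⟨β, hβ, fun g b x =>
    congrFun (commute_of_generators (ρ := ρ) (β := β) (fun i hi l => ?_) g b).eq x⟩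
  rw [hρ i hi, hβ]
  exact funext fun x => hcomm i hi l x

end Commutation

end Plactic

theorem theoremT (n k : ℕ) (hn : 0 < n) (hk : 0 < k) :
    -- the operators `σ_R` and `σ_C` are those uniquely defined by their characterizing conditions
    (∀ p q : Plactic.DecYT (Fin n) × Plactic.DecYT (Fin n),
      q = Plactic.sigmaR p ↔
        Plactic.IsSigmaR p.1.1 p.1.2 p.2.1 p.2.2 q.1.1 q.1.2 q.2.1 q.2.2) ∧
    (∀ p q : Plactic.DecYT (Fin n) × Plactic.DecYT (Fin n),
      q = Plactic.sigmaC p ↔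
        Plactic.IsSigmaC p.1.1 p.1.2 p.2.1 p.2.2 q.1.1 q.1.2 q.2.1 q.2.2) ∧
    -- the action of the symmetric group via the letter permuting operators
    ∃ ρ : Equiv.Perm (Fin n) →* Function.End (Fin k → Plactic.DecYT (Fin n)),
      (∀ (i : ℕ) (hi : i + 1 < n),
        ρ (Equiv.swap ⟨i, Nat.lt_of_succ_lt hi⟩ ⟨i + 1, hi⟩) = Plactic.sTuple i hi) ∧
      -- the action of the positive braid monoid via `σ_R` commutes with it
      (∃ βR : Plactic.PosBraidMonoid k →* Function.End (Fin k → Plactic.DecYT (Fin n)),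
        (∀ l : Fin (k - 1),
          βR (Plactic.braidGen k l) = Plactic.applyAt Plactic.sigmaR l) ∧
        ∀ (g : Equiv.Perm (Fin n)) (b : Plactic.PosBraidMonoid k)
          (x : Fin k → Plactic.DecYT (Fin n)), ρ g (βR b x) = βR b (ρ g x)) ∧
      -- the action of the positive braid monoid via `σ_C` commutes with it
      (∃ βC : Plactic.PosBraidMonoid k →* Function.End (Fin k → Plactic.DecYT (Fin n)),
        (∀ l : Fin (k - 1),
          βC (Plactic.braidGen k l) = Plactic.applyAt Plactic.sigmaC l) ∧
        ∀ (g : Equiv.Perm (Fin n)) (b : Plactic.PosBraidMonoid k)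
          (x : Fin k → Plactic.DecYT (Fin n)), ρ g (βC b x) = βC b (ρ g x)) := by
  obtain ⟨ρ, hρ⟩ := Plactic.exists_hom_of_coxeterRel (Plactic.coxeterRel_permuting n k)
  have hρ' : ∀ i (hi : i + 1 < n), ρ (Plactic.adjSwap n i) = Plactic.sTuple i hi :=
    fun i hi => (hρ i hi).trans (Plactic.permuting_of_lt hi)
  refine ⟨Plactic.eq_sigmaR_iff, Plactic.eq_sigmaC_iff, ρ, fun i hi => ?_, ?_, ?_⟩
  · rw [← hρ' i hi, Plactic.adjSwap, dif_pos hi]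
  · exact Plactic.exists_braidAction hρ' (Plactic.isCoded_sigmaR.yangBaxter Plactic.Bumping.lt
      Plactic.rowCode_injective Plactic.tab_rowCode) fun _ => Plactic.sTuple_sigmaR
  · exact Plactic.exists_braidAction hρ' (Plactic.isCoded_sigmaC.yangBaxter Plactic.Bumping.le
      Plactic.colCode_injective Plactic.tab_colCode).of_opposite fun _ => Plactic.sTuple_sigmaC
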